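/- Let $\eta_0>0$. For $\xi,\eta\in\mathbb R$ let $x(\xi,\eta)=\left(\tfrac12(\xi^2-\eta^2),\,\xi\eta\right)$, and let $\mathcal P_{\eta_0}=\{x(\xi,\eta_0):\xi\in\mathbb R\}$. For a continuous $f:\mathbb R^2\to\mathbb R$ put $$(\mathcal Rf)(x,r)=\int_{-\pi}^{\pi}f(x+re^{i\theta})\,r\,d\theta\qquad(x\in\mathbb R^2,\ r\ge 0).$$ Let $K_0(t)=\int_0^\infty e^{-t\cosh u}\,du$ $(t>0)$ be the modified Bessel function of the second kind of order zero, $H_m(x)=(-1)^me^{x^2}\frac{d^m}{dx^m}e^{-x^2}$ the Hermite polynomials, $H_{-m-1}(z)=\frac1{m!}\int_0^\infty t^m e^{-t^2-2tz}\,dt$ the Hermite functions of negative integer order, and $(\mathcal MF)(s)=\int_0^\infty y^{s-1}F(y)\,dy$ the Mellin transform. **Theorem 2.1.** Let $f:\mathbb R^2\to\mathbb R$ be continuous with compact support, and suppose that $f(x(\xi,\eta))=0$ for all $\xi\in\mathbb R$, $\eta\ge\eta_0$. For $m\ge 0$ and $k>0$ define, from the data of $\mathcal Rf$ on $\mathcal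 P_{\eta_0}\times[0,\infty)$, $$(\Lambda_mf)(k)=\frac{\sqrt k\,e^{\frac k2\eta_0^2}}{2^m m!\sqrt\pi\,H_{-m-1}(\sqrt k\,\eta_0)}\int_{-\infty}^{\infty}\int_0^\infty(\mathcal Rf)(x(\xi,\eta_0),r)\,K_0(kr)\,H_m(\sqrt k\,\xi)\,e^{-\frac k2\xi^2}\,dr\,d\xi,$$ and for $\xi\in\mathbb R$, $\eta\ge\eta_0$, $k>0$ $$\Psi(\xi,\eta,k)=e^{-\frac k2(\eta^2+\xi^2)}\sum_{m=0}^\infty H_m(\sqrt k\,\xi)\,H_{-m-1}(\sqrt k\,\eta)\,(\Lambda_mf)(k).$$ Then the double integrals in $\Lambda_m f$, the series for $\Psi$, and, for $0<\operatorname{Re}s<1$, the Mellin transform $(\mathcal M\Psi)(\xi,\eta,1-s)$ of $\Psi$ in the variable $k$ all converge absolutely. For every $\xi\in\mathbb R$ and $\eta\ge\eta_0$ we have $(\mathcal Rf)(x(\xi,\eta),0)=0$, and for every $r>0$ and every $\sigma\in(0,1)$ $$(\mathcal Rf)(x(\xi,\eta),r)=\frac1{i\pi}\int_{\sigma-i\infty}^{\sigma+i\infty}\frac{2^s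 r^{-s}\,(\mathcal M\Psi)(\xi,\eta,1-s)}{\Gamma^2((1-s)/2)}\,ds .$$ Here the contour integral of the integrand $G$ is taken in the Cesàro sense, $\lim_{T\to\infty}\frac1T\int_0^T\left(\int_{\sigma-i\tau}^{\sigma+i\tau}G(s)\,ds\right)d\tau$, and this limit exists. Moreover, the formula also holds with the ordinary symmetric improper integral $\lim_{T\to\infty}\int_{\sigma-iT}^{\sigma+iT}G(s)\,ds$ whenever that limit exists; and it does exist at every $r>0$ for which the difference quotient $\rho\mapsto\dfrac{(\mathcal Rf)(x(\xi,\eta),\rho)-(\mathcal Rf)(x(\xi,\eta),r)}{\rho-r}$ is Lebesgue integrable on a neighbourhood of $r$. -/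

import Mathlib

open Set Filter Topology MeasureTheory

namespace ParabolaMeans

noncomputable section

/-- The point of the plane with parabolic coordinates `(ξ, η)`, namely
`((ξ² - η²) / 2, ξ η)`. The plane `ℝ²` is identified with `ℂ`, as is done when
circles are written as `x + r e^{iθ}`. -/
def parabolicPoint (ξ η : ℝ) : ℂ := ⟨(ξ ^ 2 - η ^ 2) / 2, ξ * η⟩

/-- The spherical mean transform: the integral of `f` over the circle with centre `x` and
radius `r`, with respect to arc length `r dθ`. -/
def sphericalMean (f : ℂ → ℝ) (x : ℂ) (r : ℝ) : ℝ :=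
  ∫ θ in (-Real.pi)..Real.pi, f (x + (r : ℂ) * Complex.exp ((θ : ℂ) * Complex.I)) * r

/-- The modified Bessel function of the second kind of order zero, on `x > 0`:
`K₀(x) = ∫_0^∞ exp (-x cosh t) dt`. -/
def besselK0 (x : ℝ) : ℝ := ∫ t in Ioi (0 : ℝ), Real.exp (-x * Real.cosh t)

/-- The (physicists') Hermite polynomial `H_n`, by Rodrigues' formula. -/
def hermitePoly (n : ℕ) (x : ℝ) : ℝ :=
  (-1) ^ n * Real.exp (x ^ 2) * iteratedDeriv n (fun y : ℝ => Real.exp (-y ^ 2)) x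

/-- The Hermite function `H_ν` of negative real order `ν < 0`:
`H_ν(z) = Γ(-ν)⁻¹ ∫_0^∞ t^{-ν-1} exp (-t² - 2tz) dt`. -/
def hermiteNeg (ν z : ℝ) : ℝ :=
  (Real.Gamma (-ν))⁻¹ * ∫ t in Ioi (0 : ℝ), t ^ (-ν - 1) * Real.exp (-t ^ 2 - 2 * t * z)

/-- The integrand `D(ξ, r) K₀(kr) H_m(√k ξ) exp (-k ξ² / 2)` of the `m`-th Hermite moment
of the data `D`. -/
def momentIntegrand (D : ℝ → ℝ → ℝ) (m : ℕ) (k ξ r : ℝ) : ℝ :=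
  D ξ r * besselK0 (k * r) * hermitePoly m (Real.sqrt k * ξ) * Real.exp (-(k / 2) * ξ ^ 2)

/-- The coefficient `(Λ_m f)(k)`, as a function of the data
`D(ξ, r) = (R f)(x(ξ, η₀), r)` on the parabola only. -/
def lambdaCoeff (D : ℝ → ℝ → ℝ) (η₀ : ℝ) (m : ℕ) (k : ℝ) : ℝ :=
  Real.sqrt k * Real.exp (k / 2 * η₀ ^ 2) /
      (2 ^ m * (m.factorial : ℝ) * Real.sqrt Real.pi *
        hermiteNeg (-(m : ℝ) - 1) (Real.sqrt k * η₀)) *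
    ∫ ξ : ℝ, ∫ r in Ioi (0 : ℝ), momentIntegrand D m k ξ r

/-- The `m`-th term `H_m(√k ξ) H_{-m-1}(√k η) (Λ_m f)(k)` of the Hermite series. -/
def psiTerm (D : ℝ → ℝ → ℝ) (η₀ ξ η k : ℝ) (m : ℕ) : ℝ :=
  hermitePoly m (Real.sqrt k * ξ) * hermiteNeg (-(m : ℝ) - 1) (Real.sqrt k * η) *
    lambdaCoeff D η₀ m k

/-- The function `Ψ(ξ, η, k)`. -/
def psi (D : ℝ → ℝ → ℝ) (η₀ ξ η k : ℝ) : ℝ :=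
  Real.exp (-(k / 2) * (η ^ 2 + ξ ^ 2)) * ∑' m : ℕ, psiTerm D η₀ ξ η k m

/-- The integrand `2^s r^{-s} (M Ψ)(ξ, η, 1 - s) / Γ²((1 - s) / 2)` of the inverse Mellin
integral; the Mellin transform is taken in the variable `k`. -/
def inversionIntegrand (D : ℝ → ℝ → ℝ) (η₀ ξ η r : ℝ) (s : ℂ) : ℂ :=
  (2 : ℂ) ^ s * (r : ℂ) ^ (-s) * mellin (fun k : ℝ => (psi D η₀ ξ η k : ℂ)) (1 - s) /
    Complex.Gamma ((1 - s) / 2) ^ 2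

/-- The truncated contour integral `∫_{σ - iT}^{σ + iT} G(s) ds`. -/
def segmentIntegral (G : ℂ → ℂ) (σ T : ℝ) : ℂ :=
  Complex.I * ∫ t in (-T)..T, G ((σ : ℂ) + (t : ℂ) * Complex.I)

/-- `∫_{σ - i∞}^{σ + i∞} G(s) ds` converges to `A` as a symmetric improper integral,
i.e. `∫_{σ - iT}^{σ + iT} G(s) ds → A` as `T → ∞`. -/
def HasLineIntegral (G : ℂ → ℂ) (σ : ℝ) (A : ℂ) : Prop :=
  (∀ T : ℝ, IntervalIntegrable (fun t : ℝ => G ((σ : ℂ) + (t : ℂ) * Complex.I)) volume (-T) T) ∧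
    Tendsto (fun T : ℝ => segmentIntegral G σ T) atTop (𝓝 A)

/-- `∫_{σ - i∞}^{σ + i∞} G(s) ds` equals `A` as a Cesàro (C,1) integral: the averages over
`τ ∈ [0, T]` of the truncated integrals `∫_{σ - iτ}^{σ + iτ} G(s) ds` tend to `A` as
`T → ∞`. This agrees with the symmetric improper integral whenever the latter converges. -/
def HasCesaroLineIntegral (G : ℂ → ℂ) (σ : ℝ) (A : ℂ) : Prop :=
  (∀ T : ℝ, IntervalIntegrable (fun t : ℝ => G ((σ : ℂ) + (t : ℂ) * Complex.I)) volume (-T) T) ∧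
    Tendsto (fun T : ℝ => (T : ℂ)⁻¹ * ∫ τ in (0 : ℝ)..T, segmentIntegral G σ τ) atTop (𝓝 A)

end

end ParabolaMeans

open ParabolaMeans

namespace ParabolaMeans

/-! Multiplying (Rf)(x, r) by K₀(kr) and integrating in r gives, in polar coordinates about x, the
potential u_k(x) = ∫ f(y) K₀(k|x-y|) dy. Where f vanishes, u_k solves the modified Helmholtz
equation, which separates in parabolic coordinates into the products e^{-k(ξ²+η²)/2} H_m(√k ξ)
H_{-m-1}(√k η). Its values on η = η₀ determine the coefficients by Hermite orthogonality, hence u_k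
for all η ≥ η₀, and Ψ = u_k. Put Φ = (Rf)(x, ·). A Mellin transform in k turns the K₀ transform into
a product, MΨ(1-s) = MK₀(1-s) · MΦ(s), and Mellin inversion recovers Φ.

No differential equation is used: the separated expansion is proved for the kernel itself. As x(ξ,
η) = (ξ + iη)²/2, the distance |x(ξ, η) - x(a, b)| is AB/2 with A² = (ξ-a)² + (η-b)² and B² = (ξ+a)²
+ (η+b)², and K₀(AB/2) = ∫ exp(-(A²e^{2v} + B²e^{-2v})/4) dv. The integrand splits into a Mehler
kernel in (ξ, a) with parameter tanh v (`hasSum_mehler`) and a factor in (η, b) whose moments are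
multiples of H_{-m-1}(η) (`tanhMoment_eq`, by comparing generating functions). This yields the
expansion (`sum_abs_kernel_le`) and the extraction of its coefficients
(`integral_besselK0_mul_hermitePoly`). Integrating against f up to the boundary case η = η₀ needs a
majorant that blows up at the parabola but stays integrable (`integrable_parabolaWeight`,
`hasSum_potential`).

The substitution ρ = r e^v makes Mellin inversion a Fourier inversion at 0. Since Φ is only known to
be continuous, the general statement is Fejér's (`tendsto_cesaro_fourierInt`); Dini's test
(`tendsto_fourierInt_of_dini`) gives ordinary convergence. -/

/-! ### Term-by-term integration -/

theorem hasSum_of_eq {E : Type*} [AddCommMonoid E] [TopologicalSpace E] {f g : ℕ → E} {a b : E}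
    (h : HasSum f a) (hfg : ∀ n, f n = g n) (hab : a = b) : HasSum g b := by
  rwa [← funext hfg, ← hab]

/-- A bound on the partial sums of norms by one integrable function gives Σ ∫ ‖F n‖ ≤ ∫ G. Every
interchange of a series with an integral below goes through this form, because the majorants come
from closed-form generating functions. -/
theorem hasSum_integral_of_sum_norm_le {α E : Type*} [MeasurableSpace α] {μ : Measure α}
    [NormedAddCommGroup E] [NormedSpace ℝ E] {F : ℕ → α → E} {G : α → ℝ} {S : α → E}
    (hF : ∀ n, AEStronglyMeasurable (F n) μ) (hG : Integrable G μ)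
    (hle : ∀ᵐ x ∂μ, ∀ N, ∑ n ∈ Finset.range N, ‖F n x‖ ≤ G x)
    (hS : ∀ᵐ x ∂μ, HasSum (fun n => F n x) (S x)) :
    (∀ n, Integrable (F n) μ) ∧ HasSum (fun n => ∫ x, F n x ∂μ) (∫ x, S x ∂μ) := by
  have hint : ∀ n, Integrable (F n) μ := fun n => by
    refine hG.mono' (hF n) ?_
    filter_upwards [hle] with x hx
    exact (Finset.single_le_sum (f := fun n => ‖F n x‖) (fun i _ => norm_nonneg _)
      (Finset.mem_range.2 (Nat.lt_succ_self n))).trans (hx (n + 1))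
  refine ⟨hint, ?_⟩
  have hsm : Summable fun n => ∫ x, ‖F n x‖ ∂μ := by
    refine summable_of_sum_range_le (c := ∫ x, G x ∂μ)
      (fun n => integral_nonneg fun x => norm_nonneg _) fun N => ?_
    rw [← integral_finsetSum _ fun n _ => (hint n).norm]
    refine integral_mono_ae (integrable_finsetSum _ fun n _ => (hint n).norm) hG ?_
    filter_upwards [hle] with x hx using hx N
  have h := hasSum_integral_of_summable_integral_norm hint hsm
  rwa [integral_congr_ae (g := S)] at h
  filter_upwards [hS] with x hx using hx.tsum_eq

/-! ### Uniqueness of power series coefficients -/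

/-- The formal power series in one real variable with the given coefficients. -/
noncomputable def coeffSeries {E : Type*} [NormedAddCommGroup E] [NormedSpace ℝ E] (c : ℕ → E) :
    FormalMultilinearSeries ℝ ℝ E :=
  fun n => ContinuousMultilinearMap.mkPiRing ℝ (Fin n) (c n)

theorem coeff_coeffSeries {E : Type*} [NormedAddCommGroup E] [NormedSpace ℝ E] (c : ℕ → E)
    (n : ℕ) : (coeffSeries c).coeff n = c n := by
  simp [FormalMultilinearSeries.coeff, coeffSeries]

theorem hasFPowerSeriesAt_coeffSeries {E : Type*} [NormedAddCommGroup E] [NormedSpace ℝ E]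
    {c : ℕ → E} {g : ℝ → E} {x r : ℝ} (hr : 0 < r)
    (hc : ∀ t : ℝ, |t| < r → HasSum (fun n => t ^ n • c n) (g (x + t))) :
    HasFPowerSeriesAt g (coeffSeries c) x := by
  refine hasFPowerSeriesAt_iff.2 ?_
  filter_upwards [Metric.ball_mem_nhds (0 : ℝ) hr] with t ht
  simpa [coeff_coeffSeries] using hc t (by simpa using ht)

/-- Identities indexed by m are obtained below by computing one generating function in two ways and
comparing coefficients. -/
theorem powerSeries_coeff_unique {E : Type*} [NormedAddCommGroup E] [NormedSpace ℝ E]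
    {a b : ℕ → E} {g : ℝ → E} {r : ℝ} (hr : 0 < r)
    (ha : ∀ t : ℝ, |t| < r → HasSum (fun n => t ^ n • a n) (g t))
    (hb : ∀ t : ℝ, |t| < r → HasSum (fun n => t ^ n • b n) (g t)) : a = b := by
  have h := (hasFPowerSeriesAt_coeffSeries (x := 0) hr
    (by simpa using ha)).eq_formalMultilinearSeries
    (hasFPowerSeriesAt_coeffSeries (x := 0) hr (by simpa using hb))
  funext n
  have := congrArg (fun p => FormalMultilinearSeries.coeff p n) h
  simpa only [coeff_coeffSeries] using this

/-! ### Hermite polynomials through their generating function -/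

/-- The coefficients of the even series `exp (ε t²)`. -/
noncomputable def gaussCoeff (ε : ℝ) (j : ℕ) : ℝ :=
  if Even j then ε ^ (j / 2) / ((j / 2).factorial : ℝ) else 0

/-- The coefficients of the power series of `exp (2 x t + ε t²)` in `t`. -/
noncomputable def hermiteCoeff (ε x : ℝ) (m : ℕ) : ℝ :=
  ∑ p ∈ Finset.HasAntidiagonal.antidiagonal m, (2 * x) ^ p.1 / (p.1.factorial : ℝ) * gaussCoeff ε p.2

theorem hasSum_gaussCoeff (ε : ℝ) (T : ℂ) :
    HasSum (fun j => (gaussCoeff ε j : ℂ) * T ^ j) (Complex.exp (ε * T ^ 2)) := by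
  have h := NormedSpace.expSeries_div_hasSum_exp (𝔸 := ℂ) ((ε : ℂ) * T ^ 2)
  rw [← Complex.exp_eq_exp_ℂ] at h
  have hinj : Function.Injective fun n : ℕ => 2 * n :=
    fun a b (h : 2 * a = 2 * b) => by omega
  rw [← hinj.hasSum_iff]
  · refine hasSum_of_eq h (fun n => ?_) rfl
    simp [gaussCoeff, mul_pow, pow_mul]
    ring
  · intro j hj
    have : ¬ Even j := fun ⟨k, hk⟩ => hj ⟨k, by simp; omega⟩
    simp [gaussCoeff, this]

theorem hasSum_hermiteCoeff (ε x : ℝ) (T : ℂ) :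
    HasSum (fun m => (hermiteCoeff ε x m : ℂ) * T ^ m)
      (Complex.exp (2 * x * T + ε * T ^ 2)) := by
  have h1 := NormedSpace.expSeries_div_hasSum_exp (𝔸 := ℂ) (2 * x * T)
  rw [← Complex.exp_eq_exp_ℂ] at h1
  have h2 := hasSum_gaussCoeff ε T
  have s1 : Summable fun n => ‖(2 * x * T) ^ n / (n.factorial : ℂ)‖ := h1.summable.norm
  have s2 := h2.summable.norm
  have h := tsum_mul_tsum_eq_tsum_sum_antidiagonal_of_summable_norm s1 s2
  have hs := (summable_norm_sum_mul_antidiagonal_of_summable_norm s1 s2).of_norm.hasSum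
  rw [← h, h1.tsum_eq, h2.tsum_eq, ← Complex.exp_add] at hs
  refine hasSum_of_eq hs (fun m => ?_) rfl
  rw [hermiteCoeff, Complex.ofReal_sum, Finset.sum_mul]
  refine Finset.sum_congr rfl fun p hp => ?_
  rw [← Finset.HasAntidiagonal.mem_antidiagonal.1 hp, pow_add]
  push_cast
  rw [mul_pow (2 * (x : ℂ)) T]
  ring

theorem hasSum_hermiteCoeff_real (ε x t : ℝ) :
    HasSum (fun m => hermiteCoeff ε x m * t ^ m) (Real.exp (2 * x * t + ε * t ^ 2)) := by
  have h := hasSum_hermiteCoeff ε x t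
  exact_mod_cast h

/-- Changing ε from -1 to 1 removes all cancellation, so exp(2|x|t + t²) majorises the Hermite
generating series. -/
theorem abs_hermiteCoeff_le (x : ℝ) (m : ℕ) :
    |hermiteCoeff (-1) x m| ≤ hermiteCoeff 1 |x| m := by
  refine (Finset.abs_sum_le_sum_abs _ _).trans (Finset.sum_le_sum fun p _ => ?_)
  rw [abs_mul, abs_div, abs_pow, abs_mul, abs_two, Nat.abs_cast]
  gcongr
  rw [gaussCoeff, gaussCoeff]
  split_ifs <;> simp [abs_div]

theorem gaussCoeff_one_nonneg (m : ℕ) : 0 ≤ gaussCoeff 1 m := by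
  rw [gaussCoeff]; split_ifs <;> positivity

theorem abs_hermiteCoeff_one_le (x : ℝ) (m : ℕ) :
    |hermiteCoeff 1 x m| ≤ hermiteCoeff 1 |x| m := by
  refine (Finset.abs_sum_le_sum_abs _ _).trans (Finset.sum_le_sum fun p _ => ?_)
  rw [abs_mul, abs_div, abs_pow, abs_mul, abs_two, Nat.abs_cast,
    abs_of_nonneg (gaussCoeff_one_nonneg _)]

theorem hermiteCoeff_one_nonneg {x : ℝ} (hx : 0 ≤ x) (m : ℕ) : 0 ≤ hermiteCoeff 1 x m := by
  refine Finset.sum_nonneg fun p _ => ?_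
  have := gaussCoeff_one_nonneg p.2
  positivity

theorem sum_hermiteCoeff_one_le {x t : ℝ} (hx : 0 ≤ x) (ht : 0 ≤ t) (N : ℕ) :
    ∑ m ∈ Finset.range N, hermiteCoeff 1 x m * t ^ m ≤ Real.exp (2 * x * t + t ^ 2) := by
  have h := hasSum_hermiteCoeff_real 1 x t
  rw [one_mul] at h
  exact sum_le_hasSum _ (fun m _ => mul_nonneg (hermiteCoeff_one_nonneg hx m) (by positivity)) h

@[fun_prop]
theorem continuous_hermiteCoeff (ε : ℝ) (m : ℕ) : Continuous fun x => hermiteCoeff ε x m := by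
  unfold hermiteCoeff
  fun_prop

/-- From exp(-(x+t)²) = exp(-x²) exp(-2xt - t²): the Taylor coefficients of the Gaussian at x are
read off from the generating function at -t. -/
theorem hermitePoly_eq (n : ℕ) (x : ℝ) :
    hermitePoly n x = (n.factorial : ℝ) * hermiteCoeff (-1) x n := by
  have hA : AnalyticAt ℝ (fun y : ℝ => Real.exp (-y ^ 2)) x := by fun_prop
  have h1 := hA.hasFPowerSeriesAt
  have h2 : HasFPowerSeriesAt (fun y : ℝ => Real.exp (-y ^ 2))
      (coeffSeries fun n => (-1) ^ n * hermiteCoeff (-1) x n * Real.exp (-x ^ 2)) x := by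
    refine hasFPowerSeriesAt_coeffSeries zero_lt_one fun t _ => ?_
    have h := (hasSum_hermiteCoeff_real (-1) x (-t)).mul_right (Real.exp (-x ^ 2))
    rw [← Real.exp_add] at h
    refine hasSum_of_eq h (fun m => ?_) ?_
    · rw [neg_pow t, smul_eq_mul]; ring
    · congr 1; ring
  have h := congrArg (fun p => FormalMultilinearSeries.coeff p n)
    (h1.eq_formalMultilinearSeries h2)
  simp only [coeff_coeffSeries, FormalMultilinearSeries.coeff_ofScalars] at h
  have hn : (n.factorial : ℝ) ≠ 0 := by positivity
  rw [hermitePoly, (div_eq_iff hn).1 h]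
  have h3 : Real.exp (x ^ 2) * Real.exp (-x ^ 2) = 1 := by rw [← Real.exp_add]; simp
  have h4 : ((-1 : ℝ)) ^ n * (-1) ^ n = 1 := by rw [← mul_pow]; simp
  linear_combination (n.factorial * hermiteCoeff (-1) x n * Real.exp (x ^ 2) *
    Real.exp (-x ^ 2)) * h4 + (n.factorial * hermiteCoeff (-1) x n) * h3

@[fun_prop]
theorem continuous_hermitePoly (n : ℕ) : Continuous (hermitePoly n) := by
  have : hermitePoly n = fun x => (n.factorial : ℝ) * hermiteCoeff (-1) x n :=
    funext (hermitePoly_eq n)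
  rw [this]
  fun_prop

/-! ### Gaussian integrals and Mehler's formula -/

theorem integrable_exp_quadratic {b : ℝ} (hb : b < 0) (c d : ℝ) :
    Integrable fun s : ℝ => Real.exp (b * s ^ 2 + c * s + d) := by
  have h := (integrable_cexp_quadratic (b := (-b : ℝ)) (by simpa using hb) c d).norm
  refine h.congr (Eventually.of_forall fun s => ?_)
  simp only [Complex.norm_exp]
  congr 1
  rw [← Complex.ofReal_re (b * s ^ 2 + c * s + d)]
  push_cast
  ring_nf

theorem integrable_exp_quadratic_abs {b : ℝ} (hb : b < 0) (c d : ℝ) :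
    Integrable fun s : ℝ => Real.exp (b * s ^ 2 + c * |s| + d) := by
  refine ((integrable_exp_quadratic hb c d).add (integrable_exp_quadratic hb (-c) d)).mono'
    (by fun_prop) (Eventually.of_forall fun s => ?_)
  rw [Real.norm_eq_abs, Real.abs_exp, Pi.add_apply]
  rcases abs_cases s with ⟨h, _⟩ | ⟨h, _⟩ <;> rw [h]
  · have := Real.exp_pos (b * s ^ 2 + -c * s + d)
    linarith
  · have h1 := Real.exp_pos (b * s ^ 2 + c * s + d)
    rw [show c * -s = -c * s by ring]
    linarith

theorem integral_exp_quadratic {b : ℝ} (hb : b < 0) (c d : ℝ) :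
    ∫ s : ℝ, Real.exp (b * s ^ 2 + c * s + d) =
      Real.sqrt (Real.pi / -b) * Real.exp (d - c ^ 2 / (4 * b)) := by
  have h := integral_cexp_quadratic (b := (b : ℂ)) (by simpa using hb) c d
  have h2 : ((Real.pi : ℂ) / -(b : ℂ)) ^ (1 / 2 : ℂ) = (Real.sqrt (Real.pi / -b) : ℝ) := by
    rw [Real.sqrt_eq_rpow, Complex.ofReal_cpow (div_nonneg Real.pi_pos.le (by linarith))]
    push_cast; rfl
  rw [h2] at h
  have h3 : ∀ s : ℝ, Complex.exp ((b : ℂ) * s ^ 2 + c * s + d) =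
      ((Real.exp (b * s ^ 2 + c * s + d) : ℝ) : ℂ) := fun s => by push_cast; rfl
  simp_rw [h3] at h
  rw [integral_complex_ofReal] at h
  exact_mod_cast h

theorem norm_add_mul_I_le (y s : ℝ) : ‖(y : ℂ) + s * Complex.I‖ ≤ |y| + |s| := by
  refine (norm_add_le _ _).trans ?_
  simp

theorem sum_pow_div_factorial_le_exp {x : ℝ} (hx : 0 ≤ x) (N : ℕ) :
    ∑ m ∈ Finset.range N, x ^ m / (m.factorial : ℝ) ≤ Real.exp x := by
  have h := NormedSpace.expSeries_div_hasSum_exp (𝔸 := ℝ) x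
  rw [← Real.exp_eq_exp_ℝ] at h
  exact sum_le_hasSum _ (fun m _ => by positivity) h

/-- Both sides have the same generating function in t, since ∫ e^{2t(y+is)} e^{-s²} ds = √π e^{2ty -
t²}. Writing H_m as a moment makes Mehler's bilinear sum a linear one. -/
theorem integral_hermite_moment (y : ℝ) (m : ℕ) :
    Integrable (fun s : ℝ => (2 * ((y : ℂ) + s * Complex.I)) ^ m * Real.exp (-s ^ 2)) ∧
    ∫ s : ℝ, (2 * ((y : ℂ) + s * Complex.I)) ^ m * Real.exp (-s ^ 2) =
      Real.sqrt Real.pi * (m.factorial * hermiteCoeff (-1) y m) := by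
  set c : ℕ → ℂ := fun m => ∫ s : ℝ, (2 * ((y : ℂ) + s * Complex.I)) ^ m /
    (m.factorial : ℂ) * Real.exp (-s ^ 2) with hc
  have key : ∀ t : ℝ, (∀ n, Integrable fun s : ℝ => (t : ℂ) ^ n *
      ((2 * ((y : ℂ) + s * Complex.I)) ^ n / (n.factorial : ℂ) * Real.exp (-s ^ 2))) ∧
      HasSum (fun n => t ^ n • c n)
      (Real.sqrt Real.pi * Complex.exp (2 * y * t + (-1 : ℝ) * (t : ℂ) ^ 2)) := by
    intro t
    have h := hasSum_integral_of_sum_norm_le (μ := volume)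
      (F := fun n (s : ℝ) => (t : ℂ) ^ n * ((2 * ((y : ℂ) + s * Complex.I)) ^ n /
        (n.factorial : ℂ) * Real.exp (-s ^ 2)))
      (G := fun s => Real.exp ((-1) * s ^ 2 + (2 * |t|) * |s| + 2 * |t| * |y|))
      (S := fun s => Complex.exp ((-1 : ℂ) * s ^ 2 + (2 * t * Complex.I) * s + 2 * t * y))
      (fun n => by fun_prop) (integrable_exp_quadratic_abs (by norm_num) _ _)
      (Eventually.of_forall fun s N => ?_) (Eventually.of_forall fun s => ?_)
    · refine ⟨h.1, hasSum_of_eq h.2 (fun n => ?_) ?_⟩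
      · rw [integral_const_mul, hc, Complex.real_smul, Complex.ofReal_pow]
      · rw [integral_cexp_quadratic (by norm_num)]
        congr 1
        · rw [Real.sqrt_eq_rpow, Complex.ofReal_cpow Real.pi_pos.le]
          push_cast; norm_num
        · congr 1
          push_cast
          linear_combination (-(t : ℂ) ^ 2) * (- Complex.I_sq)
    · have hn : ∀ n, ‖(t : ℂ) ^ n * ((2 * ((y : ℂ) + s * Complex.I)) ^ n /
        (n.factorial : ℂ) * Real.exp (-s ^ 2))‖ =
        (|t| * (2 * ‖(y : ℂ) + s * Complex.I‖)) ^ n / (n.factorial : ℝ) *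
          Real.exp (-s ^ 2) := fun n => by
        rw [norm_mul, norm_mul, norm_div, norm_pow, norm_pow, norm_mul, Complex.norm_real,
          Complex.norm_real, Complex.norm_natCast, Real.norm_eq_abs, Real.norm_eq_abs,
          Real.abs_exp, mul_pow |t|]
        norm_num
        ring
      simp_rw [hn]
      rw [← Finset.sum_mul]
      refine (mul_le_mul_of_nonneg_right
        (sum_pow_div_factorial_le_exp (by positivity) N) (Real.exp_pos _).le).trans ?_
      rw [← Real.exp_add]
      refine Real.exp_le_exp.2 ?_
      nlinarith [norm_add_mul_I_le y s, abs_nonneg t,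
        mul_le_mul_of_nonneg_left (norm_add_mul_I_le y s) (abs_nonneg t)]
    · have h := (NormedSpace.expSeries_div_hasSum_exp (𝔸 := ℂ)
        (t * (2 * ((y : ℂ) + s * Complex.I)))).mul_right ((Real.exp (-s ^ 2) : ℝ) : ℂ)
      rw [← Complex.exp_eq_exp_ℂ] at h
      refine hasSum_of_eq h (fun n => ?_) ?_
      · rw [mul_pow]; ring
      · push_cast
        rw [← Complex.exp_add]
        congr 1; ring
  have hcoef : c = fun n => ((Real.sqrt Real.pi * hermiteCoeff (-1) y n : ℝ) : ℂ) := by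
    refine powerSeries_coeff_unique zero_lt_one (fun t _ => (key t).2) fun t _ => ?_
    refine hasSum_of_eq ((hasSum_hermiteCoeff (-1) y t).mul_left (Real.sqrt Real.pi : ℂ))
      (fun n => ?_) rfl
    rw [Complex.real_smul]; push_cast; ring
  have hm : (m.factorial : ℂ) ≠ 0 := by exact_mod_cast m.factorial_ne_zero
  have e : ∀ s : ℝ, (2 * ((y : ℂ) + s * Complex.I)) ^ m * Real.exp (-s ^ 2) =
      m.factorial * ((2 * ((y : ℂ) + s * Complex.I)) ^ m / (m.factorial : ℂ) *
        Real.exp (-s ^ 2)) := fun s => by field_simp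
  simp_rw [e]
  refine ⟨?_, ?_⟩
  · have := (key 1).1 m
    simp only [Complex.ofReal_one, one_pow, one_mul] at this
    exact this.const_mul _
  · rw [integral_const_mul]
    have := congrFun hcoef m
    simp only [hc] at this
    rw [this]; push_cast; ring

/-- Mehler's formula, with the parameter written as a hyperbolic tangent. -/
theorem hasSum_mehler (x y v : ℝ) :
    HasSum (fun m => hermitePoly m x * hermitePoly m y / (2 ^ m * m.factorial) *
        Real.tanh v ^ m)
      (Real.cosh v *
        Real.exp (x * y * Real.sinh (2 * v) - (x ^ 2 + y ^ 2) * Real.sinh v ^ 2)) := by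
  have hC := Real.cosh_pos v
  have hCS := Real.cosh_sq_sub_sinh_sq v
  set u := Real.tanh v with hu
  have hu' : u = Real.sinh v / Real.cosh v := Real.tanh_eq_sinh_div_cosh v
  have h1u : u ^ 2 - 1 = -(1 / Real.cosh v ^ 2) := by
    rw [hu']; field_simp; linarith
  have hneg : u ^ 2 - 1 < 0 := by rw [h1u]; simp; positivity
  -- H_m(y) is replaced by its moment integral and the generating function of H_m(x) is summed at
  -- u(y + is). What remains is Gaussian in s with leading coefficient u² - 1 = -1/cosh² v, which
  -- produces the prefactor cosh v.
  have h := hasSum_integral_of_sum_norm_le (μ := volume)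
      (F := fun n (s : ℝ) => (hermiteCoeff (-1) x n : ℂ) * (u / 2 : ℂ) ^ n *
        ((2 * ((y : ℂ) + s * Complex.I)) ^ n * Real.exp (-s ^ 2)))
      (G := fun s => Real.exp ((u ^ 2 - 1) * s ^ 2 + (2 * |x| * |u|) * |s| +
        (2 * |x| * |u| * |y| + u ^ 2 * y ^ 2)))
      (S := fun s => Complex.exp (((u ^ 2 - 1 : ℝ) : ℂ) * s ^ 2 +
        ((2 * x * u - 2 * u ^ 2 * y) * Complex.I) * s + (2 * x * u * y - u ^ 2 * y ^ 2)))
      (fun n => by fun_prop) (integrable_exp_quadratic_abs hneg _ _)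
      (Eventually.of_forall fun s N => ?_) (Eventually.of_forall fun s => ?_)
  · have h2 := h.2
    rw [integral_cexp_quadratic (by rwa [Complex.ofReal_re])] at h2
    simp_rw [integral_const_mul, (integral_hermite_moment y _).2] at h2
    have hpi : (0 : ℝ) < Real.sqrt Real.pi := Real.sqrt_pos.2 Real.pi_pos
    have e1 : ((Real.pi : ℂ) / -((u ^ 2 - 1 : ℝ) : ℂ)) ^ (1 / 2 : ℂ) =
        ((Real.sqrt Real.pi * Real.cosh v : ℝ) : ℂ) := by
      have : Real.sqrt (Real.pi * Real.cosh v ^ 2) = Real.sqrt Real.pi * Real.cosh v := by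
        rw [Real.sqrt_mul Real.pi_pos.le, Real.sqrt_sq hC.le]
      rw [← this, h1u, Real.sqrt_eq_rpow, Complex.ofReal_cpow (by positivity)]
      push_cast
      congr 1
      have : Complex.cosh v ≠ 0 := by exact_mod_cast hC.ne'
      field_simp
    have e2 : Complex.exp ((2 * x * u * y - u ^ 2 * y ^ 2 : ℂ) -
        ((2 * x * u - 2 * u ^ 2 * y) * Complex.I) ^ 2 / (4 * ((u ^ 2 - 1 : ℝ) : ℂ))) =
        ((Real.exp (x * y * Real.sinh (2 * v) - (x ^ 2 + y ^ 2) * Real.sinh v ^ 2) : ℝ) : ℂ) := by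
      rw [mul_pow, Complex.I_sq, Complex.ofReal_exp]
      congr 1
      have : (2 * x * u * y - u ^ 2 * y ^ 2) -
          ((2 * x * u - 2 * u ^ 2 * y) ^ 2 * (-1)) / (4 * (u ^ 2 - 1)) =
          x * y * Real.sinh (2 * v) - (x ^ 2 + y ^ 2) * Real.sinh v ^ 2 := by
        rw [h1u, hu', Real.sinh_two_mul]
        field_simp
        have h3 : Real.cosh v ^ 2 = 1 + Real.sinh v ^ 2 := by linarith
        ring_nf
        simp only [show Real.cosh v ^ 3 = (Real.cosh v ^ 2) * Real.cosh v by ring, h3]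
        ring
      rw [← this]
      push_cast
      ring
    rw [e1, e2] at h2
    have h3 := h2.mul_left (((Real.sqrt Real.pi)⁻¹ : ℝ) : ℂ)
    have h4 : HasSum (fun m => ((hermitePoly m x * hermitePoly m y / (2 ^ m * m.factorial) *
        u ^ m : ℝ) : ℂ)) ((Real.cosh v * Real.exp (x * y * Real.sinh (2 * v) -
          (x ^ 2 + y ^ 2) * Real.sinh v ^ 2) : ℝ) : ℂ) := by
      refine hasSum_of_eq h3 (fun m => ?_) ?_
      · rw [hermitePoly_eq, hermitePoly_eq]
        have h5 : (m.factorial : ℂ) ≠ 0 := by exact_mod_cast m.factorial_ne_zero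
        have h6 : (Real.sqrt Real.pi : ℂ) ≠ 0 := by exact_mod_cast hpi.ne'
        rw [div_pow]
        push_cast
        field_simp
      · rw [← Complex.ofReal_mul, ← Complex.ofReal_mul]
        congr 1
        field_simp
    exact_mod_cast h4
  · have hn : ∀ n, ‖(hermiteCoeff (-1) x n : ℂ) * (u / 2 : ℂ) ^ n *
        ((2 * ((y : ℂ) + s * Complex.I)) ^ n * Real.exp (-s ^ 2))‖ ≤
        hermiteCoeff 1 |x| n * (|u| * ‖(y : ℂ) + s * Complex.I‖) ^ n *
          Real.exp (-s ^ 2) := fun n => by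
      simp only [norm_mul, norm_pow, norm_div, Complex.norm_real, Real.norm_eq_abs,
        Real.abs_exp, Complex.norm_two, mul_pow, div_pow]
      have := abs_hermiteCoeff_le x n
      calc _ = |hermiteCoeff (-1) x n| * (|u| ^ n * ‖(y : ℂ) + s * Complex.I‖ ^ n) *
            Real.exp (-s ^ 2) := by field_simp
        _ ≤ _ := by gcongr
    refine (Finset.sum_le_sum fun n _ => hn n).trans ?_
    rw [← Finset.sum_mul]
    refine (mul_le_mul_of_nonneg_right (sum_hermiteCoeff_one_le (abs_nonneg x)
      (by positivity) N) (Real.exp_pos _).le).trans ?_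
    rw [← Real.exp_add]
    refine Real.exp_le_exp.2 ?_
    have e : ‖(y : ℂ) + s * Complex.I‖ ^ 2 = y ^ 2 + s ^ 2 := by
      rw [Complex.sq_norm, Complex.normSq_add_mul_I]
    rw [mul_pow, e, sq_abs]
    have := mul_le_mul_of_nonneg_left (norm_add_mul_I_le y s)
      (mul_nonneg (abs_nonneg x) (abs_nonneg u))
    nlinarith
  · have h := (hasSum_hermiteCoeff (-1) x (u * ((y : ℂ) + s * Complex.I))).mul_right
      ((Real.exp (-s ^ 2) : ℝ) : ℂ)
    refine hasSum_of_eq h (fun n => ?_) ?_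
    · simp only [mul_pow, div_pow]; field_simp
    · push_cast
      rw [← Complex.exp_add]
      congr 1
      linear_combination (-(u : ℂ) ^ 2 * s ^ 2) * Complex.I_sq

/-- For v ≥ 0 the exponent on the diagonal is 2x² sinh v (cosh v - sinh v) = x²(1 - e^{-2v}) ≤ x².
The only growth in v is cosh v, which the 1/cosh v of the later moments cancels. -/
theorem sum_hermitePoly_sq_le (x v : ℝ) (N : ℕ) :
    ∑ m ∈ Finset.range N, hermitePoly m x ^ 2 / (2 ^ m * m.factorial) * |Real.tanh v| ^ m ≤
      Real.cosh v * Real.exp (x ^ 2) := by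
  have h := hasSum_mehler x x |v|
  have e : |Real.tanh v| = Real.tanh |v| := by
    rcases abs_cases v with ⟨h1, h2⟩ | ⟨h1, h2⟩ <;> rw [h1]
    · rw [Real.tanh_eq_sinh_div_cosh]
      exact abs_of_nonneg (div_nonneg (Real.sinh_nonneg_iff.2 h2) (Real.cosh_pos v).le)
    · rw [Real.tanh_neg, Real.tanh_eq_sinh_div_cosh, abs_of_nonpos
        (div_nonpos_of_nonpos_of_nonneg (Real.sinh_nonpos_iff.2 h2.le) (Real.cosh_pos v).le)]
  have hnn : 0 ≤ Real.tanh |v| := e ▸ abs_nonneg _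
  have hle := sum_le_hasSum (Finset.range N) (fun m _ => by
    rw [← sq]; positivity) h
  rw [Real.cosh_abs] at hle
  rw [e]
  refine (le_of_eq ?_).trans (hle.trans ?_)
  · simp_rw [sq]
  · refine mul_le_mul_of_nonneg_left (Real.exp_le_exp.2 ?_) (Real.cosh_pos v).le
    have h1 : Real.cosh |v| - Real.sinh |v| = Real.exp (-|v|) := Real.cosh_sub_sinh _
    have h2 : Real.cosh |v| + Real.sinh |v| = Real.exp (|v|) := Real.cosh_add_sinh _
    have h3 : Real.exp |v| * Real.exp (-|v|) = 1 := by rw [← Real.exp_add]; simp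
    have h4 : Real.sinh |v| * (Real.cosh |v| - Real.sinh |v|) ≤ 1 / 2 := by
      have : Real.sinh |v| = (Real.exp |v| - Real.exp (-|v|)) / 2 := by linarith
      rw [h1, this]
      nlinarith [Real.exp_pos (-|v|)]
    rw [Real.sinh_two_mul]
    nlinarith [mul_le_mul_of_nonneg_left h4 (sq_nonneg x)]

theorem sum_abs_mehler_le (x y v : ℝ) (N : ℕ) :
    ∑ m ∈ Finset.range N, |hermitePoly m x * hermitePoly m y / (2 ^ m * m.factorial) *
      Real.tanh v ^ m| ≤ Real.cosh v * ((Real.exp (x ^ 2) + Real.exp (y ^ 2)) / 2) := by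
  have hx := sum_hermitePoly_sq_le x v N
  have hy := sum_hermitePoly_sq_le y v N
  calc _ ≤ ∑ m ∈ Finset.range N, (hermitePoly m x ^ 2 / (2 ^ m * m.factorial) *
          |Real.tanh v| ^ m + hermitePoly m y ^ 2 / (2 ^ m * m.factorial) *
          |Real.tanh v| ^ m) / 2 := by
        refine Finset.sum_le_sum fun m _ => ?_
        rw [abs_mul, abs_div, abs_pow, abs_of_pos (a := 2 ^ m * (m.factorial : ℝ))
          (by positivity), abs_mul, ← add_mul, ← add_div, mul_div_right_comm _ _ (2 : ℝ),
          div_right_comm]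
        gcongr
        nlinarith [sq_nonneg (|hermitePoly m x| - |hermitePoly m y|),
          sq_abs (hermitePoly m x), sq_abs (hermitePoly m y)]
    _ ≤ _ := by
        rw [← Finset.sum_div, Finset.sum_add_distrib]
        linarith

theorem abs_hermitePoly_le (m : ℕ) (x : ℝ) :
    |hermitePoly m x| ≤ m.factorial * Real.exp (2 * |x| + 1) := by
  rw [hermitePoly_eq, abs_mul, Nat.abs_cast]
  gcongr
  refine (abs_hermiteCoeff_le x m).trans ?_
  have h := sum_hermiteCoeff_one_le (abs_nonneg x) zero_le_one (m + 1)
  simp only [one_pow, mul_one] at h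
  exact (Finset.single_le_sum (f := fun n => hermiteCoeff 1 |x| n)
    (fun i _ => hermiteCoeff_one_nonneg (abs_nonneg x) i)
    (Finset.mem_range.2 (Nat.lt_succ_self m))).trans h

theorem integrable_abs_hermitePoly_mul_exp {b : ℝ} (hb : b < 0) (m : ℕ) :
    Integrable fun x : ℝ => |hermitePoly m x| * Real.exp (b * x ^ 2) := by
  refine ((integrable_exp_quadratic_abs hb 2 1).const_mul (m.factorial : ℝ)).mono'
    (by fun_prop) (Eventually.of_forall fun x => ?_)
  rw [norm_mul, Real.norm_eq_abs, abs_abs, Real.norm_eq_abs, Real.abs_exp]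
  refine (mul_le_mul_of_nonneg_right (abs_hermitePoly_le m x) (Real.exp_pos _).le).trans ?_
  rw [mul_assoc, ← Real.exp_add]
  exact le_of_eq (by ring_nf)

/-- Gaussian integration of the generating function in t. Up to Gaussian factors it says that H_m is
an eigenfunction of the Mehler kernel with eigenvalue tanh^m v; Hermite orthogonality enters the
proof in this form. -/
theorem integral_hermitePoly_mul_exp (a v : ℝ) (m : ℕ) :
    ∫ x : ℝ, hermitePoly m x *
      Real.exp (-Real.cosh v ^ 2 * x ^ 2 + 2 * Real.sinh v * Real.cosh v * a * x) =
      Real.sqrt Real.pi * Real.tanh v ^ m * hermitePoly m a *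
        Real.exp (a ^ 2 * Real.sinh v ^ 2) / Real.cosh v := by
  have hC := Real.cosh_pos v
  have hCS := Real.cosh_sq_sub_sinh_sq v
  set w : ℝ → ℝ := fun x =>
    Real.exp (-Real.cosh v ^ 2 * x ^ 2 + 2 * Real.sinh v * Real.cosh v * a * x) with hw
  have hneg : -Real.cosh v ^ 2 < 0 := by simp; positivity
  have key : ∀ t : ℝ, HasSum (fun n => t ^ n • ∫ x : ℝ, hermiteCoeff (-1) x n * w x)
      (Real.sqrt Real.pi / Real.cosh v * Real.exp (a ^ 2 * Real.sinh v ^ 2) *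
        Real.exp (2 * a * (t * Real.tanh v) + (-1) * (t * Real.tanh v) ^ 2)) := by
    intro t
    have h := hasSum_integral_of_sum_norm_le (μ := volume)
      (F := fun n x => t ^ n * (hermiteCoeff (-1) x n * w x))
      (G := fun x => Real.exp (-Real.cosh v ^ 2 * x ^ 2 +
        (2 * |t| + |2 * Real.sinh v * Real.cosh v * a|) * |x| + t ^ 2))
      (S := fun x => Real.exp (-Real.cosh v ^ 2 * x ^ 2 +
        (2 * Real.sinh v * Real.cosh v * a + 2 * t) * x + -t ^ 2))
      (fun n => by fun_prop) (integrable_exp_quadratic_abs hneg _ _)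
      (Eventually.of_forall fun x N => ?_) (Eventually.of_forall fun x => ?_)
    · refine hasSum_of_eq h.2 (fun n => ?_) ?_
      · rw [integral_const_mul, smul_eq_mul]
      · rw [integral_exp_quadratic hneg, neg_neg, Real.sqrt_div Real.pi_pos.le,
          Real.sqrt_sq hC.le, mul_assoc (Real.sqrt Real.pi / Real.cosh v), ← Real.exp_add]
        congr 2
        rw [Real.tanh_eq_sinh_div_cosh]
        field_simp
        have h3 : Real.cosh v ^ 2 = 1 + Real.sinh v ^ 2 := by linarith
        ring_nf
        simp only [h3]
        ring
    · have hn : ∀ n, ‖t ^ n * (hermiteCoeff (-1) x n * w x)‖ ≤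
          hermiteCoeff 1 |x| n * |t| ^ n * w x := fun n => by
        have := abs_hermiteCoeff_le x n
        rw [norm_mul, norm_mul, norm_pow, Real.norm_eq_abs, Real.norm_eq_abs, Real.norm_eq_abs,
          hw, Real.abs_exp]
        calc _ = |hermiteCoeff (-1) x n| * |t| ^ n * w x := by rw [hw]; ring
          _ ≤ _ := by rw [hw]; gcongr
      refine (Finset.sum_le_sum fun n _ => hn n).trans ?_
      rw [← Finset.sum_mul]
      refine (mul_le_mul_of_nonneg_right (sum_hermiteCoeff_one_le (abs_nonneg x)
        (abs_nonneg t) N) (Real.exp_pos _).le).trans ?_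
      rw [← Real.exp_add, Real.exp_le_exp, sq_abs]
      have := le_abs_self (2 * Real.sinh v * Real.cosh v * a * x)
      rw [abs_mul _ x] at this
      nlinarith
    · refine hasSum_of_eq ((hasSum_hermiteCoeff_real (-1) x t).mul_right (w x))
        (fun n => by ring) ?_
      rw [hw, ← Real.exp_add]
      congr 1; ring
  have hcoef := powerSeries_coeff_unique zero_lt_one (fun t _ => key t)
    (b := fun n => Real.sqrt Real.pi / Real.cosh v * Real.exp (a ^ 2 * Real.sinh v ^ 2) *
      (hermiteCoeff (-1) a n * Real.tanh v ^ n)) fun t _ => by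
        refine hasSum_of_eq ((hasSum_hermiteCoeff_real (-1) a (t * Real.tanh v)).mul_left _)
          (fun n => ?_) rfl
        rw [smul_eq_mul, mul_pow]; ring
  have := congrFun hcoef m
  simp_rw [hermitePoly_eq, mul_assoc (m.factorial : ℝ)]
  rw [integral_const_mul]
  rw [this]
  ring

/-! ### The Bessel function K₀ and its exponential kernel -/

theorem one_add_sq_div_two_le_cosh (t : ℝ) : 1 + t ^ 2 / 2 ≤ Real.cosh t := by
  have h := sum_le_hasSum (Finset.range 2) (fun n _ => by rw [pow_mul]; positivity)
    (Real.hasSum_cosh t)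
  simpa [Finset.sum_range_succ] using h

theorem integrable_exp_neg_mul_cosh {x : ℝ} (hx : 0 < x) (c : ℝ) :
    Integrable fun t : ℝ => Real.exp (c * t - x * Real.cosh t) := by
  refine (integrable_exp_quadratic (b := -(x / 2)) (by linarith) c (-x)).mono'
    (by fun_prop) (Eventually.of_forall fun t => ?_)
  rw [Real.norm_eq_abs, Real.abs_exp, Real.exp_le_exp]
  nlinarith [mul_le_mul_of_nonneg_left (one_add_sq_div_two_le_cosh t) hx.le]

theorem besselK0_eq_integral (x : ℝ) :
    besselK0 x = 1 / 2 * ∫ t : ℝ, Real.exp (-x * Real.cosh t) := by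
  have h := integral_comp_abs (f := fun t => Real.exp (-x * Real.cosh t))
  simp only [Real.cosh_abs] at h
  rw [h, besselK0]; ring

theorem besselK0_nonneg (x : ℝ) : 0 ≤ besselK0 x :=
  integral_nonneg fun _ => (Real.exp_pos _).le

/-- Follows from cosh t ≥ t²/2. The true singularity at 0 is logarithmic, but x^{-1/2} suffices for
the integrability needed near the parabola. -/
theorem besselK0_le {x : ℝ} (hx : 0 < x) :
    besselK0 x ≤ 1 / 2 * Real.sqrt (2 * Real.pi / x) := by
  rw [besselK0_eq_integral]
  gcongr
  have h := integral_gaussian (x / 2)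
  have e : Real.pi / (x / 2) = 2 * Real.pi / x := by field_simp
  rw [e] at h
  rw [← h]
  refine integral_mono (by simpa using integrable_exp_neg_mul_cosh hx 0)
    (integrable_exp_neg_mul_sq (by linarith)) fun t => Real.exp_le_exp.2 ?_
  nlinarith [mul_le_mul_of_nonneg_left (one_add_sq_div_two_le_cosh t) hx.le]

theorem measurable_besselK0 : Measurable besselK0 := by
  have h : StronglyMeasurable fun p : ℝ × ℝ => Real.exp (-p.1 * Real.cosh p.2) :=
    Continuous.stronglyMeasurable (by fun_prop)
  exact (h.integral_prod_right (ν := volume.restrict (Ioi (0 : ℝ)))).measurable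

/-- The kernel `exp (-(A² e^{2v} + B² e^{-2v}) / 4)`. -/
noncomputable def expKernel (A B v : ℝ) : ℝ :=
  Real.exp (-(A ^ 2 * Real.exp (2 * v) + B ^ 2 * Real.exp (-(2 * v))) / 4)

@[fun_prop]
theorem continuous_expKernel (A B : ℝ) : Continuous (expKernel A B) := by
  unfold expKernel; fun_prop

theorem expKernel_pos (A B v : ℝ) : 0 < expKernel A B v := Real.exp_pos _

/-- The translation by log(B/A)/2 balances the two exponentials, so that only the product AB
remains. -/
theorem expKernel_shift {A B : ℝ} (hA : 0 < A) (hB : 0 < B) (v : ℝ) :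
    expKernel A B (v + Real.log (B / A) / 2) = Real.exp (-(A * B / 2) * Real.cosh (2 * v)) := by
  rw [expKernel, Real.cosh_eq]
  congr 1
  have h1 : Real.exp (2 * (v + Real.log (B / A) / 2)) = Real.exp (2 * v) * (B / A) := by
    rw [show 2 * (v + Real.log (B / A) / 2) = 2 * v + Real.log (B / A) by ring, Real.exp_add,
      Real.exp_log (by positivity)]
  have h2 : Real.exp (-(2 * (v + Real.log (B / A) / 2))) = Real.exp (-(2 * v)) * (A / B) := by
    rw [Real.exp_neg, h1, mul_inv, ← Real.exp_neg, inv_div]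
  rw [h1, h2]
  field_simp
  ring

theorem integrable_exp_mul_expKernel {A B : ℝ} (hA : 0 < A) (hB : 0 < B) (c : ℝ) :
    Integrable fun v => Real.exp (c * v) * expKernel A B v := by
  have hAB : 0 < A * B / 2 := by positivity
  have h := (integrable_exp_neg_mul_cosh hAB (c / 2)).comp_mul_left' (two_ne_zero)
  have h2 := (h.const_mul (Real.exp (c * (Real.log (B / A) / 2)))).comp_sub_right
    (Real.log (B / A) / 2)
  refine h2.congr (Eventually.of_forall fun v => ?_)
  have e := expKernel_shift hA hB (v - Real.log (B / A) / 2)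
  rw [sub_add_cancel] at e
  simp only
  rw [e, ← Real.exp_add, ← Real.exp_add]
  congr 1; ring

theorem integrable_expKernel {A B : ℝ} (hA : 0 < A) (hB : 0 < B) :
    Integrable (expKernel A B) := by
  simpa using integrable_exp_mul_expKernel hA hB 0

theorem integral_expKernel {A B : ℝ} (hA : 0 < A) (hB : 0 < B) :
    ∫ v, expKernel A B v = besselK0 (A * B / 2) := by
  rw [← integral_add_right_eq_self _ (Real.log (B / A) / 2)]
  simp_rw [expKernel_shift hA hB]
  rw [Measure.integral_comp_mul_left (fun t => Real.exp (-(A * B / 2) * Real.cosh t)) 2,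
    besselK0_eq_integral]
  norm_num

theorem integral_cosh_mul_comp_sinh (g : ℝ → ℝ) :
    ∫ v, Real.cosh v * g (Real.sinh v) = ∫ s, g s := by
  have h := integral_image_eq_integral_abs_deriv_smul (s := univ) MeasurableSet.univ
    (fun x _ => (Real.hasDerivAt_sinh x).hasDerivWithinAt) Real.sinh_injective.injOn g
  rw [image_univ, Real.sinh_surjective.range_eq, Measure.restrict_univ] at h
  rw [h]
  simp [abs_of_pos (Real.cosh_pos _)]

/-- After the balancing shift the kernel is even, so e^v may be replaced by cosh v; then cosh 2v = 1
+ 2 sinh² v and s = sinh v give a Gaussian integral. -/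
theorem integral_exp_mul_expKernel {A B : ℝ} (hA : 0 < A) (hB : 0 < B) :
    ∫ v, Real.exp v * expKernel A B v = Real.sqrt Real.pi / A * Real.exp (-(A * B / 2)) := by
  have hAB : 0 < A * B := by positivity
  rw [← integral_add_right_eq_self _ (Real.log (B / A) / 2)]
  simp_rw [expKernel_shift hA hB, Real.exp_add, mul_right_comm _ (Real.exp (_ / 2))]
  rw [integral_mul_const]
  set φ : ℝ → ℝ := fun v => Real.exp (-(A * B / 2) * Real.cosh (2 * v)) with hφ
  have hint : Integrable fun v => Real.exp v * φ v := by
    have h := (integrable_exp_neg_mul_cosh (x := A * B / 2) (by positivity)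
      (1 / 2)).comp_mul_left' (two_ne_zero)
    refine h.congr (Eventually.of_forall fun v => ?_)
    simp only [hφ]
    rw [← Real.exp_add]
    congr 1; ring
  have hneg : ∫ v, Real.exp (-v) * φ v = ∫ v, Real.exp v * φ v := by
    rw [← integral_neg_eq_self fun v => Real.exp v * φ v]
    refine integral_congr_ae (Eventually.of_forall fun v => ?_)
    simp [hφ]
  have hint' : Integrable fun v => Real.exp (-v) * φ v := by
    refine hint.comp_neg.congr (Eventually.of_forall fun v => ?_)
    simp [hφ]
  have hcosh : ∫ v, Real.exp v * φ v = ∫ v, Real.cosh v * φ v := by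
    have h1 : ∫ v, Real.cosh v * φ v =
        ∫ v, (1 / 2) * (Real.exp v * φ v + Real.exp (-v) * φ v) := by
      refine integral_congr_ae (Eventually.of_forall fun v => ?_)
      simp only [Real.cosh_eq]; ring
    rw [h1, integral_const_mul, integral_add hint hint', hneg]
    ring
  have hval : ∫ v, Real.cosh v * φ v =
      Real.exp (-(A * B / 2)) * Real.sqrt (Real.pi / (A * B)) := by
    have h := integral_cosh_mul_comp_sinh fun s =>
      Real.exp (-(A * B / 2)) * Real.exp (-(A * B) * s ^ 2)
    rw [integral_const_mul, integral_gaussian] at h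
    rw [← h]
    refine integral_congr_ae (Eventually.of_forall fun v => ?_)
    simp only [hφ]
    rw [← Real.exp_add, Real.cosh_two_mul, Real.cosh_sq]
    congr 2; ring
  have e1 : Real.exp (Real.log (B / A) / 2) = Real.sqrt B / Real.sqrt A := by
    rw [← Real.sqrt_div hB.le, Real.sqrt_eq_rpow, Real.rpow_def_of_pos (by positivity)]
    congr 1; ring
  rw [hcosh, hval, e1, Real.sqrt_div Real.pi_pos.le, Real.sqrt_mul hA.le]
  have hsA : Real.sqrt A ≠ 0 := (Real.sqrt_pos.2 hA).ne'
  have hsB : Real.sqrt B ≠ 0 := (Real.sqrt_pos.2 hB).ne'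
  field_simp
  rw [Real.sq_sqrt hA.le]

/-! ### Generating function of the tanh moments -/

/-- The `m`-th moment `∫ tanh^m v / cosh v · exp (-(A² e^{2v} + B² e^{-2v}) / 4) dv`. -/
noncomputable def tanhMoment (A B : ℝ) (m : ℕ) : ℝ :=
  ∫ v, Real.tanh v ^ m / Real.cosh v * expKernel A B v

theorem abs_tanh_le_one (v : ℝ) : |Real.tanh v| ≤ 1 := by
  rw [abs_le]
  exact ⟨(Real.neg_one_lt_tanh v).le, (Real.tanh_lt_one v).le⟩

theorem continuous_tanh : Continuous Real.tanh := by
  have : Real.tanh = fun v => Real.sinh v / Real.cosh v :=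
    funext Real.tanh_eq_sinh_div_cosh
  rw [this]
  exact Real.continuous_sinh.div Real.continuous_cosh fun v => (Real.cosh_pos v).ne'

theorem continuous_tanhMoment_integrand (A B : ℝ) (m : ℕ) :
    Continuous fun v => Real.tanh v ^ m / Real.cosh v * expKernel A B v :=
  ((continuous_tanh.pow m).div Real.continuous_cosh fun v => (Real.cosh_pos v).ne').mul
    (continuous_expKernel A B)

/-- A geometric series in q tanh v, multiplied by 1/cosh v. -/
theorem hasSum_tanhMoment {A B : ℝ} (hA : 0 < A) (hB : 0 < B) {q : ℝ} (hq : |q| < 1) :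
    HasSum (fun m => q ^ m • tanhMoment A B m)
      (∫ v, expKernel A B v / (Real.cosh v - q * Real.sinh v)) := by
  have h := hasSum_integral_of_sum_norm_le (μ := volume)
    (F := fun n v => q ^ n * (Real.tanh v ^ n / Real.cosh v * expKernel A B v))
    (G := fun v => (1 - |q|)⁻¹ * expKernel A B v)
    (S := fun v => expKernel A B v / (Real.cosh v - q * Real.sinh v))
    (fun n => ((continuous_tanhMoment_integrand A B n).const_mul _).aestronglyMeasurable)
    ((integrable_expKernel hA hB).const_mul _)
    (Eventually.of_forall fun v N => ?_) (Eventually.of_forall fun v => ?_)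
  · refine hasSum_of_eq h.2 (fun n => ?_) rfl
    rw [integral_const_mul, tanhMoment, smul_eq_mul]
  · have hn : ∀ n, ‖q ^ n * (Real.tanh v ^ n / Real.cosh v * expKernel A B v)‖ ≤
        |q| ^ n * expKernel A B v := fun n => by
      have hE := expKernel_pos A B v
      rw [norm_mul, norm_pow, norm_mul, norm_div, norm_pow, Real.norm_eq_abs, Real.norm_eq_abs,
        Real.norm_eq_abs, Real.norm_eq_abs, abs_of_pos (Real.cosh_pos v), abs_of_pos hE]
      have h1 : |Real.tanh v| ^ n / Real.cosh v ≤ 1 :=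
        (div_le_one (Real.cosh_pos v)).2
          ((pow_le_one₀ (abs_nonneg _) (abs_tanh_le_one v)).trans (Real.one_le_cosh v))
      have h2 := mul_le_mul_of_nonneg_right h1 hE.le
      rw [one_mul] at h2
      gcongr
    refine (Finset.sum_le_sum fun n _ => hn n).trans ?_
    rw [← Finset.sum_mul]
    refine mul_le_mul_of_nonneg_right ?_ (expKernel_pos A B v).le
    exact sum_le_hasSum _ (fun n _ => by positivity)
      (hasSum_geometric_of_lt_one (abs_nonneg q) hq)
  · have hlt : |q * Real.tanh v| < 1 := by
      rw [abs_mul]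
      exact (mul_le_of_le_one_right (abs_nonneg q) (abs_tanh_le_one v)).trans_lt hq
    refine hasSum_of_eq ((hasSum_geometric_of_abs_lt_one hlt).mul_right
      (expKernel A B v / Real.cosh v)) (fun n => ?_) ?_
    · rw [mul_pow]; ring
    · have hC := (Real.cosh_pos v).ne'
      have h1 : 1 - q * Real.tanh v ≠ 0 := by
        have := (abs_lt.1 hlt).2; linarith
      rw [Real.tanh_eq_sinh_div_cosh] at h1 ⊢
      have h2 : Real.cosh v - q * Real.sinh v ≠ 0 := by
        intro h0; apply h1; field_simp; linarith
      have h3 : 1 - q * (Real.sinh v / Real.cosh v) =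
        (Real.cosh v - q * Real.sinh v) / Real.cosh v := by field_simp
      rw [h3]
      field_simp

/-- The integrand is an exact derivative. Read from right to left, it turns the denominator D into
an exponent linear in D, which can be merged with `expKernel`. -/
theorem integral_deriv_mul_exp_neg {p α D : ℝ} (hp : 0 < p) (hα : 0 < α) (hD : 0 < D) :
    IntegrableOn (fun t => (2 * p * t + α) * Real.exp (-(p * t ^ 2 + α * t) * D)) (Ioi 0) ∧
    ∫ t in Ioi (0 : ℝ), (2 * p * t + α) * Real.exp (-(p * t ^ 2 + α * t) * D) = 1 / D := by
  have hder : ∀ t : ℝ, HasDerivAt (fun t => -Real.exp (-(p * t ^ 2 + α * t) * D) / D)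
      ((2 * p * t + α) * Real.exp (-(p * t ^ 2 + α * t) * D)) t := fun t => by
    have h1 : HasDerivAt (fun t => -(p * t ^ 2 + α * t) * D) (-(p * (2 * t) + α) * D) t := by
      have h0 := (((hasDerivAt_pow 2 t).const_mul p).add
        ((hasDerivAt_id t).const_mul α)).neg.mul_const D
      simpa using h0
    refine (h1.exp.neg.div_const D).congr_deriv ?_
    field_simp
  have htend : Tendsto (fun t => -Real.exp (-(p * t ^ 2 + α * t) * D) / D) atTop (𝓝 0) := by
    have h1 : Tendsto (fun t : ℝ => (p * t ^ 2 + α * t) * D) atTop atTop := by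
      refine Tendsto.atTop_mul_const hD ?_
      exact ((tendsto_pow_atTop two_ne_zero).const_mul_atTop hp).atTop_add_atTop
        (tendsto_id.const_mul_atTop hα)
    have h2 := (Real.tendsto_exp_neg_atTop_nhds_zero.comp h1).neg.div_const D
    rw [neg_zero, zero_div] at h2
    refine h2.congr fun t => ?_
    simp only [Function.comp, neg_mul]
  have hnn : ∀ t ∈ Ioi (0 : ℝ), 0 ≤ (2 * p * t + α) * Real.exp (-(p * t ^ 2 + α * t) * D) :=
    fun t ht => by have : (0 : ℝ) < t := ht; positivity
  refine ⟨integrableOn_Ioi_deriv_of_nonneg' (fun t _ => hder t) hnn htend, ?_⟩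
  rw [integral_Ioi_of_hasDerivAt_of_nonneg' (fun t _ => hder t) hnn htend]
  simp
  ring

/-- The denominator is e^{-v}((1-q)e^{2v} + (1+q))/2. The preceding representation of 1/D, with p =
1-q and α = A, is inserted and the v-integral is carried out first. -/
theorem integral_expKernel_div {A B : ℝ} (hA : 0 < A) (hB : 0 < B) {q : ℝ} (hq : |q| < 1) :
    ∫ v, expKernel A B v / (Real.cosh v - q * Real.sinh v) =
      2 * Real.sqrt Real.pi * Real.exp (-(A * B / 2)) *
        ∫ t in Ioi (0 : ℝ),
          Real.exp (-(1 - q ^ 2) * t ^ 2 - ((1 + q) * A + (1 - q) * B) * t) := by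
  obtain ⟨hq1, hq2⟩ := abs_lt.1 hq
  have hp : 0 < 1 - q := by linarith
  have hr : 0 < 1 + q := by linarith
  set K : ℝ → ℝ → ℝ := fun v t => 2 * Real.exp v * expKernel A B v *
    ((2 * (1 - q) * t + A) *
      Real.exp (-((1 - q) * t ^ 2 + A * t) * ((1 - q) * Real.exp (2 * v) + (1 + q)))) with hK
  have hDpos : ∀ v, 0 < (1 - q) * Real.exp (2 * v) + (1 + q) := fun v => by positivity
  have hinner : ∀ v, ∫ t in Ioi (0 : ℝ), K v t =
      expKernel A B v / (Real.cosh v - q * Real.sinh v) := fun v => by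
    simp only [hK]
    rw [integral_const_mul, (integral_deriv_mul_exp_neg hp hA (hDpos v)).2]
    have e1 : Real.cosh v - q * Real.sinh v =
        Real.exp (-v) * ((1 - q) * Real.exp (2 * v) + (1 + q)) / 2 := by
      rw [Real.cosh_eq, Real.sinh_eq, show 2 * v = v + v by ring, Real.exp_add, mul_add,
        show Real.exp (-v) * ((1 - q) * (Real.exp v * Real.exp v)) =
          (1 - q) * Real.exp v * (Real.exp (-v) * Real.exp v) by ring, ← Real.exp_add (-v)]
      simp only [neg_add_cancel, Real.exp_zero]
      ring
    rw [e1, Real.exp_neg]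
    have := (hDpos v).ne'
    field_simp
  have hmeas : AEStronglyMeasurable (Function.uncurry K)
      (volume.prod (volume.restrict (Ioi (0 : ℝ)))) := by
    refine Continuous.aestronglyMeasurable ?_
    simp only [hK, Function.uncurry_def, expKernel]
    fun_prop
  have hint : Integrable (Function.uncurry K)
      (volume.prod (volume.restrict (Ioi (0 : ℝ)))) := by
    refine (integrable_prod_iff hmeas).2 ⟨Eventually.of_forall fun v => ?_, ?_⟩
    · exact (integral_deriv_mul_exp_neg hp hA (hDpos v)).1.const_mul
        (2 * Real.exp v * expKernel A B v)
    · have e : ∀ v, ∫ t in Ioi (0 : ℝ), ‖Function.uncurry K (v, t)‖ =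
          expKernel A B v / (Real.cosh v - q * Real.sinh v) := fun v => by
        rw [← hinner]
        refine setIntegral_congr_fun measurableSet_Ioi fun t ht => ?_
        have ht : (0 : ℝ) < t := ht
        have := expKernel_pos A B v
        simp only [Function.uncurry, hK]
        exact Real.norm_of_nonneg (by positivity)
      simp_rw [e]
      refine ((integrable_expKernel hA hB).const_mul ((1 - |q|)⁻¹)).mono'
        (Measurable.aestronglyMeasurable (by fun_prop))
        (Eventually.of_forall fun v => ?_)
      have hC := Real.cosh_pos v
      have h1 : 1 - |q| ≤ Real.cosh v - q * Real.sinh v := by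
        have h2 : |Real.sinh v| ≤ Real.cosh v := by
          have := abs_tanh_le_one v
          rw [Real.tanh_eq_sinh_div_cosh, abs_div, abs_of_pos hC, div_le_one hC] at this
          exact this
        have h3 := le_abs_self (q * Real.sinh v)
        rw [abs_mul] at h3
        nlinarith [mul_le_mul_of_nonneg_left h2 (abs_nonneg q), Real.one_le_cosh v]
      have h0 : 0 < 1 - |q| := by linarith
      rw [Real.norm_of_nonneg (div_nonneg (expKernel_pos _ _ _).le (h0.le.trans h1)),
        div_eq_inv_mul]
      have := expKernel_pos A B v
      gcongr
  simp_rw [← hinner]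
  rw [integral_integral_swap hint, ← integral_const_mul]
  refine setIntegral_congr_fun measurableSet_Ioi fun t ht => ?_
  have ht : (0 : ℝ) < t := ht
  have hA' : 0 < A + 2 * (1 - q) * t := by positivity
  -- Completing the square: A²/4 + (1-q)((1-q)t² + At) = (A + 2(1-q)t)²/4. The kernel keeps its
  -- shape with A shifted, and the prefactor A + 2(1-q)t cancels the 1/A of
  -- `integral_exp_mul_expKernel`.
  have e : ∀ v, K v t = 2 * (A + 2 * (1 - q) * t) *
      Real.exp (-(1 + q) * ((1 - q) * t ^ 2 + A * t)) *
      (Real.exp v * expKernel (A + 2 * (1 - q) * t) B v) := fun v => by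
    have : expKernel A B v * Real.exp (-((1 - q) * t ^ 2 + A * t) *
        ((1 - q) * Real.exp (2 * v) + (1 + q))) =
        Real.exp (-(1 + q) * ((1 - q) * t ^ 2 + A * t)) *
          expKernel (A + 2 * (1 - q) * t) B v := by
      rw [expKernel, expKernel, ← Real.exp_add, ← Real.exp_add]
      congr 1; ring
    simp only [hK]
    linear_combination (2 * Real.exp v * (2 * (1 - q) * t + A)) * this
  simp_rw [e]
  rw [integral_const_mul, integral_exp_mul_expKernel hA' hB]
  have e2 : Real.exp (-(1 - q ^ 2) * t ^ 2 - ((1 + q) * A + (1 - q) * B) * t) *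
      Real.exp (-(A * B / 2)) = Real.exp (-(1 + q) * ((1 - q) * t ^ 2 + A * t)) *
        Real.exp (-((A + 2 * (1 - q) * t) * B / 2)) := by
    rw [← Real.exp_add, ← Real.exp_add]
    congr 1; ring
  rw [mul_assoc (2 * Real.sqrt Real.pi), mul_comm (Real.exp (-(A * B / 2))), e2]
  field_simp

/-! ### Hermite functions of negative order -/

theorem hermiteNeg_eq (m : ℕ) (z : ℝ) :
    hermiteNeg (-(m : ℝ) - 1) z =
      (m.factorial : ℝ)⁻¹ * ∫ t in Ioi (0 : ℝ), t ^ m * Real.exp (-t ^ 2 - 2 * t * z) := by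
  rw [hermiteNeg, show -(-(m : ℝ) - 1) = m + 1 by ring, Real.Gamma_nat_eq_factorial]
  simp [Real.rpow_natCast]

theorem integrableOn_pow_mul_exp (m : ℕ) (z : ℝ) :
    IntegrableOn (fun t : ℝ => t ^ m * Real.exp (-t ^ 2 - 2 * t * z)) (Ioi 0) := by
  refine (((integrable_exp_quadratic (b := -1) (by norm_num) (1 - 2 * z) 0).const_mul
    (m.factorial : ℝ)).integrableOn (s := Ioi (0 : ℝ))).mono'
    (Continuous.aestronglyMeasurable (by fun_prop)) ?_
  filter_upwards [ae_restrict_mem measurableSet_Ioi] with t ht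
  have ht : (0 : ℝ) < t := ht
  rw [Real.norm_of_nonneg (by positivity),
    show -1 * t ^ 2 + (1 - 2 * z) * t + 0 = t + (-t ^ 2 - 2 * t * z) by ring, Real.exp_add,
    ← mul_assoc]
  gcongr
  have := Real.pow_div_factorial_le_exp t ht.le m
  rwa [div_le_iff₀' (by positivity)] at this

/-- Needed because Λ_m divides by this value. -/
theorem hermiteNeg_pos (m : ℕ) (z : ℝ) : 0 < hermiteNeg (-(m : ℝ) - 1) z := by
  rw [hermiteNeg_eq]
  refine mul_pos (by positivity) ?_
  rw [setIntegral_pos_iff_support_of_nonneg_ae]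
  · have : Function.support (fun t : ℝ => t ^ m * Real.exp (-t ^ 2 - 2 * t * z)) ∩ Ioi 0 =
        Ioi 0 := by
      refine inter_eq_right.2 fun t ht => ?_
      have ht : (0 : ℝ) < t := ht
      exact (by positivity : t ^ m * Real.exp (-t ^ 2 - 2 * t * z) ≠ 0)
    rw [this]; simp
  · filter_upwards [ae_restrict_mem measurableSet_Ioi] with t ht
    have ht : (0 : ℝ) < t := ht
    simp only [Pi.zero_apply]
    positivity
  · exact integrableOn_pow_mul_exp m z

/-- The series for exp(2bqt + q²t²) is integrated against e^{-t²-2tη}; the condition |q| < 1 keeps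
the quadratic term negative. -/
theorem hasSum_hermiteCoeff_mul_hermiteNeg (b η : ℝ) {q : ℝ} (hq : |q| < 1) :
    HasSum (fun m => q ^ m • (m.factorial * hermiteCoeff 1 b m * hermiteNeg (-(m : ℝ) - 1) η))
      (∫ t in Ioi (0 : ℝ), Real.exp (-(1 - q ^ 2) * t ^ 2 - (2 * η - 2 * q * b) * t)) := by
  have hneg : q ^ 2 - 1 < 0 := by
    have := (sq_lt_one_iff_abs_lt_one q).2 hq; linarith
  have h := hasSum_integral_of_sum_norm_le (μ := volume.restrict (Ioi (0 : ℝ)))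
    (F := fun n t => q ^ n * hermiteCoeff 1 b n * (t ^ n * Real.exp (-t ^ 2 - 2 * t * η)))
    (G := fun t => Real.exp ((q ^ 2 - 1) * t ^ 2 + (2 * |b| * |q| - 2 * η) * t + 0))
    (S := fun t => Real.exp (-(1 - q ^ 2) * t ^ 2 - (2 * η - 2 * q * b) * t))
    (fun n => Continuous.aestronglyMeasurable (by fun_prop))
    (integrable_exp_quadratic hneg _ _).integrableOn ?_ (Eventually.of_forall fun t => ?_)
  · refine hasSum_of_eq h.2 (fun n => ?_) rfl
    have : (n.factorial : ℝ) ≠ 0 := by positivity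
    rw [integral_const_mul, hermiteNeg_eq, smul_eq_mul]
    field_simp
  · filter_upwards [ae_restrict_mem measurableSet_Ioi] with t ht N
    have ht : (0 : ℝ) < t := ht
    have hn : ∀ n, ‖q ^ n * hermiteCoeff 1 b n * (t ^ n * Real.exp (-t ^ 2 - 2 * t * η))‖ ≤
        hermiteCoeff 1 |b| n * (|q| * t) ^ n * Real.exp (-t ^ 2 - 2 * t * η) := fun n => by
      have := abs_hermiteCoeff_one_le b n
      rw [norm_mul, norm_mul, norm_mul, norm_pow, norm_pow, Real.norm_eq_abs, Real.norm_eq_abs,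
        Real.norm_eq_abs, Real.norm_eq_abs, Real.abs_exp, abs_of_pos ht]
      calc _ = |hermiteCoeff 1 b n| * (|q| * t) ^ n * Real.exp (-t ^ 2 - 2 * t * η) := by
            rw [mul_pow]; ring
        _ ≤ _ := by gcongr
    refine (Finset.sum_le_sum fun n _ => hn n).trans ?_
    rw [← Finset.sum_mul]
    refine (mul_le_mul_of_nonneg_right (sum_hermiteCoeff_one_le (abs_nonneg b)
      (by positivity) N) (Real.exp_pos _).le).trans ?_
    rw [← Real.exp_add, Real.exp_le_exp, mul_pow, sq_abs]
    exact le_of_eq (by ring)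
  · refine hasSum_of_eq ((hasSum_hermiteCoeff_real 1 b (q * t)).mul_right
      (Real.exp (-t ^ 2 - 2 * t * η))) (fun n => ?_) ?_
    · rw [mul_pow]; ring
    · rw [← Real.exp_add]; congr 1; ring

/-- With A = η - b and B = η + b one has (1+q)A + (1-q)B = 2η - 2qb and AB = η² - b², so the two
generating functions in q coincide. -/
theorem tanhMoment_eq {η b : ℝ} (hb : |b| < η) (m : ℕ) :
    tanhMoment (η - b) (η + b) m = 2 * Real.sqrt Real.pi * Real.exp ((b ^ 2 - η ^ 2) / 2) *
      (m.factorial * hermiteCoeff 1 b m * hermiteNeg (-(m : ℝ) - 1) η) := by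
  obtain ⟨hb1, hb2⟩ := abs_lt.1 hb
  have hA : 0 < η - b := by linarith
  have hB : 0 < η + b := by linarith
  have h := powerSeries_coeff_unique zero_lt_one
    (fun q hq => hasSum_tanhMoment hA hB (q := q) hq)
    (b := fun m => 2 * Real.sqrt Real.pi * Real.exp ((b ^ 2 - η ^ 2) / 2) *
      (m.factorial * hermiteCoeff 1 b m * hermiteNeg (-(m : ℝ) - 1) η)) fun q hq => ?_
  · exact congrFun h m
  · rw [integral_expKernel_div hA hB hq]
    refine hasSum_of_eq ((hasSum_hermiteCoeff_mul_hermiteNeg b η hq).mul_left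
      (2 * Real.sqrt Real.pi * Real.exp ((b ^ 2 - η ^ 2) / 2))) (fun n => ?_) ?_
    · simp only [smul_eq_mul]; ring
    · congr 2
      · congr 1; ring
      · funext t; congr 1; ring

/-! ### Hermite expansion of the kernel K₀(|x(ξ, η) - x(a, b)|) -/

/-- With ζ = ξ + iη the point is ζ²/2, and |ζ² - ζ'²| = |ζ - ζ'| |ζ + ζ'|. -/
theorem norm_parabolicPoint_sub (ξ η a b : ℝ) :
    ‖parabolicPoint ξ η - parabolicPoint a b‖ =
      Real.sqrt ((ξ - a) ^ 2 + (η - b) ^ 2) * Real.sqrt ((ξ + a) ^ 2 + (η + b) ^ 2) / 2 := by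
  refine (sq_eq_sq₀ (norm_nonneg _) (by positivity)).1 ?_
  rw [Complex.sq_norm, Complex.normSq_apply, div_pow, mul_pow, Real.sq_sqrt (by positivity),
    Real.sq_sqrt (by positivity)]
  simp only [parabolicPoint, Complex.sub_re, Complex.sub_im]
  ring

theorem parabolicPoint_mul (c ξ η : ℝ) :
    parabolicPoint (c * ξ) (c * η) = (c ^ 2 : ℝ) * parabolicPoint ξ η := by
  apply Complex.ext <;> simp [parabolicPoint, -Complex.ofReal_pow] <;> ring

theorem norm_parabolicPoint_sub_mul {k : ℝ} (hk : 0 ≤ k) (ξ η a b : ℝ) :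
    k * ‖parabolicPoint ξ η - parabolicPoint a b‖ =
      ‖parabolicPoint (Real.sqrt k * ξ) (Real.sqrt k * η) -
        parabolicPoint (Real.sqrt k * a) (Real.sqrt k * b)‖ := by
  rw [parabolicPoint_mul, parabolicPoint_mul, ← mul_sub, norm_mul, Real.sq_sqrt hk,
    Complex.norm_real, Real.norm_of_nonneg hk]

/-- The coefficient of `H_m(ξ) H_{-m-1}(η)` in the expansion of the kernel
`K₀(|x(ξ, η) - x(a, b)|)`. -/
noncomputable def kernelCoeff (a b : ℝ) (m : ℕ) : ℝ :=
  2 * Real.sqrt Real.pi * hermitePoly m a * (m.factorial * hermiteCoeff 1 b m) *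
    Real.exp ((b ^ 2 - a ^ 2) / 2) / (2 ^ m * m.factorial)

theorem kernelCoeff_mul_hermiteNeg {η a b : ℝ} (hb : |b| < η) (m : ℕ) :
    kernelCoeff a b m * hermiteNeg (-(m : ℝ) - 1) η =
      Real.exp ((η ^ 2 - a ^ 2) / 2) *
        (hermitePoly m a / (2 ^ m * m.factorial) * tanhMoment (η - b) (η + b) m) := by
  rw [tanhMoment_eq hb, kernelCoeff, show (η ^ 2 - a ^ 2) / 2 =
    (b ^ 2 - a ^ 2) / 2 - (b ^ 2 - η ^ 2) / 2 by ring, Real.exp_sub]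
  have := (Real.exp_pos ((b ^ 2 - η ^ 2) / 2)).ne'
  field_simp

/-- In A²e^{2v} + B²e^{-2v} the contributions of (ξ, a) and (η, b) are additive, so the exponential
separates: a Mehler kernel times `expKernel (η - b) (η + b)`. -/
theorem besselK0_norm_eq {ξ η a b : ℝ} (hb : |b| < η) :
    besselK0 ‖parabolicPoint ξ η - parabolicPoint a b‖ =
      ∫ v, Real.exp (ξ * a * Real.sinh (2 * v) - (ξ ^ 2 + a ^ 2) / 2 * Real.cosh (2 * v)) *
        expKernel (η - b) (η + b) v := by
  obtain ⟨hb1, hb2⟩ := abs_lt.1 hb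
  have hA : 0 < η - b := by linarith
  have hB : 0 < η + b := by linarith
  rw [norm_parabolicPoint_sub, ← integral_expKernel (by positivity) (by positivity)]
  refine integral_congr_ae (Eventually.of_forall fun v => ?_)
  simp only [expKernel]
  rw [Real.sq_sqrt (by positivity), Real.sq_sqrt (by positivity), ← Real.exp_add, Real.sinh_eq,
    Real.cosh_eq]
  congr 1; ring

/-- Mehler's formula is applied for each v and integrated against the (η, b) factor. The bound on
absolute partial sums is independent of N and explicit in (a, b), as needed to integrate over the
support of f. -/
theorem sum_abs_kernel_le {ξ η a b : ℝ} (hb : |b| < η) (N : ℕ) :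
    ∑ m ∈ Finset.range N,
      |hermitePoly m ξ * hermiteNeg (-(m : ℝ) - 1) η * kernelCoeff a b m| ≤
      Real.exp ((η ^ 2 - a ^ 2) / 2) * ((Real.exp (ξ ^ 2) + Real.exp (a ^ 2)) / 2) *
        besselK0 ((η ^ 2 - b ^ 2) / 2) ∧
    HasSum (fun m : ℕ => hermitePoly m ξ * hermiteNeg (-(m : ℝ) - 1) η * kernelCoeff a b m)
      (Real.exp ((ξ ^ 2 + η ^ 2) / 2) *
        besselK0 ‖parabolicPoint ξ η - parabolicPoint a b‖) := by
  obtain ⟨hb1, hb2⟩ := abs_lt.1 hb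
  have hA : 0 < η - b := by linarith
  have hB : 0 < η + b := by linarith
  set T : ℕ → ℝ := fun m => hermitePoly m ξ * hermitePoly m a / (2 ^ m * m.factorial) with hT
  set F : ℕ → ℝ → ℝ := fun m v =>
    T m * (Real.tanh v ^ m / Real.cosh v * expKernel (η - b) (η + b) v) with hF
  set G : ℝ → ℝ := fun v => (Real.exp (ξ ^ 2) + Real.exp (a ^ 2)) / 2 *
    expKernel (η - b) (η + b) v with hG
  have hGint : Integrable G := (integrable_expKernel hA hB).const_mul _
  have hmeas : ∀ n, AEStronglyMeasurable (F n) volume := fun n =>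
    ((continuous_tanhMoment_integrand _ _ n).const_mul _).aestronglyMeasurable
  have hle : ∀ v N, ∑ n ∈ Finset.range N, ‖F n v‖ ≤ G v := fun v N => by
    have hC := Real.cosh_pos v
    have hE := expKernel_pos (η - b) (η + b) v
    have e : ∀ n, ‖F n v‖ = |T n * Real.tanh v ^ n| *
        (expKernel (η - b) (η + b) v / Real.cosh v) := fun n => by
      rw [hF, ← abs_of_pos (div_pos hE hC), ← abs_mul, Real.norm_eq_abs]
      congr 1; ring
    simp_rw [e]
    rw [← Finset.sum_mul]
    refine (mul_le_mul_of_nonneg_right (sum_abs_mehler_le ξ a v N)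
      (div_pos hE hC).le).trans (le_of_eq ?_)
    simp only [hG]
    field_simp
  have hsum : ∀ v, HasSum (fun n => F n v) (Real.exp ((ξ ^ 2 + a ^ 2) / 2) *
      (Real.exp (ξ * a * Real.sinh (2 * v) - (ξ ^ 2 + a ^ 2) / 2 * Real.cosh (2 * v)) *
        expKernel (η - b) (η + b) v)) := fun v => by
    have hC := Real.cosh_pos v
    refine hasSum_of_eq ((hasSum_mehler ξ a v).mul_right
      (expKernel (η - b) (η + b) v / Real.cosh v)) (fun n => ?_) ?_
    · simp only [hF, hT]; ring
    · rw [← mul_assoc (Real.exp _), ← Real.exp_add, Real.cosh_two_mul, Real.cosh_sq]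
      rw [show (ξ ^ 2 + a ^ 2) / 2 + (ξ * a * Real.sinh (2 * v) - (ξ ^ 2 + a ^ 2) / 2 *
        (Real.sinh v ^ 2 + 1 + Real.sinh v ^ 2)) =
        ξ * a * Real.sinh (2 * v) - (ξ ^ 2 + a ^ 2) * Real.sinh v ^ 2 by ring]
      field_simp
  have hint : ∀ n, ∫ v, F n v = T n * tanhMoment (η - b) (η + b) n := fun n => by
    rw [hF, tanhMoment, integral_const_mul]
  have hterm : ∀ n : ℕ, hermitePoly n ξ * hermiteNeg (-(n : ℝ) - 1) η * kernelCoeff a b n =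
      Real.exp ((η ^ 2 - a ^ 2) / 2) * ∫ v, F n v := fun n => by
    rw [hint, mul_assoc, mul_comm (hermiteNeg _ _), kernelCoeff_mul_hermiteNeg hb, hT]
    ring
  have h := hasSum_integral_of_sum_norm_le hmeas hGint
    (Eventually.of_forall fun v => hle v) (Eventually.of_forall hsum)
  constructor
  · simp_rw [hterm, abs_mul, Real.abs_exp]
    rw [← Finset.mul_sum, mul_assoc]
    refine mul_le_mul_of_nonneg_left ?_ (Real.exp_pos _).le
    have e : (Real.exp (ξ ^ 2) + Real.exp (a ^ 2)) / 2 * besselK0 ((η ^ 2 - b ^ 2) / 2) =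
        ∫ v, G v := by
      rw [hG, integral_const_mul, integral_expKernel hA hB]
      congr 2; ring
    rw [e]
    calc _ ≤ ∑ n ∈ Finset.range N, ∫ v, ‖F n v‖ :=
          Finset.sum_le_sum fun n _ => norm_integral_le_integral_norm _
      _ = ∫ v, ∑ n ∈ Finset.range N, ‖F n v‖ :=
          (integral_finsetSum _ fun n _ => (h.1 n).norm).symm
      _ ≤ _ := integral_mono (integrable_finsetSum _ fun n _ => (h.1 n).norm) hGint
          fun v => hle v N
  · simp_rw [hterm]
    have h2 := h.2.mul_left (Real.exp ((η ^ 2 - a ^ 2) / 2))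
    refine hasSum_of_eq h2 (fun n => rfl) ?_
    rw [integral_const_mul, ← besselK0_norm_eq hb, ← mul_assoc, ← Real.exp_add]
    congr 2; ring

/-- The v-integral and the ξ-integral are exchanged, after which the eigenfunction identity
`integral_hermitePoly_mul_exp` isolates the single index m; the series itself is not integrated. -/
theorem integral_besselK0_mul_hermitePoly {η a b : ℝ} (hb : |b| < η) (m : ℕ) :
    ∫ ξ, besselK0 ‖parabolicPoint ξ η - parabolicPoint a b‖ *
        (hermitePoly m ξ * Real.exp (-ξ ^ 2 / 2)) =
      Real.sqrt Real.pi * (2 ^ m * m.factorial) * Real.exp (-η ^ 2 / 2) *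
        hermiteNeg (-(m : ℝ) - 1) η * kernelCoeff a b m := by
  obtain ⟨hb1, hb2⟩ := abs_lt.1 hb
  have hA : 0 < η - b := by linarith
  have hB : 0 < η + b := by linarith
  set K : ℝ → ℝ → ℝ := fun ξ v =>
    Real.exp (ξ * a * Real.sinh (2 * v) - (ξ ^ 2 + a ^ 2) / 2 * Real.cosh (2 * v)) *
      expKernel (η - b) (η + b) v * (hermitePoly m ξ * Real.exp (-ξ ^ 2 / 2)) with hK
  have hint : Integrable (Function.uncurry K) (volume.prod volume) := by
    have h := (integrable_abs_hermitePoly_mul_exp (b := -1 / 2) (by norm_num) m).mul_prod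
      (integrable_expKernel hA hB)
    refine h.mono' ?_ (Eventually.of_forall fun p => ?_)
    · refine Continuous.aestronglyMeasurable ?_
      simp only [hK, Function.uncurry_def]
      fun_prop
    · have hE := expKernel_pos (η - b) (η + b) p.2
      simp only [hK, Function.uncurry]
      rw [norm_mul, norm_mul, norm_mul, Real.norm_eq_abs, Real.abs_exp, Real.norm_of_nonneg hE.le,
        Real.norm_eq_abs, Real.norm_eq_abs, Real.abs_exp,
        show -1 / 2 * p.1 ^ 2 = -p.1 ^ 2 / 2 by ring]
      -- The exponent equals -((ξ-a)²e^{2v} + (ξ+a)²e^{-2v})/4.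
      have h1 : Real.exp (p.1 * a * Real.sinh (2 * p.2) -
          (p.1 ^ 2 + a ^ 2) / 2 * Real.cosh (2 * p.2)) ≤ 1 := by
        rw [Real.exp_le_one_iff, Real.sinh_eq, Real.cosh_eq]
        nlinarith [mul_nonneg (sq_nonneg (p.1 - a)) (Real.exp_pos (2 * p.2)).le,
          mul_nonneg (sq_nonneg (p.1 + a)) (Real.exp_pos (-(2 * p.2))).le]
      have h2 : 0 ≤ expKernel (η - b) (η + b) p.2 *
        (|hermitePoly m p.1| * Real.exp (-p.1 ^ 2 / 2)) := by positivity
      nlinarith [mul_le_mul_of_nonneg_right h1 h2]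
  have e1 : ∀ ξ, besselK0 ‖parabolicPoint ξ η - parabolicPoint a b‖ *
      (hermitePoly m ξ * Real.exp (-ξ ^ 2 / 2)) = ∫ v, K ξ v := fun ξ => by
    rw [besselK0_norm_eq hb, ← integral_mul_const]
  simp_rw [e1]
  rw [integral_integral_swap hint]
  have e2 : ∀ v, ∫ ξ, K ξ v = Real.sqrt Real.pi * hermitePoly m a * Real.exp (-a ^ 2 / 2) *
      (Real.tanh v ^ m / Real.cosh v * expKernel (η - b) (η + b) v) := fun v => by
    have e3 : ∀ ξ, K ξ v = Real.exp (-a ^ 2 / 2 * Real.cosh (2 * v)) *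
        expKernel (η - b) (η + b) v * (hermitePoly m ξ *
        Real.exp (-Real.cosh v ^ 2 * ξ ^ 2 + 2 * Real.sinh v * Real.cosh v * a * ξ)) := by
      intro ξ
      have : Real.exp (ξ * a * Real.sinh (2 * v) - (ξ ^ 2 + a ^ 2) / 2 * Real.cosh (2 * v)) *
          Real.exp (-ξ ^ 2 / 2) = Real.exp (-a ^ 2 / 2 * Real.cosh (2 * v)) *
          Real.exp (-Real.cosh v ^ 2 * ξ ^ 2 + 2 * Real.sinh v * Real.cosh v * a * ξ) := by
        rw [← Real.exp_add, ← Real.exp_add, Real.sinh_two_mul, Real.cosh_two_mul, Real.cosh_sq]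
        congr 1; ring
      simp only [hK]
      linear_combination (expKernel (η - b) (η + b) v * hermitePoly m ξ) * this
    simp_rw [e3]
    rw [integral_const_mul, integral_hermitePoly_mul_exp]
    have : Real.exp (-a ^ 2 / 2 * Real.cosh (2 * v)) * Real.exp (a ^ 2 * Real.sinh v ^ 2) =
        Real.exp (-a ^ 2 / 2) := by
      rw [← Real.exp_add, Real.cosh_two_mul, Real.cosh_sq]
      congr 1; ring
    rw [← this]
    ring
  simp_rw [e2]
  rw [integral_const_mul, ← tanhMoment, mul_assoc _ (hermiteNeg _ _), mul_comm (hermiteNeg _ _),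
    kernelCoeff_mul_hermiteNeg hb]
  have e4 : Real.exp (-a ^ 2 / 2) = Real.exp (-η ^ 2 / 2) * Real.exp ((η ^ 2 - a ^ 2) / 2) := by
    rw [← Real.exp_add]; congr 1; ring
  rw [e4]
  field_simp

/-! ### Mellin transform of K₀ -/

theorem sigmoid_mul_one_sub (t : ℝ) :
    Real.sigmoid t * (1 - Real.sigmoid t) =
      1 / (2 * Real.cosh (t / 2)) * (1 / (2 * Real.cosh (t / 2))) := by
  have h1 : (2 * Real.cosh (t / 2)) * (2 * Real.cosh (t / 2)) =
      (1 + Real.exp (-t)) * (1 + Real.exp t) := by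
    have e1 : Real.exp t = Real.exp (t / 2) * Real.exp (t / 2) := by
      rw [← Real.exp_add]; congr 1; ring
    have e2 : Real.exp (-t) = Real.exp (-(t / 2)) * Real.exp (-(t / 2)) := by
      rw [← Real.exp_add]; congr 1; ring
    have e3 : Real.exp (t / 2) * Real.exp (-(t / 2)) = 1 := by rw [← Real.exp_add]; simp
    rw [Real.cosh_eq, e1, e2]
    linear_combination (1 - Real.exp (t / 2) * Real.exp (-(t / 2))) * e3
  rw [← Real.sigmoid_neg, Real.sigmoid_def, Real.sigmoid_def, neg_neg, ← mul_inv, ← h1]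
  rw [one_div, mul_inv]

/-- The substitution x = 1/(1 + e^{-t}) in the integral for B(z/2, z/2) gives 2^{-z} ∫
cosh(t/2)^{-z} dt. -/
theorem integral_inv_cosh_cpow {z : ℂ} (hz : 0 < z.re) :
    Integrable (fun t : ℝ => ((1 / Real.cosh t : ℝ) : ℂ) ^ z) ∧
    ∫ t : ℝ, ((1 / Real.cosh t : ℝ) : ℂ) ^ z =
      (2 : ℂ) ^ z / 2 * (Complex.Gamma (z / 2) ^ 2 / Complex.Gamma z) := by
  have hz2 : 0 < (z / 2).re := by simpa using hz
  set g : ℝ → ℂ := fun x => (x : ℂ) ^ (z / 2 - 1) * (1 - (x : ℂ)) ^ (z / 2 - 1) with hg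
  have hder : ∀ t ∈ (univ : Set ℝ), HasDerivWithinAt Real.sigmoid
      (Real.sigmoid t * (1 - Real.sigmoid t)) univ t :=
    fun t _ => (Real.hasDerivAt_sigmoid t).hasDerivWithinAt
  have himg : Real.sigmoid '' univ = Ioo 0 1 := by rw [image_univ, Real.range_sigmoid]
  have hconv : IntegrableOn g (Ioo 0 1) := by
    have := Complex.betaIntegral_convergent hz2 hz2
    rwa [intervalIntegrable_iff_integrableOn_Ioo_of_le zero_le_one] at this
  have hval : ∫ x in Ioo (0 : ℝ) 1, g x = Complex.betaIntegral (z / 2) (z / 2) := by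
    rw [Complex.betaIntegral, intervalIntegral.integral_of_le zero_le_one,
      integral_Ioc_eq_integral_Ioo]
  have hpt : ∀ t : ℝ, |Real.sigmoid t * (1 - Real.sigmoid t)| • g (Real.sigmoid t) =
      (2 : ℂ) ^ (-z) * ((1 / Real.cosh (t / 2) : ℝ) : ℂ) ^ z := fun t => by
    have hs := Real.sigmoid_pos t
    have hs1 : 0 < 1 - Real.sigmoid t := by linarith [Real.sigmoid_lt_one t]
    have hC := Real.cosh_pos (t / 2)
    have hprod : Real.sigmoid t * (1 - Real.sigmoid t) ≠ 0 := (mul_pos hs hs1).ne'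
    have hc0 : ((1 / (2 * Real.cosh (t / 2)) : ℝ) : ℂ) ≠ 0 := by
      rw [Complex.ofReal_ne_zero]; positivity
    rw [abs_of_pos (mul_pos hs hs1), hg]
    simp only
    rw [show (1 : ℂ) - (Real.sigmoid t : ℂ) = ((1 - Real.sigmoid t : ℝ) : ℂ) by push_cast; rfl,
      ← Complex.mul_cpow_ofReal_nonneg hs.le hs1.le, ← Complex.ofReal_mul, Complex.real_smul]
    have e : ∀ x : ℝ, x ≠ 0 → (x : ℂ) * (x : ℂ) ^ (z / 2 - 1) = (x : ℂ) ^ (z / 2) :=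
      fun x hx => by
        have hx' : (x : ℂ) ≠ 0 := by exact_mod_cast hx
        rw [Complex.cpow_sub _ _ hx', Complex.cpow_one]; field_simp
    rw [e _ hprod, sigmoid_mul_one_sub, Complex.ofReal_mul,
      Complex.mul_cpow_ofReal_nonneg (by positivity) (by positivity),
      ← Complex.cpow_add _ _ hc0, add_halves,
      show (1 / (2 * Real.cosh (t / 2)) : ℝ) = (1 / 2) * (1 / Real.cosh (t / 2)) by field_simp,
      Complex.ofReal_mul, Complex.mul_cpow_ofReal_nonneg (by norm_num) (by positivity)]
    congr 1
    rw [Complex.cpow_neg, ← Complex.inv_cpow]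
    · norm_num
    · rw [show (2 : ℂ) = ((2 : ℝ) : ℂ) by norm_num, Complex.arg_ofReal_of_nonneg (by norm_num)]
      exact Real.pi_pos.ne
  have hint := (integrableOn_image_iff_integrableOn_abs_deriv_smul MeasurableSet.univ hder
    Real.sigmoid_injective.injOn g).1 (by rwa [himg])
  have hI := integral_image_eq_integral_abs_deriv_smul MeasurableSet.univ hder
    Real.sigmoid_injective.injOn g
  have h2 : (2 : ℂ) ^ (-z) ≠ 0 := by simp [Complex.cpow_eq_zero_iff]
  simp_rw [hpt] at hint hI
  rw [himg, hval, Measure.restrict_univ, integral_const_mul] at hI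
  rw [integrableOn_univ] at hint
  set F : ℝ → ℂ := fun t => ((1 / Real.cosh t : ℝ) : ℂ) ^ z with hF
  have hintF : Integrable fun t => F (t / 2) := by
    refine (hint.const_mul ((2 : ℂ) ^ (-z))⁻¹).congr (Eventually.of_forall fun t => ?_)
    simp only [hF]
    rw [inv_mul_cancel_left₀ h2]
  have hintF' : Integrable F := by
    refine (hintF.comp_mul_left' (two_ne_zero)).congr (Eventually.of_forall fun t => ?_)
    simp
  refine ⟨hintF', ?_⟩
  have hI2 : ∫ t, F (t / 2) = 2 * ∫ t, F t := by
    rw [Measure.integral_comp_div]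
    simp [Complex.real_smul]
  have hGz : Complex.Gamma z ≠ 0 := Complex.Gamma_ne_zero_of_re_pos hz
  have hB := Complex.Gamma_mul_Gamma_eq_betaIntegral hz2 hz2
  rw [add_halves, hI] at hB
  change _ = Complex.Gamma z * ((2 : ℂ) ^ (-z) * ∫ t, F (t / 2)) at hB
  rw [hI2, Complex.cpow_neg] at hB
  have h2' : (2 : ℂ) ^ z ≠ 0 := by simp [Complex.cpow_eq_zero_iff]
  rw [sq, hB]
  field_simp

/-- Under the integral for K₀, the Mellin transform of e^{-u cosh t} is Γ(z) cosh^{-z} t; the factor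
Γ(z) cancels against the denominator of the beta function. -/
theorem mellin_besselK0 {z : ℂ} (hz : 0 < z.re) :
    MellinConvergent (fun u => (besselK0 u : ℂ)) z ∧
    mellin (fun u => (besselK0 u : ℂ)) z =
      (2 : ℂ) ^ z / 4 * Complex.Gamma (z / 2) ^ 2 := by
  set K : ℝ → ℝ → ℂ := fun u t =>
    (u : ℂ) ^ (z - 1) * Complex.exp (-((Real.cosh t : ℝ) * u)) with hK
  have hmeas : AEStronglyMeasurable (Function.uncurry K)
      ((volume.restrict (Ioi (0 : ℝ))).prod volume) := by
    refine Measurable.aestronglyMeasurable ?_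
    simp only [hK, Function.uncurry_def]
    fun_prop
  have hnorm : ∀ t : ℝ, ∀ u ∈ Ioi (0 : ℝ), ‖K u t‖ =
      u ^ (z.re - 1) * Real.exp (-(Real.cosh t * u)) := fun t u hu => by
    have hu : 0 < u := hu
    rw [hK, norm_mul, Complex.norm_cpow_eq_rpow_re_of_pos hu, Complex.norm_exp]
    simp
  have hint : Integrable (Function.uncurry K)
      ((volume.restrict (Ioi (0 : ℝ))).prod volume) := by
    refine (integrable_prod_iff' hmeas).2 ⟨Eventually.of_forall fun t => ?_, ?_⟩
    · have h := integrableOn_rpow_mul_exp_neg_mul_rpow (p := 1) (s := z.re - 1)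
        (b := Real.cosh t) (by linarith) one_pos (Real.cosh_pos t)
      refine Integrable.mono' h (Measurable.aestronglyMeasurable ?_) ?_
      · simp only [hK, Function.uncurry_def]
        fun_prop
      · filter_upwards [ae_restrict_mem measurableSet_Ioi] with u hu
        rw [Function.uncurry, hnorm t u hu, Real.rpow_one, neg_mul]
    · have e : ∀ t : ℝ, ∫ u in Ioi (0 : ℝ), ‖Function.uncurry K (u, t)‖ =
          ‖((1 / Real.cosh t : ℝ) : ℂ) ^ z‖ * Real.Gamma z.re := fun t => by
        rw [Complex.norm_cpow_eq_rpow_re_of_pos (by have := Real.cosh_pos t; positivity),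
          ← Real.integral_rpow_mul_exp_neg_mul_Ioi hz (Real.cosh_pos t)]
        exact setIntegral_congr_fun measurableSet_Ioi (hnorm t)
      simp_rw [e]
      exact (integral_inv_cosh_cpow hz).1.norm.mul_const _
  have hinner : ∀ u : ℝ, ∫ t, K u t = (u : ℂ) ^ (z - 1) * (2 * (besselK0 u : ℂ)) := fun u => by
    have h1 : ∫ t : ℝ, Complex.exp (-((Real.cosh t : ℝ) * u)) =
        ((∫ t : ℝ, Real.exp (-u * Real.cosh t) : ℝ) : ℂ) := by
      rw [← integral_complex_ofReal]
      refine integral_congr_ae (Eventually.of_forall fun t => ?_)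
      simp only
      push_cast
      congr 1; ring
    rw [hK, integral_const_mul, besselK0_eq_integral, h1]
    push_cast
    ring
  constructor
  · have h := hint.integral_prod_left
    simp only [Function.uncurry_apply_pair, hinner] at h
    refine (h.const_mul (1 / 2)).congr (Eventually.of_forall fun u => ?_)
    simp only [smul_eq_mul]
    ring
  · have hswap := integral_integral_swap hint
    simp only [hinner] at hswap
    have e : ∀ t : ℝ, ∫ u in Ioi (0 : ℝ), K u t =
        ((1 / Real.cosh t : ℝ) : ℂ) ^ z * Complex.Gamma z := fun t => by
      rw [hK, Complex.integral_cpow_mul_exp_neg_mul_Ioi hz (Real.cosh_pos t)]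
      push_cast; rfl
    simp_rw [e] at hswap
    rw [integral_mul_const, (integral_inv_cosh_cpow hz).2] at hswap
    have e2 : ∀ u : ℝ, (u : ℂ) ^ (z - 1) * (2 * (besselK0 u : ℂ)) =
      2 * ((u : ℂ) ^ (z - 1) • (besselK0 u : ℂ)) := fun u => by simp only [smul_eq_mul]; ring
    simp_rw [e2] at hswap
    rw [integral_const_mul] at hswap
    have hGz : Complex.Gamma z ≠ 0 := Complex.Gamma_ne_zero_of_re_pos hz
    rw [mellin]
    rw [← mul_right_inj' (two_ne_zero (α := ℂ)), hswap]
    field_simp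
    ring

/-! ### An integrable majorant singular on the parabola -/

/-- The weight `(η² - b²)^{-1/2}` on the part of a disc inside the parabola `|b| < η`, where
`b² = |y| - Re y`. -/
noncomputable def parabolaWeight (R η : ℝ) : ℂ → ℝ :=
  indicator {y | ‖y‖ < R ∧ ‖y‖ - y.re < η ^ 2} fun y => 1 / Real.sqrt (η ^ 2 - (‖y‖ - y.re))

theorem parabolaWeight_nonneg (R η : ℝ) (y : ℂ) : 0 ≤ parabolaWeight R η y :=
  indicator_nonneg (fun _ _ => by positivity) y

theorem measurable_parabolaWeight (R η : ℝ) : Measurable (parabolaWeight R η) := by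
  refine Measurable.indicator (by fun_prop) ?_
  exact (measurableSet_lt (f := fun y : ℂ => ‖y‖) (g := fun _ => R) (by fun_prop)
    (by fun_prop)).inter (measurableSet_lt (f := fun y : ℂ => ‖y‖ - y.re)
      (g := fun _ => η ^ 2) (by fun_prop) (by fun_prop))

/-- The function `ρ ↦ ρ^{-1/2}` on `(0, L)`, extended by zero. -/
noncomputable def invSqrtOn (L : ℝ) : ℝ → ℝ := indicator (Ioo 0 L) fun ρ => 1 / Real.sqrt ρ

theorem integrable_invSqrtOn (L : ℝ) : Integrable (invSqrtOn L) := by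
  refine (integrable_indicator_iff measurableSet_Ioo).2 ?_
  rcases le_or_gt L 0 with hL | hL
  · simp [Ioo_eq_empty (not_lt.2 hL)]
  · have h := intervalIntegral.intervalIntegrable_rpow' (a := 0) (b := L) (r := -(1 / 2))
      (by norm_num)
    rw [intervalIntegrable_iff_integrableOn_Ioo_of_le hL.le] at h
    refine h.congr_fun (fun x hx => ?_) measurableSet_Ioo
    simp only
    rw [Real.rpow_neg hx.1.le, Real.sqrt_eq_rpow, one_div (x ^ _)]

theorem measurable_invSqrtOn (L : ℝ) : Measurable (invSqrtOn L) :=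
  Measurable.indicator (by fun_prop) measurableSet_Ioo

/-- In polar coordinates η² - (|y| - Re y) = η² - cr with c = 1 - cos θ. Along each ray the
singularity is an inverse square root, and its integral is bounded uniformly in θ. -/
theorem integrable_parabolaWeight {R η : ℝ} (hR : 0 < R) (hη : 0 < η) :
    Integrable (parabolaWeight R η) := by
  refine ⟨(measurable_parabolaWeight R η).aestronglyMeasurable, ?_⟩
  rw [hasFiniteIntegral_iff_ofReal (Eventually.of_forall (parabolaWeight_nonneg R η)),
    ← Complex.lintegral_comp_polarCoord_symm]
  set C₁ : ℝ := R * (Real.sqrt 2 / η)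
  set C₂ : ℝ := R * (Real.sqrt (2 * R) / η)
  have hC₁ : 0 ≤ C₁ := by positivity
  have hC₂ : 0 ≤ C₂ := by positivity
  set u : ℝ → ℝ := indicator (Ioo 0 R) fun _ => C₁
  -- The two terms dominate the integrand away from and near the parabola; the factor R in both
  -- constants bounds the Jacobian r.
  set U : ℝ × ℝ → ENNReal := fun p => ENNReal.ofReal (u p.1) +
    ENNReal.ofReal (C₂ * invSqrtOn (2 * R) (η ^ 2 / (1 - Real.cos p.2) - p.1)) with hU
  have hu : Integrable u :=
    (integrable_indicator_iff measurableSet_Ioo).2 (integrableOn_const (by simp))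
  have hum : Measurable u := Measurable.indicator (by fun_prop) measurableSet_Ioo
  have hUm : Measurable U := by
    have := measurable_invSqrtOn (2 * R)
    fun_prop
  have hv : Integrable fun ρ => C₂ * invSqrtOn (2 * R) ρ :=
    (integrable_invSqrtOn _).const_mul _
  have hpt : ∀ p ∈ polarCoord.target,
      ENNReal.ofReal p.1 • ENNReal.ofReal (parabolaWeight R η (Complex.polarCoord.symm p)) ≤
        U p := by
    rintro ⟨r, θ⟩ hp
    rw [polarCoord_target] at hp
    have hr : 0 < r := hp.1
    rw [smul_eq_mul, ← ENNReal.ofReal_mul hr.le, hU]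
    simp only
    by_cases hy : Complex.polarCoord.symm (r, θ) ∈
        {y : ℂ | ‖y‖ < R ∧ ‖y‖ - y.re < η ^ 2}
    swap
    · rw [parabolaWeight, indicator_of_notMem hy]; simp
    rw [parabolaWeight, indicator_of_mem hy]
    have hn : ‖Complex.polarCoord.symm (r, θ)‖ = r := by
      rw [Complex.norm_polarCoord_symm]; exact abs_of_pos hr
    have hre : (Complex.polarCoord.symm (r, θ)).re = r * Real.cos θ := by
      rw [Complex.polarCoord_symm_apply, Complex.re_ofReal_mul]
      simp [-Complex.ofReal_cos, -Complex.ofReal_sin]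
    simp only [mem_ofPred_eq, hn, hre] at hy ⊢
    obtain ⟨hyR, hyη⟩ := hy
    set c := 1 - Real.cos θ
    have hc : r - r * Real.cos θ = c * r := by simp only [c]; ring
    rw [hc] at hyη ⊢
    -- If cr ≤ η²/2 the weight is at most √2/η. Otherwise r < R forces c > η²/(2R), and η² - cr =
    -- c(η²/c - r) with η²/c - r in (0, 2R).
    rcases le_or_gt (c * r) (η ^ 2 / 2) with hcr | hcr
    · refine le_trans (ENNReal.ofReal_le_ofReal ?_) le_self_add
      simp only [u]
      rw [indicator_of_mem (mem_Ioo.2 ⟨hr, hyR⟩)]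
      refine mul_le_mul hyR.le ?_ (by positivity) hR.le
      rw [div_le_div_iff₀ (Real.sqrt_pos.2 (by linarith)) hη, one_mul, ← Real.sqrt_mul zero_le_two]
      exact Real.le_sqrt_of_sq_le (by linarith)
    · refine le_trans (ENNReal.ofReal_le_ofReal ?_) le_add_self
      have hc0 : 0 < c := by
        by_contra h
        have : c * r ≤ 0 := mul_nonpos_of_nonpos_of_nonneg (not_lt.1 h) hr.le
        nlinarith [sq_nonneg η]
      have hmem : η ^ 2 / c - r ∈ Ioo 0 (2 * R) := by
        have h1 : r < η ^ 2 / c := by rw [lt_div_iff₀ hc0]; linarith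
        have h2 : η ^ 2 / c < 2 * R := by
          rw [div_lt_iff₀ hc0]; nlinarith
        exact ⟨by linarith, by linarith⟩
      rw [invSqrtOn, indicator_of_mem hmem, mul_assoc R]
      refine mul_le_mul hyR.le ?_ (by positivity) hR.le
      have e : η ^ 2 - c * r = c * (η ^ 2 / c - r) := by field_simp
      rw [e, Real.sqrt_mul hc0.le, div_mul_div_comm, mul_one,
        div_le_div_iff₀ (by have := hmem.1; positivity) (by have := hmem.1; positivity), one_mul,
        ← mul_assoc, ← Real.sqrt_mul (by positivity)]
      refine mul_le_mul_of_nonneg_right ?_ (Real.sqrt_nonneg _)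
      refine Real.le_sqrt_of_sq_le ?_
      nlinarith
  refine (setLIntegral_mono hUm hpt).trans_lt ?_
  rw [polarCoord_target, Measure.volume_eq_prod, ← Measure.prod_restrict,
    lintegral_prod_symm _ hUm.aemeasurable]
  -- Reflection and translation in r remove the dependence on θ, even where c = 0 and η²/c takes the
  -- default value 0.
  have hbd : ∀ θ : ℝ, ∫⁻ r in Ioi (0 : ℝ), U (r, θ) ≤
      (∫⁻ r, ENNReal.ofReal (u r)) +
        ∫⁻ ρ, ENNReal.ofReal (C₂ * invSqrtOn (2 * R) ρ) := fun θ => by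
    refine (setLIntegral_le_lintegral _ _).trans (le_of_eq ?_)
    rw [hU]
    simp only
    rw [lintegral_add_left (by fun_prop),
      lintegral_sub_left_eq_self (fun ρ => ENNReal.ofReal (C₂ * invSqrtOn (2 * R) ρ))]
  refine (lintegral_mono hbd).trans_lt ?_
  rw [lintegral_const]
  exact ENNReal.mul_lt_top (ENNReal.add_lt_top.2 ⟨hu.lintegral_lt_top, hv.lintegral_lt_top⟩)
    (by simp)

/-! ### Parabolic coordinates of a given point -/

/-- A square root of `2 y`, whose real and imaginary parts are parabolic coordinates of `y`. -/
noncomputable def parabolicRoot (y : ℂ) : ℂ := (2 * y) ^ (((2 : ℕ) : ℂ)⁻¹)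

theorem measurable_parabolicRoot : Measurable parabolicRoot := by
  unfold parabolicRoot
  fun_prop

theorem parabolicPoint_root (y : ℂ) :
    parabolicPoint (parabolicRoot y).re (parabolicRoot y).im = y := by
  have h : parabolicRoot y ^ 2 = 2 * y := Complex.cpow_nat_inv_pow _ two_ne_zero
  have hre := congrArg Complex.re h
  have him := congrArg Complex.im h
  simp only [sq, Complex.mul_re, Complex.mul_im] at hre him
  norm_num at hre him
  apply Complex.ext <;> simp only [parabolicPoint] <;> linarith

theorem parabolicPoint_neg (ξ η : ℝ) : parabolicPoint (-ξ) (-η) = parabolicPoint ξ η := by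
  simp [parabolicPoint]

theorem norm_parabolicPoint (a b : ℝ) : ‖parabolicPoint a b‖ = (a ^ 2 + b ^ 2) / 2 := by
  refine (sq_eq_sq₀ (norm_nonneg _) (by positivity)).1 ?_
  rw [Complex.sq_norm, Complex.normSq_apply]
  simp only [parabolicPoint]
  ring

theorem sq_im_parabolicRoot (y : ℂ) : (parabolicRoot y).im ^ 2 = ‖y‖ - y.re := by
  conv_rhs => rw [← parabolicPoint_root y, norm_parabolicPoint]
  simp only [parabolicPoint]
  ring

theorem sq_re_parabolicRoot (y : ℂ) : (parabolicRoot y).re ^ 2 = ‖y‖ + y.re := by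
  conv_rhs => rw [← parabolicPoint_root y, norm_parabolicPoint]
  simp only [parabolicPoint]
  ring

/-- Since (ξ, η) and (-ξ, -η) give the same point, vanishing for η ≥ η₀ also excludes η ≤ -η₀. -/
theorem abs_im_parabolicRoot_lt {f : ℂ → ℝ} {η₀ : ℝ}
    (hsupp : ∀ ξ η : ℝ, η₀ ≤ η → f (parabolicPoint ξ η) = 0) {y : ℂ} (hy : f y ≠ 0) :
    |(parabolicRoot y).im| < η₀ := by
  by_contra h
  apply hy
  rcases le_abs.1 (not_lt.1 h) with h | h
  · rw [← parabolicPoint_root y]; exact hsupp _ _ h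
  · rw [← parabolicPoint_root y, ← parabolicPoint_neg]; exact hsupp _ _ h

/-! ### Spherical means integrated against a radial kernel -/

theorem integrableOn_mul_besselK0 {k : ℝ} (hk : 0 < k) :
    IntegrableOn (fun r => r * besselK0 (k * r)) (Ioi 0) := by
  have h := (mellin_besselK0 (z := 2) (by norm_num)).1
  have h2 := ((MellinConvergent.comp_mul_left hk).2 h).norm
  refine h2.congr ?_
  filter_upwards [ae_restrict_mem measurableSet_Ioi] with r hr
  have hr : 0 < r := hr
  rw [norm_smul, show (2 : ℂ) - 1 = 1 by norm_num, Complex.cpow_one, Complex.norm_real,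
    Complex.norm_real, Real.norm_of_nonneg hr.le, Real.norm_of_nonneg (besselK0_nonneg _)]

theorem abs_sphericalMean_le {f : ℂ → ℝ} {M : ℝ} (hM : ∀ y, |f y| ≤ M) (x : ℂ) {r : ℝ}
    (hr : 0 ≤ r) : |sphericalMean f x r| ≤ 2 * Real.pi * M * r := by
  have h := intervalIntegral.norm_integral_le_of_norm_le_const (a := -Real.pi) (b := Real.pi)
    (f := fun θ : ℝ => f (x + (r : ℂ) * Complex.exp ((θ : ℂ) * Complex.I)) * r) (C := M * r)
    fun θ _ => by
      rw [Real.norm_eq_abs, abs_mul, abs_of_nonneg hr]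
      exact mul_le_mul_of_nonneg_right (hM _) hr
  rw [Real.norm_eq_abs] at h
  refine h.trans (le_of_eq ?_)
  rw [sub_neg_eq_add, abs_of_pos (by positivity)]
  ring

theorem continuous_sphericalMean {f : ℂ → ℝ} (hf : Continuous f) :
    Continuous fun p : ℂ × ℝ => sphericalMean f p.1 p.2 := by
  unfold sphericalMean
  refine intervalIntegral.continuous_parametric_intervalIntegral_of_continuous' ?_ _ _
  simp only [Function.uncurry_def]
  fun_prop

@[fun_prop]
theorem continuous_parabolicPoint (η : ℝ) : Continuous fun ξ => parabolicPoint ξ η := by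
  have : (fun ξ => parabolicPoint ξ η) =
      fun ξ : ℝ => (((ξ ^ 2 - η ^ 2) / 2 : ℝ) : ℂ) + ((ξ * η : ℝ) : ℂ) * Complex.I := by
    funext ξ
    apply Complex.ext <;> simp [parabolicPoint, -Complex.ofReal_mul, -Complex.ofReal_div]
  rw [this]
  fun_prop

/-- Polar coordinates centred at x; the factor r of the arc length is the Jacobian. -/
theorem integral_sphericalMean_mul {f : ℂ → ℝ} (hf : Continuous f) {M : ℝ}
    (hM : ∀ y, |f y| ≤ M) {g : ℝ → ℝ} (hgm : Measurable g)
    (hg : IntegrableOn (fun r => r * g r) (Ioi 0)) (x : ℂ) :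
    ∫ r in Ioi (0 : ℝ), sphericalMean f x r * g r = ∫ y, f y * g ‖y - x‖ := by
  have hM0 : 0 ≤ M := (abs_nonneg _).trans (hM 0)
  have e1 : ∫ y, f y * g ‖y - x‖ = ∫ y, f (x + y) * g ‖y‖ := by
    rw [← integral_add_left_eq_self (fun y => f y * g ‖y - x‖) x]
    simp
  rw [e1, ← Complex.integral_comp_polarCoord_symm, polarCoord_target, Measure.volume_eq_prod]
  have e2 : ∀ p ∈ Ioi (0 : ℝ) ×ˢ Ioo (-Real.pi) Real.pi,
      p.1 • (f (x + Complex.polarCoord.symm p) * g ‖Complex.polarCoord.symm p‖) =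
      f (x + (p.1 : ℂ) * Complex.exp ((p.2 : ℂ) * Complex.I)) * p.1 * g p.1 := fun p hp => by
    have hr : 0 < p.1 := hp.1
    rw [Complex.norm_polarCoord_symm, abs_of_pos hr, Complex.polarCoord_symm_apply,
      Complex.exp_mul_I, smul_eq_mul]
    push_cast
    ring
  have hms : MeasurableSet (Ioi (0 : ℝ) ×ˢ Ioo (-Real.pi) Real.pi) :=
    measurableSet_Ioi.prod measurableSet_Ioo
  rw [setIntegral_congr_fun hms e2, setIntegral_prod]
  · refine setIntegral_congr_fun measurableSet_Ioi fun r _ => ?_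
    simp only
    rw [integral_mul_const, sphericalMean, intervalIntegral.integral_of_le (by linarith [Real.pi_pos]),
      integral_Ioc_eq_integral_Ioo]
  · rw [IntegrableOn, ← Measure.prod_restrict]
    have h1 : Integrable (fun _ : ℝ => M) (volume.restrict (Ioo (-Real.pi) Real.pi)) :=
      integrable_const _
    refine (hg.norm.mul_prod h1).mono' ?_ (Eventually.of_forall fun p => ?_)
    · refine Measurable.aestronglyMeasurable ?_
      have := hf.measurable
      fun_prop
    · rw [mul_assoc, norm_mul, mul_comm]
      exact mul_le_mul_of_nonneg_left (hM _) (norm_nonneg _)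

theorem integrable_besselK0_norm_sub {k : ℝ} (hk : 0 < k) (x : ℂ) :
    Integrable fun y : ℂ => besselK0 (k * ‖y - x‖) := by
  refine Integrable.comp_sub_right (f := fun y : ℂ => besselK0 (k * ‖y‖)) ?_ x
  refine (integrable_fun_norm_addHaar (E := ℂ) volume (f := fun r => besselK0 (k * r))).2 ?_
  simpa [Complex.finrank_real_complex] using integrableOn_mul_besselK0 hk

/-! ### The potential, its coefficients and the data on the parabola -/

/-- The potential of `f` with kernel `K₀(k |y - x|)`. -/
noncomputable def besselPotential (f : ℂ → ℝ) (k : ℝ) (x : ℂ) : ℝ :=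
  ∫ y, f y * besselK0 (k * ‖y - x‖)

/-- The coefficients of the Hermite expansion of the potential of `f`. -/
noncomputable def potentialCoeff (f : ℂ → ℝ) (k : ℝ) (m : ℕ) : ℝ :=
  ∫ y, f y * kernelCoeff (Real.sqrt k * (parabolicRoot y).re)
    (Real.sqrt k * (parabolicRoot y).im) m

theorem measurable_kernelCoeff (k : ℝ) (m : ℕ) :
    Measurable fun y : ℂ => kernelCoeff (Real.sqrt k * (parabolicRoot y).re)
      (Real.sqrt k * (parabolicRoot y).im) m := by
  have hr := measurable_parabolicRoot
  have ha : Measurable fun y : ℂ => Real.sqrt k * (parabolicRoot y).re := by fun_prop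
  have hb : Measurable fun y : ℂ => Real.sqrt k * (parabolicRoot y).im := by fun_prop
  have h1 : Measurable fun y : ℂ => hermitePoly m (Real.sqrt k * (parabolicRoot y).re) :=
    (continuous_hermitePoly m).measurable.comp ha
  have h2 : Measurable fun y : ℂ => hermiteCoeff 1 (Real.sqrt k * (parabolicRoot y).im) m :=
    (continuous_hermiteCoeff 1 m).measurable.comp hb
  simp only [kernelCoeff]
  fun_prop

theorem besselK0_norm_sub_eq {k : ℝ} (hk : 0 ≤ k) (ξ η : ℝ) (y : ℂ) :
    besselK0 (k * ‖y - parabolicPoint ξ η‖) =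
      besselK0 ‖parabolicPoint (Real.sqrt k * ξ) (Real.sqrt k * η) -
        parabolicPoint (Real.sqrt k * (parabolicRoot y).re)
          (Real.sqrt k * (parabolicRoot y).im)‖ := by
  rw [← norm_parabolicPoint_sub_mul hk, parabolicPoint_root, norm_sub_rev]

theorem abs_sqrt_mul_lt {k : ℝ} (hk : 0 < k) {b η : ℝ} (h : |b| < η) :
    |Real.sqrt k * b| < Real.sqrt k * η := by
  have hs := Real.sqrt_pos.2 hk
  rw [abs_mul, abs_of_pos hs]
  exact mul_lt_mul_of_pos_left h hs

/-- The kernel expansion is integrated against f. On the support |b| < η₀ ≤ η, so it is available at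
every relevant y, but for η = η₀ its bound has no uniform limit at the parabola, and
`parabolaWeight` serves as majorant. -/
theorem hasSum_potential {η₀ : ℝ} (hη₀ : 0 < η₀) {f : ℂ → ℝ} (hf : Continuous f)
    (hcs : HasCompactSupport f)
    (hsupp : ∀ ξ η : ℝ, η₀ ≤ η → f (parabolicPoint ξ η) = 0)
    (ξ : ℝ) {η : ℝ} (hη : η₀ ≤ η) {k : ℝ} (hk : 0 < k) :
    HasSum (fun m : ℕ => hermitePoly m (Real.sqrt k * ξ) *
        hermiteNeg (-(m : ℝ) - 1) (Real.sqrt k * η) * potentialCoeff f k m)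
      (Real.exp (k / 2 * (ξ ^ 2 + η ^ 2)) * besselPotential f k (parabolicPoint ξ η)) := by
  obtain ⟨M, hM⟩ := hcs.exists_bound_of_continuous hf
  have hM0 : 0 ≤ M := (norm_nonneg _).trans (hM 0)
  obtain ⟨R, hR0, hR⟩ := hcs.isCompact.isBounded.subset_ball_lt 0 0
  have hs := Real.sqrt_pos.2 hk
  have hs2 : Real.sqrt k ^ 2 = k := Real.sq_sqrt hk.le
  -- The bound of `sum_abs_kernel_le` rescaled by √k: a² = |y| + Re y ≤ 2R controls e^{ka²}, and
  -- `besselK0_le` at k(η₀² - b²)/2 gives ½√(4π/k) times the weight.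
  set C : ℝ := M * (Real.exp (k * η ^ 2 / 2) * ((Real.exp (k * ξ ^ 2) +
    Real.exp (k * (2 * R))) / 2) * (1 / 2 * Real.sqrt (4 * Real.pi / k))) with hC
  have h := hasSum_integral_of_sum_norm_le (μ := (volume : Measure ℂ))
    (F := fun m y => f y * (hermitePoly m (Real.sqrt k * ξ) *
      hermiteNeg (-(m : ℝ) - 1) (Real.sqrt k * η) *
      kernelCoeff (Real.sqrt k * (parabolicRoot y).re) (Real.sqrt k * (parabolicRoot y).im) m))
    (G := fun y => C * parabolaWeight R η₀ y)
    (S := fun y => f y * (Real.exp (k / 2 * (ξ ^ 2 + η ^ 2)) *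
      besselK0 (k * ‖y - parabolicPoint ξ η‖)))
    (fun n => ?_) ((integrable_parabolaWeight hR0 hη₀).const_mul _)
    (Eventually.of_forall fun y N => ?_) (Eventually.of_forall fun y => ?_)
  · refine hasSum_of_eq h.2 (fun n => ?_) ?_
    · rw [potentialCoeff, ← integral_const_mul]
      refine integral_congr_ae (Eventually.of_forall fun y => ?_)
      simp only; ring
    · rw [besselPotential, ← integral_const_mul]
      refine integral_congr_ae (Eventually.of_forall fun y => ?_)
      simp only; ring
  · exact (hf.measurable.mul ((measurable_kernelCoeff k n).const_mul _)).aestronglyMeasurable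
  · by_cases hy : f y = 0
    · simp only [hy, zero_mul, norm_zero, Finset.sum_const_zero]
      exact mul_nonneg (by positivity) (parabolaWeight_nonneg _ _ _)
    have hb₀ := abs_im_parabolicRoot_lt hsupp hy
    have hb := hb₀.trans_le hη
    have hyR : ‖y‖ < R := by
      simpa using hR (subset_tsupport f hy)
    have hb2 : (parabolicRoot y).im ^ 2 < η₀ ^ 2 := sq_lt_sq.2 (by rwa [abs_of_pos hη₀])
    have ha2 : (parabolicRoot y).re ^ 2 ≤ 2 * R := by
      rw [sq_re_parabolicRoot]
      linarith [(Complex.abs_re_le_norm y), le_abs_self y.re]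
    have hw : parabolaWeight R η₀ y =
        1 / Real.sqrt (η₀ ^ 2 - (parabolicRoot y).im ^ 2) := by
      rw [sq_im_parabolicRoot] at hb2 ⊢
      rw [parabolaWeight, indicator_of_mem (show y ∈ {y : ℂ | ‖y‖ < R ∧ ‖y‖ - y.re < η₀ ^ 2}
        from ⟨hyR, hb2⟩)]
    have hK := (sum_abs_kernel_le (ξ := Real.sqrt k * ξ)
      (a := Real.sqrt k * (parabolicRoot y).re) (abs_sqrt_mul_lt hk hb) N).1
    simp_rw [norm_mul (f y)]
    rw [← Finset.mul_sum, hC, mul_assoc]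
    refine mul_le_mul (hM y) (hK.trans ?_) (Finset.sum_nonneg fun _ _ => norm_nonneg _) hM0
    simp only [mul_pow, hs2]
    rw [mul_assoc (Real.exp (k * η ^ 2 / 2) * _)]
    have hηη : η₀ ^ 2 ≤ η ^ 2 := by gcongr
    have hpos : 0 < η₀ ^ 2 - (parabolicRoot y).im ^ 2 := by linarith
    refine mul_le_mul ?_ ?_ (besselK0_nonneg _) (by positivity)
    · gcongr
      nlinarith [mul_nonneg hk.le (sq_nonneg (parabolicRoot y).re)]
    · rw [← mul_sub]
      have hlt : k * (η₀ ^ 2 - (parabolicRoot y).im ^ 2) / 2 ≤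
          k * (η ^ 2 - (parabolicRoot y).im ^ 2) / 2 := by gcongr
      refine (besselK0_le (lt_of_lt_of_le (by positivity) hlt)).trans ?_
      rw [hw, mul_assoc, mul_one_div, ← Real.sqrt_div (by positivity)]
      refine mul_le_mul_of_nonneg_left (Real.sqrt_le_sqrt ?_) (by norm_num)
      rw [div_div, div_le_div_iff₀ (lt_of_lt_of_le (by positivity) hlt) (by positivity)]
      nlinarith [mul_le_mul_of_nonneg_left hlt Real.pi_pos.le]
  · by_cases hy : f y = 0
    · simp only [hy, zero_mul]; exact hasSum_zero
    have hb := (abs_im_parabolicRoot_lt hsupp hy).trans_le hη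
    have hK := (sum_abs_kernel_le (ξ := Real.sqrt k * ξ)
      (a := Real.sqrt k * (parabolicRoot y).re) (abs_sqrt_mul_lt hk hb) 0).2
    rw [← besselK0_norm_sub_eq hk.le] at hK
    refine hasSum_of_eq (hK.mul_left (f y)) (fun n => rfl) ?_
    rw [mul_pow, mul_pow, hs2]
    congr 3; ring

theorem integral_besselK0_norm_sub_mul {η : ℝ} {k : ℝ} (hk : 0 < k) {y : ℂ}
    (hb : |(parabolicRoot y).im| < η) (m : ℕ) :
    ∫ ξ, besselK0 (k * ‖y - parabolicPoint ξ η‖) *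
        (hermitePoly m (Real.sqrt k * ξ) * Real.exp (-(k / 2) * ξ ^ 2)) =
      (Real.sqrt k)⁻¹ * (Real.sqrt Real.pi * (2 ^ m * m.factorial) *
        Real.exp (-(k / 2 * η ^ 2)) * hermiteNeg (-(m : ℝ) - 1) (Real.sqrt k * η)) *
        kernelCoeff (Real.sqrt k * (parabolicRoot y).re)
          (Real.sqrt k * (parabolicRoot y).im) m := by
  have hs := Real.sqrt_pos.2 hk
  have hs2 : Real.sqrt k ^ 2 = k := Real.sq_sqrt hk.le
  have h := integral_besselK0_mul_hermitePoly (a := Real.sqrt k * (parabolicRoot y).re)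
    (abs_sqrt_mul_lt hk hb) m
  set g : ℝ → ℝ := fun x => besselK0 ‖parabolicPoint x (Real.sqrt k * η) -
    parabolicPoint (Real.sqrt k * (parabolicRoot y).re)
      (Real.sqrt k * (parabolicRoot y).im)‖ * (hermitePoly m x * Real.exp (-x ^ 2 / 2)) with hg
  have e : ∀ ξ, besselK0 (k * ‖y - parabolicPoint ξ η‖) *
      (hermitePoly m (Real.sqrt k * ξ) * Real.exp (-(k / 2) * ξ ^ 2)) =
      g (Real.sqrt k * ξ) := fun ξ => by
    simp only [hg]
    rw [besselK0_norm_sub_eq hk.le, mul_pow, hs2]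
    congr 3; ring
  simp_rw [e]
  rw [Measure.integral_comp_mul_left g, h, smul_eq_mul, abs_of_pos (inv_pos.2 hs), mul_pow, hs2,
    show -(k * η ^ 2) / 2 = -(k / 2 * η ^ 2) by ring]
  ring

theorem integrable_abs_hermitePoly_sqrt {k : ℝ} (hk : 0 < k) (m : ℕ) :
    Integrable fun ξ : ℝ => |hermitePoly m (Real.sqrt k * ξ)| * Real.exp (-(k / 2) * ξ ^ 2) := by
  have h := (integrable_abs_hermitePoly_mul_exp (b := -(1 / 2)) (by norm_num) m).comp_mul_left'
    (Real.sqrt_pos.2 hk).ne'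
  refine h.congr (Eventually.of_forall fun ξ => ?_)
  simp only
  rw [mul_pow, Real.sq_sqrt hk.le]
  congr 2; ring

/-- By Fubini, the ξ-integral is carried out for fixed y, where the extraction formula for the
kernel applies. -/
theorem integral_besselPotential_mul {η₀ : ℝ} {f : ℂ → ℝ} (hf : Continuous f) {M : ℝ}
    (hM : ∀ y, |f y| ≤ M) (hsupp : ∀ ξ η : ℝ, η₀ ≤ η → f (parabolicPoint ξ η) = 0)
    {k : ℝ} (hk : 0 < k) (m : ℕ) :
    ∫ ξ, besselPotential f k (parabolicPoint ξ η₀) *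
        (hermitePoly m (Real.sqrt k * ξ) * Real.exp (-(k / 2) * ξ ^ 2)) =
      (Real.sqrt k)⁻¹ * (Real.sqrt Real.pi * (2 ^ m * m.factorial) *
        Real.exp (-(k / 2 * η₀ ^ 2)) * hermiteNeg (-(m : ℝ) - 1) (Real.sqrt k * η₀)) *
        potentialCoeff f k m := by
  set h : ℝ → ℝ := fun ξ =>
    hermitePoly m (Real.sqrt k * ξ) * Real.exp (-(k / 2) * ξ ^ 2) with hh
  have hM0 : 0 ≤ M := (abs_nonneg _).trans (hM 0)
  have hhc : Continuous h := by fun_prop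
  set K : ℝ → ℂ → ℝ := fun ξ y =>
    f y * besselK0 (k * ‖y - parabolicPoint ξ η₀‖) * h ξ with hK
  have hmeas : AEStronglyMeasurable (Function.uncurry K) (volume.prod volume) := by
    refine Measurable.aestronglyMeasurable ?_
    have h1 := measurable_besselK0
    have h2 := hf.measurable
    have h3 : Measurable fun p : ℝ × ℂ => k * ‖p.2 - parabolicPoint p.1 η₀‖ :=
      Continuous.measurable (by fun_prop)
    have h4 := hhc.measurable
    simp only [hK, Function.uncurry_def]
    exact ((h2.comp measurable_snd).mul (h1.comp h3)).mul (h4.comp measurable_fst)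
  have hKle : ∀ ξ y, ‖K ξ y‖ ≤ M * |h ξ| * besselK0 (k * ‖y - parabolicPoint ξ η₀‖) :=
    fun ξ y => by
      simp only [hK]
      rw [norm_mul, norm_mul, Real.norm_eq_abs, Real.norm_eq_abs, Real.norm_eq_abs,
        abs_of_nonneg (besselK0_nonneg _), mul_right_comm]
      have := besselK0_nonneg (k * ‖y - parabolicPoint ξ η₀‖)
      gcongr
      exact hM y
  have hslice : ∀ ξ, Integrable fun y => K ξ y := fun ξ => by
    refine ((integrable_besselK0_norm_sub hk (parabolicPoint ξ η₀)).const_mul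
      (M * |h ξ|)).mono' ?_ (Eventually.of_forall (hKle ξ))
    have h1 := measurable_besselK0
    have h2 := hf.measurable
    refine Measurable.aestronglyMeasurable ?_
    simp only [hK]
    fun_prop
  have hint : Integrable (Function.uncurry K) (volume.prod volume) := by
    refine (integrable_prod_iff hmeas).2 ⟨Eventually.of_forall hslice, ?_⟩
    -- Translation invariance makes the y-integral independent of ξ, leaving only the
    -- Gaussian-weighted Hermite factor to integrate.
    have hI : ∀ x : ℂ, ∫ y, besselK0 (k * ‖y - x‖) = ∫ y : ℂ, besselK0 (k * ‖y‖) := fun x =>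
      integral_sub_right_eq_self (fun y : ℂ => besselK0 (k * ‖y‖)) x
    refine ((integrable_abs_hermitePoly_sqrt hk m).const_mul
      (M * ∫ y : ℂ, besselK0 (k * ‖y‖))).mono' hmeas.norm.integral_prod_right'
      (Eventually.of_forall fun ξ => ?_)
    rw [Real.norm_of_nonneg (integral_nonneg fun _ => norm_nonneg _)]
    refine (integral_mono (hslice ξ).norm
      ((integrable_besselK0_norm_sub hk (parabolicPoint ξ η₀)).const_mul (M * |h ξ|))
      (hKle ξ)).trans (le_of_eq ?_)
    rw [integral_const_mul, hI, hh, abs_mul, Real.abs_exp]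
    ring
  have e1 : ∀ ξ, besselPotential f k (parabolicPoint ξ η₀) *
      (hermitePoly m (Real.sqrt k * ξ) * Real.exp (-(k / 2) * ξ ^ 2)) = ∫ y, K ξ y := fun ξ => by
    rw [besselPotential, ← integral_mul_const]
  simp_rw [e1]
  rw [integral_integral_swap hint, potentialCoeff, ← integral_const_mul]
  refine integral_congr_ae (Eventually.of_forall fun y => ?_)
  simp only [hK]
  by_cases hy : f y = 0
  · simp [hy]
  · simp_rw [mul_assoc (f y)]
    rw [integral_const_mul, hh,
      integral_besselK0_norm_sub_mul hk (abs_im_parabolicRoot_lt hsupp hy) m]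
    ring

theorem integral_sphericalMean_mul_besselK0 {f : ℂ → ℝ} (hf : Continuous f) {M : ℝ}
    (hM : ∀ y, |f y| ≤ M) {k : ℝ} (hk : 0 < k) (x : ℂ) :
    ∫ r in Ioi (0 : ℝ), sphericalMean f x r * besselK0 (k * r) = besselPotential f k x :=
  integral_sphericalMean_mul hf hM (g := fun r => besselK0 (k * r))
    (measurable_besselK0.comp (measurable_const_mul k)) (integrableOn_mul_besselK0 hk) x

theorem integrable_momentIntegrand {η₀ : ℝ} {f : ℂ → ℝ} (hf : Continuous f) {M : ℝ}
    (hM : ∀ y, |f y| ≤ M) {D : ℝ → ℝ → ℝ}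
    (hD : ∀ ξ r : ℝ, 0 ≤ r → D ξ r = sphericalMean f (parabolicPoint ξ η₀) r)
    (m : ℕ) {k : ℝ} (hk : 0 < k) :
    Integrable (fun p : ℝ × ℝ => momentIntegrand D m k p.1 p.2)
      (volume.prod (volume.restrict (Ioi (0 : ℝ)))) := by
  have hpos : ∀ᵐ p ∂((volume : Measure ℝ).prod (volume.restrict (Ioi (0 : ℝ)))), 0 < p.2 :=
    Measure.quasiMeasurePreserving_snd.ae (ae_restrict_mem measurableSet_Ioi)
  have hint : Integrable (fun p : ℝ × ℝ => momentIntegrand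
      (fun ξ r => sphericalMean f (parabolicPoint ξ η₀) r) m k p.1 p.2)
      (volume.prod (volume.restrict (Ioi (0 : ℝ)))) := by
    have hb := ((integrable_abs_hermitePoly_sqrt hk m).mul_prod
      (integrableOn_mul_besselK0 hk)).const_mul (2 * Real.pi * M)
    refine hb.mono' ?_ ?_
    · refine Measurable.aestronglyMeasurable ?_
      have h1 : Measurable fun p : ℝ × ℝ => sphericalMean f (parabolicPoint p.1 η₀) p.2 := by
        have := continuous_sphericalMean hf
        exact (this.comp (f := fun p : ℝ × ℝ => (parabolicPoint p.1 η₀, p.2))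
          (by fun_prop)).measurable
      have h2 := measurable_besselK0
      have h3 := (continuous_hermitePoly m).measurable
      unfold momentIntegrand
      fun_prop
    · filter_upwards [hpos] with p hp
      rw [momentIntegrand, norm_mul, norm_mul, norm_mul, Real.norm_eq_abs, Real.norm_eq_abs,
        Real.norm_eq_abs, Real.norm_eq_abs, Real.abs_exp, abs_of_nonneg (besselK0_nonneg _)]
      have h1 := abs_sphericalMean_le hM (parabolicPoint p.1 η₀) hp.le
      have h2 := besselK0_nonneg (k * p.2)
      calc _ ≤ 2 * Real.pi * M * p.2 * besselK0 (k * p.2) *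
            |hermitePoly m (Real.sqrt k * p.1)| * Real.exp (-(k / 2) * p.1 ^ 2) := by gcongr
        _ = _ := by ring
  refine hint.congr ?_
  filter_upwards [hpos] with p hp
  simp only [momentIntegrand, hD _ _ hp.le]

/-- The normalisation in Λ_m is the reciprocal of the factor produced by the extraction formula on η
= η₀. -/
theorem lambdaCoeff_eq {η₀ : ℝ} {f : ℂ → ℝ} (hf : Continuous f) {M : ℝ}
    (hM : ∀ y, |f y| ≤ M) (hsupp : ∀ ξ η : ℝ, η₀ ≤ η → f (parabolicPoint ξ η) = 0)
    {D : ℝ → ℝ → ℝ} (hD : ∀ ξ r : ℝ, 0 ≤ r → D ξ r = sphericalMean f (parabolicPoint ξ η₀) r)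
    (m : ℕ) {k : ℝ} (hk : 0 < k) :
    lambdaCoeff D η₀ m k = potentialCoeff f k m := by
  have hinner : ∀ ξ, ∫ r in Ioi (0 : ℝ), momentIntegrand D m k ξ r =
      besselPotential f k (parabolicPoint ξ η₀) *
        (hermitePoly m (Real.sqrt k * ξ) * Real.exp (-(k / 2) * ξ ^ 2)) := fun ξ => by
    rw [← integral_sphericalMean_mul_besselK0 hf hM hk, ← integral_mul_const]
    refine setIntegral_congr_fun measurableSet_Ioi fun r hr => ?_
    simp only [momentIntegrand]
    rw [hD _ _ (le_of_lt hr)]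
    ring
  rw [lambdaCoeff]
  simp_rw [hinner]
  rw [integral_besselPotential_mul hf hM hsupp hk, Real.exp_neg]
  have h1 := (Real.sqrt_pos.2 hk).ne'
  have h2 := (Real.sqrt_pos.2 Real.pi_pos).ne'
  have h3 := (hermiteNeg_pos m (Real.sqrt k * η₀)).ne'
  field_simp

/-- The coefficients do not depend on η, so those read off at η₀ sum to the potential at every η ≥
η₀. -/
theorem hasSum_psiTerm {η₀ : ℝ} (hη₀ : 0 < η₀) {f : ℂ → ℝ} (hf : Continuous f)
    (hcs : HasCompactSupport f)
    (hsupp : ∀ ξ η : ℝ, η₀ ≤ η → f (parabolicPoint ξ η) = 0)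
    {D : ℝ → ℝ → ℝ} (hD : ∀ ξ r : ℝ, 0 ≤ r → D ξ r = sphericalMean f (parabolicPoint ξ η₀) r)
    (ξ : ℝ) {η : ℝ} (hη : η₀ ≤ η) {k : ℝ} (hk : 0 < k) :
    Summable (psiTerm D η₀ ξ η k) ∧
    psi D η₀ ξ η k = ∫ r in Ioi (0 : ℝ),
      sphericalMean f (parabolicPoint ξ η) r * besselK0 (k * r) := by
  obtain ⟨M, hM⟩ := hcs.exists_bound_of_continuous hf
  have h := hasSum_potential hη₀ hf hcs hsupp ξ hη hk
  have e : psiTerm D η₀ ξ η k = fun m : ℕ => hermitePoly m (Real.sqrt k * ξ) *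
      hermiteNeg (-(m : ℝ) - 1) (Real.sqrt k * η) * potentialCoeff f k m := by
    funext m
    rw [psiTerm, lambdaCoeff_eq hf hM hsupp hD m hk]
  rw [← e] at h
  refine ⟨h.summable, ?_⟩
  rw [psi, h.tsum_eq, integral_sphericalMean_mul_besselK0 hf hM hk, ← mul_assoc, ← Real.exp_add,
    show -(k / 2) * (η ^ 2 + ξ ^ 2) + k / 2 * (ξ ^ 2 + η ^ 2) = 0 by ring, Real.exp_zero, one_mul]

/-! ### Fourier inversion at the origin: Fejér and Dini -/

/-- The Fourier integral `∫ g(v) e^{itv} dv`. -/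
noncomputable def fourierInt (g : ℝ → ℂ) (t : ℝ) : ℂ :=
  ∫ v : ℝ, g v * Complex.exp ((t * v : ℝ) * Complex.I)

theorem norm_mul_exp_ofReal_mul_I (z : ℂ) (x : ℝ) :
    ‖z * Complex.exp ((x : ℂ) * Complex.I)‖ = ‖z‖ := by
  rw [norm_mul, Complex.norm_exp_ofReal_mul_I, mul_one]

theorem integrable_mul_exp_I {g : ℝ → ℂ} (hg : Integrable g) (t : ℝ) :
    Integrable fun v : ℝ => g v * Complex.exp ((t * v : ℝ) * Complex.I) :=
  hg.norm.mono' (hg.aestronglyMeasurable.mul (Continuous.aestronglyMeasurable (by fun_prop)))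
    (Eventually.of_forall fun v => (norm_mul_exp_ofReal_mul_I _ _).le)

theorem continuous_fourierInt {g : ℝ → ℂ} (hg : Integrable g) : Continuous (fourierInt g) := by
  refine continuous_of_dominated (bound := fun v => ‖g v‖)
    (fun t => (integrable_mul_exp_I hg t).aestronglyMeasurable)
    (fun t => Eventually.of_forall fun v => (norm_mul_exp_ofReal_mul_I _ _).le) hg.norm
    (Eventually.of_forall fun v => by fun_prop)

theorem fourierInt_add_const_mul {g h : ℝ → ℂ} (hg : Integrable g) (hh : Integrable h) (c : ℂ)
    (t : ℝ) : fourierInt (fun v => g v + c * h v) t = fourierInt g t + c * fourierInt h t := by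
  simp only [fourierInt]
  rw [← integral_const_mul, ← integral_add (integrable_mul_exp_I hg t)
    ((integrable_mul_exp_I hh t).const_mul c)]
  congr 1; funext v; ring

theorem ae_ne_zero_real : ∀ᵐ v : ℝ, v ≠ 0 := compl_mem_ae_iff.2 (measure_singleton 0)

theorem integral_exp_mul_I_symm {v : ℝ} (hv : v ≠ 0) (T : ℝ) :
    ∫ t in (-T)..T, Complex.exp ((t * v : ℝ) * Complex.I) =
      ((2 * Real.sin (T * v) / v : ℝ) : ℂ) := by
  have hv' : (v : ℂ) * Complex.I ≠ 0 :=
    mul_ne_zero (by exact_mod_cast hv) Complex.I_ne_zero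
  have e : ∀ t : ℝ, Complex.exp ((t * v : ℝ) * Complex.I) =
      Complex.exp ((v * Complex.I) * t) := fun t => by push_cast; congr 1; ring
  simp_rw [e]
  rw [integral_exp_mul_complex hv']
  push_cast
  rw [Complex.sin, div_eq_div_iff hv' (by exact_mod_cast hv)]
  rw [show (v : ℂ) * Complex.I * T = T * v * Complex.I by ring,
    show (v : ℂ) * Complex.I * -T = -(T * v) * Complex.I by ring]
  linear_combination (v * (Complex.exp (T * v * Complex.I) -
    Complex.exp (-(T * v) * Complex.I))) * Complex.I_sq

theorem integral_fourierInt_symm {g : ℝ → ℂ} (hg : Integrable g) (T : ℝ) :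
    ∫ t in (-T)..T, fourierInt g t = ∫ v : ℝ, g v * ((2 * Real.sin (T * v) / v : ℝ) : ℂ) := by
  simp only [fourierInt]
  rw [intervalIntegral_integral_swap]
  · refine integral_congr_ae ?_
    filter_upwards [ae_ne_zero_real] with v hv
    rw [intervalIntegral.integral_const_mul, integral_exp_mul_I_symm hv]
  · have h1 : IntegrableOn (fun _ : ℝ => (1 : ℝ)) (uIoc (-T) T) :=
      continuous_const.integrableOn_uIoc
    refine (h1.mul_prod hg.norm).mono' ?_ (Eventually.of_forall fun p => ?_)
    · simp only [Function.uncurry_def]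
      exact (hg.aestronglyMeasurable.comp_snd).mul
        (Continuous.aestronglyMeasurable (by fun_prop))
    · rw [Function.uncurry, norm_mul_exp_ofReal_mul_I, one_mul]

theorem abs_two_mul_sin_div_le (τ v : ℝ) : |2 * Real.sin (τ * v) / v| ≤ 2 * |τ| := by
  rcases eq_or_ne v 0 with rfl | hv
  · simp
  · rw [abs_div, div_le_iff₀ (abs_pos.2 hv), abs_mul, abs_two, mul_assoc, ← abs_mul τ]
    exact mul_le_mul_of_nonneg_left Real.abs_sin_le_abs zero_le_two

theorem integral_two_mul_sin_div {v : ℝ} (hv : v ≠ 0) (T : ℝ) :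
    ∫ τ in (0 : ℝ)..T, 2 * Real.sin (τ * v) / v = 2 * (1 - Real.cos (T * v)) / v ^ 2 := by
  rw [intervalIntegral.integral_div, intervalIntegral.integral_const_mul,
    intervalIntegral.integral_comp_mul_right _ hv, integral_sin]
  simp
  field_simp

/-- Integrating the Dirichlet kernel 2 sin(τv)/v in τ produces the nonnegative Fejér kernel. -/
theorem integral_integral_fourierInt {g : ℝ → ℂ} (hg : Integrable g) (T : ℝ) :
    ∫ τ in (0 : ℝ)..T, ∫ t in (-τ)..τ, fourierInt g t =
      ∫ v : ℝ, g v * ((2 * (1 - Real.cos (T * v)) / v ^ 2 : ℝ) : ℂ) := by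
  simp_rw [integral_fourierInt_symm hg]
  rw [intervalIntegral_integral_swap]
  · refine integral_congr_ae ?_
    filter_upwards [ae_ne_zero_real] with v hv
    rw [intervalIntegral.integral_const_mul, intervalIntegral.integral_ofReal,
      integral_two_mul_sin_div hv]
  · have h1 : IntegrableOn (fun τ : ℝ => 2 * |τ|) (uIoc 0 T) :=
      Continuous.integrableOn_uIoc (by fun_prop)
    refine (h1.mul_prod hg.norm).mono' ?_ (Eventually.of_forall fun p => ?_)
    · simp only [Function.uncurry_def]
      exact (hg.aestronglyMeasurable.comp_snd).mul
        (Measurable.aestronglyMeasurable (by fun_prop))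
    · rw [Function.uncurry, norm_mul, Complex.norm_real, mul_comm]
      exact mul_le_mul_of_nonneg_right (abs_two_mul_sin_div_le _ _) (norm_nonneg _)

theorem fejer_kernel_le (w : ℝ) : |2 * (1 - Real.cos w) / w ^ 2| ≤ 8 * (1 + w ^ 2)⁻¹ := by
  rcases eq_or_ne w 0 with rfl | hw
  · simp
  have hw2 : 0 < w ^ 2 := by positivity
  have h1 := Real.one_sub_sq_div_two_le_cos (x := w)
  have h2 := Real.neg_one_le_cos w
  have h3 := Real.cos_le_one w
  rw [abs_of_nonneg (div_nonneg (by linarith) hw2.le), ← div_eq_mul_inv,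
    div_le_div_iff₀ hw2 (by positivity)]
  nlinarith

/-- Rescaling w = Tv leaves a fixed integrable kernel and dominated convergence applies. As h(0) =
0, the mass of the kernel need not be computed; the constant 2π comes from the Gaussian instead. -/
theorem tendsto_fejer_of_zero {h : ℝ → ℂ} (hc : Continuous h) {B : ℝ} (hB : ∀ v, ‖h v‖ ≤ B)
    (h0 : h 0 = 0) :
    Tendsto (fun T : ℝ => (T : ℂ)⁻¹ *
      ∫ v : ℝ, h v * ((2 * (1 - Real.cos (T * v)) / v ^ 2 : ℝ) : ℂ)) atTop (𝓝 0) := by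
  have key : Tendsto (fun T : ℝ => ∫ w : ℝ, h (w / T) *
      ((2 * (1 - Real.cos w) / w ^ 2 : ℝ) : ℂ)) atTop (𝓝 (∫ _ : ℝ, (0 : ℂ))) := by
    refine tendsto_integral_filter_of_dominated_convergence
      (fun w => B * (8 * (1 + w ^ 2)⁻¹)) ?_ ?_ ((integrable_inv_one_add_sq.const_mul 8).const_mul B) ?_
    · refine Eventually.of_forall fun T => Measurable.aestronglyMeasurable ?_
      have := hc.measurable
      fun_prop
    · refine Eventually.of_forall fun T => Eventually.of_forall fun w => ?_
      rw [norm_mul, Complex.norm_real]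
      exact mul_le_mul (hB _) (fejer_kernel_le w) (norm_nonneg _)
        ((norm_nonneg _).trans (hB 0))
    · refine Eventually.of_forall fun w => ?_
      have h1 : Tendsto (fun T : ℝ => w / T) atTop (𝓝 0) := tendsto_const_nhds.div_atTop tendsto_id
      have h2 := ((hc.tendsto 0).comp h1).mul_const ((2 * (1 - Real.cos w) / w ^ 2 : ℝ) : ℂ)
      rwa [h0, zero_mul] at h2
  rw [integral_zero] at key
  refine key.congr' ?_
  filter_upwards [eventually_gt_atTop 0] with T hT
  have h1 := Measure.integral_comp_mul_left (fun w : ℝ => h (w / T) *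
      ((2 * (1 - Real.cos w) / w ^ 2 : ℝ) : ℂ)) T
  rw [abs_of_pos (inv_pos.2 hT), Complex.real_smul] at h1
  have hT' : (T : ℂ) ≠ 0 := by exact_mod_cast hT.ne'
  have h2 : ∫ w : ℝ, h (w / T) * ((2 * (1 - Real.cos w) / w ^ 2 : ℝ) : ℂ) =
      T * ∫ v : ℝ, h (T * v / T) * ((2 * (1 - Real.cos (T * v)) / (T * v) ^ 2 : ℝ) : ℂ) := by
    rw [h1, Complex.ofReal_inv, mul_inv_cancel_left₀ hT']
  rw [h2, ← integral_const_mul, ← integral_const_mul]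
  refine integral_congr_ae (Eventually.of_forall fun v => ?_)
  simp only
  rw [mul_div_cancel_left₀ _ hT.ne']
  push_cast
  rcases eq_or_ne v 0 with rfl | hv
  · simp
  · have hv' : (v : ℂ) ≠ 0 := by exact_mod_cast hv
    field_simp

/-- The Riemann–Lebesgue lemma at both ends of the line, with the sine written through e^{iTv} and
e^{-iTv}. -/
theorem tendsto_integral_sin_smul {φ : ℝ → ℂ} (hφ : Integrable φ) :
    Tendsto (fun T : ℝ => ∫ v : ℝ, φ v * ((2 * Real.sin (T * v) : ℝ) : ℂ)) atTop (𝓝 0) := by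
  have h := Real.tendsto_integral_exp_smul_cocompact φ
  rw [cocompact_eq_atBot_atTop, tendsto_sup] at h
  have h2pi : (0 : ℝ) < 2 * Real.pi := by positivity
  have e1 : ∀ w : ℝ, ∫ v : ℝ, Real.fourierChar (-(v * w)) • φ v =
      fourierInt φ (-(2 * Real.pi * w)) := fun w => by
    refine integral_congr_ae (Eventually.of_forall fun v => ?_)
    simp only
    rw [Circle.smul_def, Real.fourierChar_apply, smul_eq_mul, mul_comm]
    congr 3
    push_cast; ring
  simp_rw [e1] at h
  have hdiv : Tendsto (fun T : ℝ => T / (2 * Real.pi)) atTop atTop :=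
    tendsto_id.atTop_div_const h2pi
  have a1 : Tendsto (fun T : ℝ => fourierInt φ T) atTop (𝓝 0) := by
    refine (h.1.comp (tendsto_neg_atTop_atBot.comp hdiv)).congr fun T => ?_
    simp only [Function.comp]
    congr 1; field_simp
  have a2 : Tendsto (fun T : ℝ => fourierInt φ (-T)) atTop (𝓝 0) := by
    refine (h.2.comp hdiv).congr fun T => ?_
    simp only [Function.comp]
    congr 1; field_simp
  have h3 := (a1.sub a2).const_mul (-Complex.I)
  rw [sub_zero, mul_zero] at h3
  refine h3.congr fun T => ?_
  rw [fourierInt, fourierInt, ← integral_sub (integrable_mul_exp_I hφ T)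
    (integrable_mul_exp_I hφ (-T)), ← integral_const_mul]
  refine integral_congr_ae (Eventually.of_forall fun v => ?_)
  simp only
  push_cast
  rw [Complex.sin, neg_mul (T : ℂ)]
  ring

theorem fourierInt_gaussian (t : ℝ) :
    fourierInt (fun v => ((Real.exp (-v ^ 2) : ℝ) : ℂ)) t =
      ((Real.sqrt Real.pi * Real.exp (-(1 / 4) * t ^ 2) : ℝ) : ℂ) := by
  have h := fourierIntegral_gaussian (b := 1) (by simp) t
  have e : (Real.pi / 1 : ℂ) ^ (1 / 2 : ℂ) = (Real.sqrt Real.pi : ℝ) := by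
    rw [Real.sqrt_eq_rpow, Complex.ofReal_cpow Real.pi_pos.le]; push_cast; simp
  rw [e] at h
  rw [fourierInt]
  refine Eq.trans ?_ (h.trans ?_)
  · refine integral_congr_ae (Eventually.of_forall fun v => ?_)
    simp only
    push_cast
    rw [mul_comm]
    congr 2 <;> ring
  · push_cast
    congr 2; ring

/-- The one case of inversion done by hand; subtracting g(0)e^{-v²} reduces the general case to
functions vanishing at 0. -/
theorem tendsto_integral_fourierInt_gaussian :
    Tendsto (fun T : ℝ => ∫ t in (-T)..T,
      fourierInt (fun v => ((Real.exp (-v ^ 2) : ℝ) : ℂ)) t) atTop (𝓝 (2 * Real.pi)) := by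
  simp_rw [fourierInt_gaussian]
  have hint : Integrable fun t : ℝ => Real.sqrt Real.pi * Real.exp (-(1 / 4) * t ^ 2) :=
    (integrable_exp_neg_mul_sq (by norm_num)).const_mul _
  have hval : ∫ t : ℝ, ((Real.sqrt Real.pi * Real.exp (-(1 / 4) * t ^ 2) : ℝ) : ℂ) =
      2 * Real.pi := by
    rw [integral_complex_ofReal, integral_const_mul, integral_gaussian, ← Real.sqrt_mul
      Real.pi_pos.le, show Real.pi * (Real.pi / (1 / 4)) = (2 * Real.pi) ^ 2 by ring,
      Real.sqrt_sq (by positivity)]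
    push_cast; rfl
  have hint' : Integrable fun t : ℝ =>
      ((Real.sqrt Real.pi * Real.exp (-(1 / 4) * t ^ 2) : ℝ) : ℂ) := hint.ofReal
  rw [← hval]
  exact intervalIntegral_tendsto_integral hint' tendsto_neg_atTop_atBot tendsto_id

/-- The average is ∫₀¹ S(Tx) dx, to which dominated convergence applies. It serves the Gaussian part
of Fejér's theorem and the consistency of the two kinds of contour integral. -/
theorem tendsto_average {S : ℝ → ℂ} (hc : Continuous S) {A : ℂ} (hS : Tendsto S atTop (𝓝 A)) :
    Tendsto (fun T : ℝ => (T : ℂ)⁻¹ * ∫ τ in (0 : ℝ)..T, S τ) atTop (𝓝 A) := by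
  obtain ⟨B, hB⟩ : ∃ B, ∀ τ, 0 ≤ τ → ‖S τ‖ ≤ B := by
    have h1 : ∀ᶠ τ in atTop, ‖S τ‖ < ‖A‖ + 1 :=
      hS.norm.eventually_lt_const (lt_add_one _)
    obtain ⟨X, hX⟩ := eventually_atTop.1 h1
    obtain ⟨B, hB⟩ := (isCompact_Icc (a := (0 : ℝ)) (b := X)).exists_bound_of_continuousOn
      hc.continuousOn
    refine ⟨max B (‖A‖ + 1), fun τ hτ => ?_⟩
    rcases le_total τ X with h | h
    · exact (hB τ ⟨hτ, h⟩).trans (le_max_left _ _)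
    · exact (hX τ h).le.trans (le_max_right _ _)
  have key : Tendsto (fun T : ℝ => ∫ x in (0 : ℝ)..1, S (T * x)) atTop
      (𝓝 (∫ _ in (0 : ℝ)..1, A)) := by
    refine intervalIntegral.tendsto_integral_filter_of_dominated_convergence (fun _ => B) ?_ ?_
      intervalIntegrable_const ?_
    · exact Eventually.of_forall fun T => Continuous.aestronglyMeasurable (by fun_prop)
    · filter_upwards [eventually_ge_atTop 0] with T hT
      refine Eventually.of_forall fun x hx => hB _ ?_
      rw [uIoc_of_le zero_le_one] at hx
      exact mul_nonneg hT hx.1.le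
    · refine Eventually.of_forall fun x hx => ?_
      rw [uIoc_of_le zero_le_one] at hx
      exact hS.comp (tendsto_id.atTop_mul_const hx.1)
  simp only [intervalIntegral.integral_const, sub_zero, one_smul] at key
  refine key.congr' ?_
  filter_upwards [eventually_gt_atTop 0] with T hT
  rw [intervalIntegral.integral_comp_mul_left _ hT.ne', mul_zero, mul_one, Complex.real_smul]
  push_cast; rfl

theorem continuous_integral_symm {F : ℝ → ℂ} (hF : Continuous F) :
    Continuous fun T : ℝ => ∫ t in (-T)..T, F t := by
  have h : (fun T : ℝ => ∫ t in (-T)..T, F t) =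
      fun T : ℝ => (∫ t in (0 : ℝ)..T, F t) - ∫ t in (0 : ℝ)..(-T), F t := by
    funext T
    rw [intervalIntegral.integral_interval_sub_left (hF.intervalIntegrable _ _)
      (hF.intervalIntegrable _ _)]
  rw [h]
  have h1 := intervalIntegral.continuous_primitive (μ := volume)
    (fun a b => hF.intervalIntegrable a b) 0
  exact h1.sub (h1.comp continuous_neg)

theorem integrable_gaussian_complex : Integrable fun v : ℝ => ((Real.exp (-v ^ 2) : ℝ) : ℂ) := by
  have := integrable_exp_neg_mul_sq (b := 1) one_pos
  simp only [neg_mul, one_mul] at this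
  exact this.ofReal

theorem integral_fourierInt_split {g : ℝ → ℂ} (hg : Integrable g) (T : ℝ) :
    ∫ t in (-T)..T, fourierInt g t =
      (∫ t in (-T)..T, fourierInt (fun v => g v - g 0 * ((Real.exp (-v ^ 2) : ℝ) : ℂ)) t) +
        g 0 * ∫ t in (-T)..T, fourierInt (fun v => ((Real.exp (-v ^ 2) : ℝ) : ℂ)) t := by
  have hh : Integrable fun v => g v - g 0 * ((Real.exp (-v ^ 2) : ℝ) : ℂ) :=
    hg.sub (integrable_gaussian_complex.const_mul _)
  rw [← intervalIntegral.integral_const_mul, ← intervalIntegral.integral_add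
    ((continuous_fourierInt hh).intervalIntegrable _ _)
    (((continuous_fourierInt integrable_gaussian_complex).const_mul _).intervalIntegrable _ _)]
  refine intervalIntegral.integral_congr fun t _ => ?_
  rw [← fourierInt_add_const_mul hh integrable_gaussian_complex]
  congr 1; funext v; ring

/-- Fejér's theorem for Fourier integrals. -/
theorem tendsto_cesaro_fourierInt {g : ℝ → ℂ} (hg : Integrable g) (hc : Continuous g) {B : ℝ}
    (hB : ∀ v, ‖g v‖ ≤ B) :
    Tendsto (fun T : ℝ => (T : ℂ)⁻¹ * ∫ τ in (0 : ℝ)..T, ∫ t in (-τ)..τ, fourierInt g t) atTop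
      (𝓝 (g 0 * (2 * Real.pi))) := by
  set h : ℝ → ℂ := fun v => g v - g 0 * ((Real.exp (-v ^ 2) : ℝ) : ℂ) with hh
  have hhi : Integrable h := hg.sub (integrable_gaussian_complex.const_mul _)
  have hhc : Continuous h := by fun_prop
  have hhB : ∀ v, ‖h v‖ ≤ B + B := fun v => by
    refine (norm_sub_le _ _).trans (add_le_add (hB v) ?_)
    rw [norm_mul, Complex.norm_real, Real.norm_eq_abs, Real.abs_exp]
    have h1 : Real.exp (-v ^ 2) ≤ 1 := Real.exp_le_one_iff.2 (by nlinarith [sq_nonneg v])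
    nlinarith [hB 0, norm_nonneg (g 0), Real.exp_pos (-v ^ 2)]
  have l1 := tendsto_fejer_of_zero hhc hhB (by simp [hh])
  have l2 := (tendsto_average (continuous_integral_symm
    (continuous_fourierInt integrable_gaussian_complex))
    tendsto_integral_fourierInt_gaussian).const_mul (g 0)
  have l3 := l1.add l2
  rw [zero_add] at l3
  refine l3.congr fun T => ?_
  simp_rw [integral_fourierInt_split hg]
  rw [intervalIntegral.integral_add
    ((continuous_integral_symm (continuous_fourierInt hhi)).intervalIntegrable _ _)
    (((continuous_integral_symm (continuous_fourierInt
      integrable_gaussian_complex)).const_mul _).intervalIntegrable _ _),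
    intervalIntegral.integral_const_mul, integral_integral_fourierInt hhi]
  ring

/-- Dini's test for Fourier integrals. -/
theorem tendsto_fourierInt_of_dini {g : ℝ → ℂ} (hg : Integrable g)
    (hd : IntegrableAtFilter (fun v : ℝ => (g v - g 0) / (v : ℂ)) (𝓝 0)) :
    Tendsto (fun T : ℝ => ∫ t in (-T)..T, fourierInt g t) atTop (𝓝 (g 0 * (2 * Real.pi))) := by
  set h : ℝ → ℂ := fun v => g v - g 0 * ((Real.exp (-v ^ 2) : ℝ) : ℂ) with hh
  have hhi : Integrable h := hg.sub (integrable_gaussian_complex.const_mul _)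
  -- Near 0 the quotient is the Dini quotient of g plus a multiple of the bounded function (1 -
  -- e^{-v²})/v; for |v| ≥ δ it is at most ‖h‖/δ.
  have hquot : Integrable fun v : ℝ => h v / (v : ℂ) := by
    obtain ⟨s, hs, hds⟩ := hd
    obtain ⟨ε, hε, hεs⟩ := Metric.mem_nhds_iff.1 hs
    set δ := min ε 1
    have hδ : 0 < δ := lt_min hε one_pos
    have hmeas : AEStronglyMeasurable (fun v : ℝ => h v / (v : ℂ)) volume :=
      (hhi.aestronglyMeasurable.mul (g := fun v : ℝ => (v : ℂ)⁻¹)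
        (Measurable.aestronglyMeasurable (by fun_prop))).congr
        (Eventually.of_forall fun v => (div_eq_mul_inv _ _).symm)
    have hnear : IntegrableOn (fun v : ℝ => h v / (v : ℂ)) (Metric.ball 0 δ) := by
      have h1 : IntegrableOn (fun v : ℝ => (g v - g 0) / (v : ℂ)) (Metric.ball 0 δ) :=
        hds.mono_set ((Metric.ball_subset_ball (min_le_left _ _)).trans hεs)
      have h2 : IntegrableOn (fun v : ℝ => g 0 * (((1 - Real.exp (-v ^ 2)) / v : ℝ) : ℂ))
          (Metric.ball 0 δ) := by
        refine Integrable.mono' (g := fun _ => ‖g 0‖ * 2)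
          (integrableOn_const measure_ball_lt_top.ne) (Measurable.aestronglyMeasurable (by fun_prop)) ?_
        filter_upwards [ae_restrict_mem measurableSet_ball] with v hv
        rw [norm_mul, Complex.norm_real, Real.norm_eq_abs, abs_div]
        refine mul_le_mul_of_nonneg_left ?_ (norm_nonneg _)
        have hv1 : |v| ≤ 1 := by
          rw [mem_ball_zero_iff, Real.norm_eq_abs] at hv
          exact hv.le.trans (min_le_right _ _)
        have h3 := Real.abs_exp_sub_one_le (x := -v ^ 2) (by
          rw [abs_neg, abs_pow]; exact pow_le_one₀ (abs_nonneg _) hv1)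
        rw [abs_neg, abs_pow] at h3
        rw [abs_sub_comm]
        refine div_le_of_le_mul₀ (abs_nonneg _) zero_le_two (h3.trans ?_)
        nlinarith [abs_nonneg v]
      refine (h1.add h2).congr (Eventually.of_forall fun v => ?_)
      simp only [Pi.add_apply, hh]
      push_cast
      ring
    have hfar : IntegrableOn (fun v : ℝ => h v / (v : ℂ)) (Metric.ball 0 δ)ᶜ := by
      refine Integrable.mono' (g := fun v => δ⁻¹ * ‖h v‖) (hhi.norm.const_mul _).integrableOn
        hmeas.restrict ?_
      filter_upwards [ae_restrict_mem measurableSet_ball.compl] with v hv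
      have hv1 : δ ≤ |v| := by simpa using hv
      rw [norm_div, Complex.norm_real, Real.norm_eq_abs, div_eq_inv_mul]
      gcongr
    have := hnear.union hfar
    rwa [union_compl_self, integrableOn_univ] at this
  have l1 := tendsto_integral_sin_smul hquot
  have l2 := tendsto_integral_fourierInt_gaussian.const_mul (g 0)
  have l3 := l1.add l2
  rw [zero_add] at l3
  refine l3.congr fun T => ?_
  rw [integral_fourierInt_split hg, integral_fourierInt_symm hhi]
  congr 1
  refine integral_congr_ae (Eventually.of_forall fun v => ?_)
  simp only
  push_cast
  ring

/-! ### Mellin transforms on vertical lines -/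

/-- The function `v ↦ Φ(r e^v) e^{σv}`, whose Fourier integral is the Mellin transform of `Φ`
along the line `Re s = σ`, up to the factor `r^s`. -/
noncomputable def logProfile (Φ : ℝ → ℝ) (r σ v : ℝ) : ℂ :=
  ((Φ (r * Real.exp v) * Real.exp (σ * v) : ℝ) : ℂ)

theorem logProfile_zero (Φ : ℝ → ℝ) (r σ : ℝ) : logProfile Φ r σ 0 = Φ r := by
  simp [logProfile]

theorem continuous_logProfile {Φ : ℝ → ℝ} (hΦ : Continuous Φ) (r σ : ℝ) :
    Continuous (logProfile Φ r σ) := by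
  unfold logProfile
  fun_prop

/-- The linear bound at ρ = 0 gives exponential decay as v → -∞, and the vanishing for ρ ≥ L cuts
off v → +∞. -/
theorem norm_logProfile_le {Φ : ℝ → ℝ} {C L : ℝ} (hL : 0 < L)
    (hC : ∀ ρ, 0 ≤ ρ → |Φ ρ| ≤ C * ρ) (hL0 : ∀ ρ, L ≤ ρ → Φ ρ = 0) {r : ℝ} (hr : 0 < r)
    (σ v : ℝ) :
    ‖logProfile Φ r σ v‖ ≤ indicator (Iic (Real.log (L / r)))
      (fun v => C * r * Real.exp ((1 + σ) * v)) v := by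
  by_cases hv : v ≤ Real.log (L / r)
  · rw [indicator_of_mem (mem_Iic.2 hv), logProfile, Complex.norm_real, Real.norm_eq_abs,
      abs_mul, Real.abs_exp, show (1 + σ) * v = v + σ * v by ring, Real.exp_add, ← mul_assoc]
    refine mul_le_mul_of_nonneg_right ?_ (Real.exp_pos _).le
    rw [mul_assoc]
    exact hC _ (by positivity)
  · have h1 : L ≤ r * Real.exp v := by
      have h2 : L / r ≤ Real.exp v := by
        rw [← Real.exp_log (div_pos hL hr)]
        exact Real.exp_le_exp.2 (not_le.1 hv).le
      rwa [div_le_iff₀' hr] at h2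
    rw [indicator_of_notMem (by simpa using hv), logProfile, hL0 _ h1]
    simp

theorem integrable_logProfile {Φ : ℝ → ℝ} (hΦ : Continuous Φ) {C L : ℝ} (hL : 0 < L)
    (hC : ∀ ρ, 0 ≤ ρ → |Φ ρ| ≤ C * ρ) (hL0 : ∀ ρ, L ≤ ρ → Φ ρ = 0) {r : ℝ} (hr : 0 < r)
    {σ : ℝ} (hσ : 0 < σ) : Integrable (logProfile Φ r σ) := by
  refine Integrable.mono' ?_ (continuous_logProfile hΦ r σ).aestronglyMeasurable
    (Eventually.of_forall fun v => norm_logProfile_le hL hC hL0 hr σ v)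
  refine (integrable_indicator_iff measurableSet_Iic).2 (Integrable.const_mul ?_ _)
  exact integrableOn_exp_mul_Iic (by linarith) _

theorem norm_logProfile_le_const {Φ : ℝ → ℝ} {C L : ℝ} (hL : 0 < L)
    (hC : ∀ ρ, 0 ≤ ρ → |Φ ρ| ≤ C * ρ) (hL0 : ∀ ρ, L ≤ ρ → Φ ρ = 0) {r : ℝ} (hr : 0 < r)
    {σ : ℝ} (hσ : 0 < σ) (v : ℝ) :
    ‖logProfile Φ r σ v‖ ≤ C * r * Real.exp ((1 + σ) * Real.log (L / r)) := by
  have hC0 : 0 ≤ C := by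
    have := (abs_nonneg _).trans (hC 1 zero_le_one)
    linarith
  refine (norm_logProfile_le hL hC hL0 hr σ v).trans ?_
  by_cases hv : v ≤ Real.log (L / r)
  · rw [indicator_of_mem (mem_Iic.2 hv)]
    gcongr
  · rw [indicator_of_notMem (by simpa using hv)]
    positivity

theorem integral_comp_mul_exp {r : ℝ} (hr : 0 < r) (g : ℝ → ℂ) :
    ∫ ρ in Ioi (0 : ℝ), g ρ = ∫ v : ℝ, (r * Real.exp v) • g (r * Real.exp v) := by
  have hder : ∀ v ∈ (univ : Set ℝ), HasDerivWithinAt (fun v => r * Real.exp v)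
      (r * Real.exp v) univ v :=
    fun v _ => ((Real.hasDerivAt_exp v).const_mul r).hasDerivWithinAt
  have hinj : InjOn (fun v => r * Real.exp v) univ := fun a _ b _ h =>
    Real.exp_injective (mul_left_cancel₀ hr.ne' h)
  have himg : (fun v => r * Real.exp v) '' univ = Ioi 0 := by
    ext ρ
    simp only [image_univ, mem_range, mem_Ioi]
    constructor
    · rintro ⟨v, rfl⟩; positivity
    · intro hρ
      exact ⟨Real.log (ρ / r), by rw [Real.exp_log (by positivity)]; field_simp⟩
  have h := integral_image_eq_integral_abs_deriv_smul MeasurableSet.univ hder hinj g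
  rw [himg, Measure.restrict_univ] at h
  rw [h]
  refine integral_congr_ae (Eventually.of_forall fun v => ?_)
  simp only
  rw [abs_of_pos (by positivity)]

/-- Substitution ρ = r e^v in the Mellin integral, where ρ^s = r^s e^{σv} e^{itv}. -/
theorem fourierInt_logProfile {Φ : ℝ → ℝ} {r : ℝ} (hr : 0 < r) (σ t : ℝ) :
    fourierInt (logProfile Φ r σ) t = (r : ℂ) ^ (-((σ : ℂ) + t * Complex.I)) *
      mellin (fun ρ => (Φ ρ : ℂ)) ((σ : ℂ) + t * Complex.I) := by
  set s : ℂ := (σ : ℂ) + t * Complex.I with hs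
  rw [mellin, integral_comp_mul_exp hr, ← integral_const_mul, fourierInt]
  refine integral_congr_ae (Eventually.of_forall fun v => ?_)
  simp only
  have hρ : ((r * Real.exp v : ℝ) : ℂ) ≠ 0 := by
    exact_mod_cast (mul_pos hr (Real.exp_pos v)).ne'
  have hr' : (r : ℂ) ≠ 0 := by exact_mod_cast hr.ne'
  have h1 : ((r * Real.exp v : ℝ) : ℂ) * ((r * Real.exp v : ℝ) : ℂ) ^ (s - 1) =
      (r : ℂ) ^ s * Complex.exp (v * s) := by
    rw [Complex.cpow_sub _ _ hρ, Complex.cpow_one, mul_div_cancel₀ _ hρ, Complex.ofReal_mul,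
      Complex.mul_cpow_ofReal_nonneg hr.le (Real.exp_pos v).le]
    congr 1
    rw [Complex.cpow_def_of_ne_zero (by exact_mod_cast (Real.exp_pos v).ne'),
      ← Complex.ofReal_log (Real.exp_pos v).le, Real.log_exp]
  have h2 : (r : ℂ) ^ (-s) * (r : ℂ) ^ s = 1 := by
    rw [← Complex.cpow_add _ _ hr']; simp
  rw [Complex.real_smul, smul_eq_mul, ← mul_assoc ((r * Real.exp v : ℝ) : ℂ), h1, logProfile]
  have h3 : Complex.exp (v * s) =
      ((Real.exp (σ * v) : ℝ) : ℂ) * Complex.exp ((t * v : ℝ) * Complex.I) := by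
    push_cast
    rw [← Complex.exp_add, hs]
    congr 1; ring
  rw [h3, Complex.ofReal_mul]
  linear_combination (-((Φ (r * Real.exp v) : ℂ) * ((Real.exp (σ * v) : ℝ) : ℂ) *
    Complex.exp ((t * v : ℝ) * Complex.I))) * h2

/-- Fubini together with the scaling k ↦ kρ: for fixed ρ the k-integral is ρ^{s-1} MK₀(1-s). Here Re
s < 1 makes MK₀(1-s) converge, and Re s > 0 with |Φ(ρ)| ≤ Cρ handles ρ near 0. -/
theorem mellin_besselK0_transform {Φ ψ : ℝ → ℝ} (hΦ : Continuous Φ) {C L : ℝ}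
    (hC : ∀ ρ, 0 ≤ ρ → |Φ ρ| ≤ C * ρ) (hL0 : ∀ ρ, L ≤ ρ → Φ ρ = 0)
    (hψ : ∀ k, 0 < k → ψ k = ∫ ρ in Ioi (0 : ℝ), Φ ρ * besselK0 (k * ρ))
    {s : ℂ} (h0 : 0 < s.re) (h1 : s.re < 1) :
    MellinConvergent (fun k => (ψ k : ℂ)) (1 - s) ∧
    mellin (fun k => (ψ k : ℂ)) (1 - s) =
      (2 : ℂ) ^ (1 - s) / 4 * Complex.Gamma ((1 - s) / 2) ^ 2 *
        mellin (fun ρ => (Φ ρ : ℂ)) s := by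
  have hre : 0 < (1 - s).re := by simpa using h1
  obtain ⟨hKc, hKv⟩ := mellin_besselK0 hre
  have hC0 : 0 ≤ C := by
    have := (abs_nonneg _).trans (hC 1 zero_le_one)
    linarith
  set ν : Measure ℝ := volume.restrict (Ioi (0 : ℝ)) with hν
  set K : ℝ → ℝ → ℂ := fun k ρ =>
    (k : ℂ) ^ (1 - s - 1) * ((Φ ρ * besselK0 (k * ρ) : ℝ) : ℂ) with hK
  have hmeas : AEStronglyMeasurable (Function.uncurry K) (ν.prod ν) := by
    refine Measurable.aestronglyMeasurable ?_
    have h1 := measurable_besselK0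
    have h2 := hΦ.measurable
    simp only [hK, Function.uncurry_def]
    fun_prop
  have hslice : ∀ ρ : ℝ, 0 < ρ → Integrable (fun k => K k ρ) ν := fun ρ hρ => by
    have h := ((MellinConvergent.comp_mul_left hρ).2 hKc).const_mul (Φ ρ : ℂ)
    refine h.congr (Eventually.of_forall fun k => ?_)
    simp only [hK, smul_eq_mul]
    rw [mul_comm k]
    push_cast; ring
  set c : ℝ := ∫ u in Ioi (0 : ℝ), u ^ (-s.re) * besselK0 u with hc
  have hnorm : ∀ ρ : ℝ, 0 < ρ → ∫ k in Ioi (0 : ℝ), ‖K k ρ‖ = |Φ ρ| * (ρ ^ (s.re - 1) * c) :=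
    fun ρ hρ => by
      have e1 : ∀ k ∈ Ioi (0 : ℝ), ‖K k ρ‖ =
          (|Φ ρ| * ρ ^ s.re) * ((ρ * k) ^ (-s.re) * besselK0 (ρ * k)) := fun k hk => by
        have hk : 0 < k := hk
        simp only [hK]
        rw [norm_mul, Complex.norm_cpow_eq_rpow_re_of_pos hk, Complex.norm_real,
          Real.norm_eq_abs, abs_mul, abs_of_nonneg (besselK0_nonneg _),
          Real.mul_rpow hρ.le hk.le, mul_comm ρ k, show (1 - s - 1).re = -s.re by simp,
          Real.rpow_neg hρ.le]
        have := (Real.rpow_pos_of_pos hρ s.re).ne'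
        field_simp
      rw [setIntegral_congr_fun measurableSet_Ioi e1, integral_const_mul,
        integral_comp_mul_left_Ioi (fun u => u ^ (-s.re) * besselK0 u) 0 hρ, mul_zero,
        smul_eq_mul, Real.rpow_sub_one hρ.ne']
      ring
  have hpos : ∀ᵐ ρ ∂ν, 0 < ρ := ae_restrict_mem measurableSet_Ioi
  have hΦint : Integrable (fun ρ => |Φ ρ| * (ρ ^ (s.re - 1) * c)) ν := by
    have hc0 : 0 ≤ c := setIntegral_nonneg measurableSet_Ioi fun u hu =>
      mul_nonneg (Real.rpow_nonneg (le_of_lt hu) _) (besselK0_nonneg _)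
    have hG : IntegrableOn (indicator (Iio L) fun _ => C * L ^ s.re * c) (Ioi (0 : ℝ)) := by
      rw [IntegrableOn, integrable_indicator_iff measurableSet_Iio, IntegrableOn,
        Measure.restrict_restrict measurableSet_Iio]
      exact integrable_const_iff.2 (Or.inr ⟨by rw [Measure.restrict_apply_univ, inter_comm, Ioi_inter_Iio]; simp⟩)
    refine hG.mono' ?_ ?_
    · have h2 := hΦ.measurable
      exact Measurable.aestronglyMeasurable (by fun_prop)
    · filter_upwards [hpos] with ρ hρ
      rw [Real.norm_of_nonneg (by positivity)]
      by_cases hρL : ρ < L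
      · rw [indicator_of_mem (mem_Iio.2 hρL), ← mul_assoc]
        refine mul_le_mul_of_nonneg_right ?_ hc0
        calc _ ≤ C * ρ * ρ ^ (s.re - 1) := by
              have := hC ρ hρ.le
              gcongr
          _ = C * ρ ^ s.re := by rw [Real.rpow_sub_one hρ.ne']; field_simp
          _ ≤ _ := by gcongr
      · rw [hL0 ρ (not_lt.1 hρL), indicator_of_notMem (by simpa using hρL)]
        simp
  have hint : Integrable (Function.uncurry K) (ν.prod ν) := by
    refine (integrable_prod_iff' hmeas).2 ⟨?_, ?_⟩
    · filter_upwards [hpos] with ρ hρ using hslice ρ hρ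
    · refine hΦint.congr ?_
      filter_upwards [hpos] with ρ hρ using (hnorm ρ hρ).symm
  have hinner : ∀ k : ℝ, 0 < k → ∫ ρ, K k ρ ∂ν = (k : ℂ) ^ (1 - s - 1) • (ψ k : ℂ) :=
    fun k hk => by
      simp only [hK]
      rw [integral_const_mul, integral_complex_ofReal, hψ k hk, smul_eq_mul]
  constructor
  · refine hint.integral_prod_left.congr ?_
    filter_upwards [hpos] with k hk using hinner k hk
  · have hswap := integral_integral_swap hint
    have e1 : ∫ k, ∫ ρ, K k ρ ∂ν ∂ν = mellin (fun k => (ψ k : ℂ)) (1 - s) := by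
      rw [mellin]
      refine integral_congr_ae ?_
      filter_upwards [hpos] with k hk using hinner k hk
    rw [← e1, hswap, mellin, ← hKv, ← integral_const_mul]
    refine integral_congr_ae ?_
    filter_upwards [hpos] with ρ hρ
    have h3 := mellin_comp_mul_left (fun u => (besselK0 u : ℂ)) (1 - s) hρ
    have e2 : ∫ k, K k ρ ∂ν = (Φ ρ : ℂ) * mellin (fun u => (besselK0 (ρ * u) : ℂ)) (1 - s) := by
      rw [mellin, ← integral_const_mul]
      refine integral_congr_ae (Eventually.of_forall fun k => ?_)
      simp only [hK, smul_eq_mul]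
      rw [mul_comm k]
      push_cast; ring
    rw [e2, h3, smul_eq_mul, smul_eq_mul, neg_sub]
    ring

/-- The substitution ρ = r e^v transports Dini's condition from r to 0, because ρ - r is comparable
with v; the factor e^{σv} adds only a bounded term. -/
theorem integrableAtFilter_logProfile {Φ : ℝ → ℝ} (hΦ : Continuous Φ) {r : ℝ} (hr : 0 < r)
    {σ : ℝ} (hσ0 : 0 < σ) (hσ1 : σ < 1)
    (h : IntegrableAtFilter (fun ρ : ℝ => (Φ ρ - Φ r) / (ρ - r)) (𝓝 r) volume) :
    IntegrableAtFilter (fun v : ℝ => (logProfile Φ r σ v - logProfile Φ r σ 0) / (v : ℂ))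
      (𝓝 0) volume := by
  obtain ⟨s, hs, hint⟩ := h
  set φ : ℝ → ℝ := fun v => r * Real.exp v with hφ
  have hφc : Continuous φ := by fun_prop
  have hpre : φ ⁻¹' s ∈ 𝓝 0 := hφc.continuousAt.preimage_mem_nhds (by simpa [hφ] using hs)
  obtain ⟨ε, hε, hεs⟩ := Metric.mem_nhds_iff.1 hpre
  set V := Metric.ball (0 : ℝ) (min ε 1) with hV
  have hVs : φ '' V ⊆ s := by
    rintro _ ⟨v, hv, rfl⟩
    exact hεs (Metric.ball_subset_ball (min_le_left _ _) hv)
  have hder : ∀ v ∈ V, HasDerivWithinAt φ (r * Real.exp v) V v :=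
    fun v _ => ((Real.hasDerivAt_exp v).const_mul r).hasDerivWithinAt
  have hinj : InjOn φ V := fun a _ b _ h => Real.exp_injective (mul_left_cancel₀ hr.ne' h)
  have hq := (integrableOn_image_iff_integrableOn_abs_deriv_smul measurableSet_ball hder hinj _).1
    (hint.mono_set hVs)
  refine ⟨V, Metric.ball_mem_nhds _ (lt_min hε one_pos), ?_⟩
  have hcst : IntegrableOn (fun _ : ℝ => |Φ r| * 2) V :=
    integrableOn_const measure_ball_lt_top.ne
  refine Integrable.mono' ((hq.norm.const_mul (2 * Real.exp 1)).add hcst) ?_ ?_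
  · have := (continuous_logProfile hΦ r σ).measurable
    exact Measurable.aestronglyMeasurable (by fun_prop)
  · filter_upwards [ae_restrict_mem measurableSet_ball] with v hv
    have hv1 : |v| ≤ 1 := by
      rw [mem_ball_zero_iff, Real.norm_eq_abs] at hv
      exact hv.le.trans (min_le_right _ _)
    -- At v = 0 both quotients take the default value 0 of division by zero.
    rcases eq_or_ne v 0 with rfl | hv0
    · simp only [Complex.ofReal_zero, div_zero, norm_zero, Pi.add_apply]
      positivity
    have hvpos : 0 < |v| := abs_pos.2 hv0
    have hE : 0 < r * Real.exp v := by positivity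
    have hsub : r * Real.exp v - r ≠ 0 := by
      intro h0
      have : Real.exp v = 1 := by
        have h2 : r * Real.exp v = r * 1 := by linarith
        exact mul_left_cancel₀ hr.ne' h2
      exact hv0 (Real.exp_eq_one_iff v |>.1 this)
    rw [logProfile_zero, logProfile, norm_div, ← Complex.ofReal_sub, Complex.norm_real,
      Complex.norm_real, Real.norm_eq_abs, Real.norm_eq_abs, div_le_iff₀ hvpos]
    simp only [Pi.add_apply, hφ, smul_eq_mul, norm_mul, norm_div, Real.norm_eq_abs, abs_abs,
      abs_of_pos hE]
    have e1 : Φ (r * Real.exp v) * Real.exp (σ * v) - Φ r =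
        Real.exp (σ * v) * (Φ (r * Real.exp v) - Φ r) + Φ r * (Real.exp (σ * v) - 1) := by ring
    have b1 : |Real.exp (σ * v) - 1| ≤ 2 * |v| := by
      have hσv : |σ * v| ≤ |v| := by
        rw [abs_mul, abs_of_pos hσ0]
        exact mul_le_of_le_one_left (abs_nonneg _) hσ1.le
      exact (Real.abs_exp_sub_one_le (hσv.trans hv1)).trans (by linarith)
    -- This bound trades the denominator v for ρ - r at the cost of exactly the Jacobian r e^v that
    -- occurs in `hq`.
    have b2 : |r * Real.exp v - r| ≤ r * Real.exp v * (2 * |v|) := by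
      have h2 := Real.abs_exp_sub_one_le (x := -v) (by rwa [abs_neg])
      rw [abs_neg] at h2
      have h3 : r * Real.exp v - r = -(r * Real.exp v * (Real.exp (-v) - 1)) := by
        have : Real.exp v * Real.exp (-v) = 1 := by rw [← Real.exp_add]; simp
        linear_combination (r) * this
      rw [h3, abs_neg, abs_mul, abs_of_pos hE]
      gcongr
    have b3 : Real.exp (σ * v) ≤ Real.exp 1 := by
      refine Real.exp_le_exp.2 ((le_abs_self _).trans ?_)
      rw [abs_mul, abs_of_pos hσ0]
      nlinarith [abs_nonneg v]
    have habs : 0 < |r * Real.exp v - r| := abs_pos.2 hsub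
    rw [e1]
    refine (abs_add_le _ _).trans ?_
    rw [abs_mul, abs_mul, Real.abs_exp]
    have b4 : |Φ (r * Real.exp v) - Φ r| ≤ r * Real.exp v *
        (|Φ (r * Real.exp v) - Φ r| / |r * Real.exp v - r|) * (2 * |v|) := by
      rw [mul_div_assoc', div_mul_eq_mul_div, le_div_iff₀ habs]
      calc _ ≤ |Φ (r * Real.exp v) - Φ r| * (r * Real.exp v * (2 * |v|)) := by gcongr
        _ = _ := by ring
    calc _ ≤ Real.exp 1 * (r * Real.exp v *
          (|Φ (r * Real.exp v) - Φ r| / |r * Real.exp v - r|) * (2 * |v|)) +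
          |Φ r| * (2 * |v|) := by gcongr
      _ = _ := by ring

/-! ### The inversion formula -/

theorem sphericalMean_eq_zero {f : ℂ → ℝ} {R : ℝ} (hR : tsupport f ⊆ Metric.ball 0 R) (x : ℂ)
    {r : ℝ} (hr : R + ‖x‖ ≤ r) : sphericalMean f x r = 0 := by
  have h : ∀ θ : ℝ, f (x + (r : ℂ) * Complex.exp ((θ : ℂ) * Complex.I)) * r = 0 := fun θ => by
    suffices h0 : x + (r : ℂ) * Complex.exp ((θ : ℂ) * Complex.I) ∉ tsupport f by
      rw [image_eq_zero_of_notMem_tsupport h0, zero_mul]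
    intro hmem
    have h1 := hR hmem
    rw [mem_ball_zero_iff] at h1
    have h2 := norm_sub_norm_le ((r : ℂ) * Complex.exp ((θ : ℂ) * Complex.I)) (-x)
    rw [sub_neg_eq_add, norm_neg, norm_mul, Complex.norm_exp_ofReal_mul_I, mul_one,
      Complex.norm_real, add_comm _ x] at h2
    linarith [le_abs_self r, Real.norm_eq_abs r]
  simp [sphericalMean, h]

end ParabolaMeans

theorem theorem2p1 (η₀ : ℝ) (hη₀ : 0 < η₀) (f : ℂ → ℝ) (hf : Continuous f)
    (hcs : HasCompactSupport f)
    (hsupp : ∀ ξ η : ℝ, η₀ ≤ η → f (parabolicPoint ξ η) = 0)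
    (D : ℝ → ℝ → ℝ)
    (hD : ∀ ξ r : ℝ, 0 ≤ r → D ξ r = sphericalMean f (parabolicPoint ξ η₀) r) :
    -- the double integrals that define the coefficients converge absolutely
    (∀ (m : ℕ) (k : ℝ), 0 < k →
      Integrable (fun p : ℝ × ℝ => momentIntegrand D m k p.1 p.2)
        (volume.prod (volume.restrict (Ioi (0 : ℝ))))) ∧
    ∀ ξ η : ℝ, η₀ ≤ η →
      -- the series that defines `Ψ` converges
      (∀ k : ℝ, 0 < k → Summable (psiTerm D η₀ ξ η k)) ∧
      -- the Mellin transform of `Ψ` at `1 - s` converges absolutely for `0 < Re s < 1`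
      (∀ s : ℂ, 0 < s.re → s.re < 1 →
        MellinConvergent (fun k : ℝ => (psi D η₀ ξ η k : ℂ)) (1 - s)) ∧
      -- the degenerate circle `r = 0`
      sphericalMean f (parabolicPoint ξ η) 0 = 0 ∧
      -- the inversion formula
      ∀ r : ℝ, 0 < r → ∀ σ : ℝ, 0 < σ → σ < 1 →
        (∃ A : ℂ, HasCesaroLineIntegral (inversionIntegrand D η₀ ξ η r) σ A ∧
          (sphericalMean f (parabolicPoint ξ η) r : ℂ) = 1 / (Complex.I * Real.pi) * A) ∧
        (∀ A : ℂ, HasLineIntegral (inversionIntegrand D η₀ ξ η r) σ A →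
          (sphericalMean f (parabolicPoint ξ η) r : ℂ) = 1 / (Complex.I * Real.pi) * A) ∧
        (IntegrableAtFilter
            (fun ρ : ℝ => (sphericalMean f (parabolicPoint ξ η) ρ -
              sphericalMean f (parabolicPoint ξ η) r) / (ρ - r)) (𝓝 r) volume →
          ∃ A : ℂ, HasLineIntegral (inversionIntegrand D η₀ ξ η r) σ A ∧
            (sphericalMean f (parabolicPoint ξ η) r : ℂ) = 1 / (Complex.I * Real.pi) * A) := by
  obtain ⟨M, hM⟩ := hcs.exists_bound_of_continuous hf
  refine ⟨fun m k hk => integrable_momentIntegrand hf hM hD m hk, fun ξ η hη => ?_⟩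
  have hψ := fun k (hk : 0 < k) => hasSum_psiTerm hη₀ hf hcs hsupp hD ξ hη hk
  obtain ⟨R, hR0, hR⟩ := hcs.isCompact.isBounded.subset_ball_lt 0 0
  set x := parabolicPoint ξ η with hx
  set Φ : ℝ → ℝ := sphericalMean f x with hΦ
  have hΦc : Continuous Φ :=
    (continuous_sphericalMean hf).comp (f := fun r : ℝ => (x, r)) (by fun_prop)
  have hΦC : ∀ ρ, 0 ≤ ρ → |Φ ρ| ≤ 2 * Real.pi * M * ρ := fun ρ hρ => abs_sphericalMean_le hM x hρ
  have hL : 0 < R + ‖x‖ := by positivity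
  have hΦL : ∀ ρ, R + ‖x‖ ≤ ρ → Φ ρ = 0 := fun ρ hρ => sphericalMean_eq_zero hR x hρ
  have hmel := fun s (h0 : 0 < Complex.re s) (h1 : s.re < 1) =>
    mellin_besselK0_transform hΦc hΦC hΦL (fun k hk => (hψ k hk).2) h0 h1
  refine ⟨fun k hk => (hψ k hk).1, fun s h0 h1 => (hmel s h0 h1).1, by simp [hΦ, sphericalMean],
    fun r hr σ hσ0 hσ1 => ?_⟩
  set G := inversionIntegrand D η₀ ξ η r with hG
  set g := logProfile Φ r σ with hg
  have hgi : Integrable g := integrable_logProfile hΦc hL hΦC hΦL hr hσ0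
  have hgc : Continuous g := continuous_logProfile hΦc r σ
  have hgB := norm_logProfile_le_const hL hΦC hΦL hr hσ0
  have hg0 : g 0 = Φ r := logProfile_zero Φ r σ
  -- The Γ² factors cancel and 2^s · 2^{1-s}/4 = 1/2, so on the line the integrand is half the
  -- Fourier integral of the log profile.
  have hGg : ∀ t : ℝ, G ((σ : ℂ) + t * Complex.I) = 1 / 2 * fourierInt g t := fun t => by
    set s : ℂ := (σ : ℂ) + t * Complex.I with hs
    have hsre : s.re = σ := by simp [hs]
    have hΓ : Complex.Gamma ((1 - s) / 2) ≠ 0 := by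
      refine Complex.Gamma_ne_zero_of_re_pos ?_
      have : ((1 - s) / 2).re = (1 - σ) / 2 := by
        rw [← hsre]; simp
      rw [this]; linarith
    have h2 : (2 : ℂ) ^ s * (2 : ℂ) ^ (1 - s) = 2 := by
      rw [← Complex.cpow_add _ _ two_ne_zero]; simp
    rw [hG, hg, fourierInt_logProfile hr, inversionIntegrand,
      (hmel s (by rwa [hsre]) (by rwa [hsre])).2, div_eq_iff (pow_ne_zero 2 hΓ)]
    linear_combination (1 / 4 * (r : ℂ) ^ (-s) * Complex.Gamma ((1 - s) / 2) ^ 2 *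
      mellin (fun ρ => (Φ ρ : ℂ)) s) * h2
  have hGfun : (fun t : ℝ => G ((σ : ℂ) + t * Complex.I)) = fun t => 1 / 2 * fourierInt g t :=
    funext hGg
  have hII : ∀ T : ℝ, IntervalIntegrable (fun t : ℝ => G ((σ : ℂ) + t * Complex.I)) volume
      (-T) T := fun T => by
    rw [hGfun]
    exact ((continuous_fourierInt hgi).const_mul _).intervalIntegrable _ _
  have hseg : ∀ T : ℝ, segmentIntegral G σ T =
      Complex.I / 2 * ∫ t in (-T)..T, fourierInt g t := fun T => by
    rw [segmentIntegral, hGfun, intervalIntegral.integral_const_mul]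
    ring
  have hsegc : Continuous (segmentIntegral G σ) := by
    rw [funext hseg]
    exact (continuous_integral_symm (continuous_fourierInt hgi)).const_mul _
  -- The common limit: i from ds, 1/2 from the integrand and 2π g(0) from Fourier inversion, in
  -- total iπ Φ(r).
  set A₀ : ℂ := Complex.I / 2 * (g 0 * (2 * Real.pi)) with hA₀
  have hA₀v : (Φ r : ℂ) = 1 / (Complex.I * Real.pi) * A₀ := by
    have : (Real.pi : ℂ) ≠ 0 := by exact_mod_cast Real.pi_ne_zero
    rw [hA₀, hg0]
    field_simp
  have hces : Tendsto (fun T : ℝ => (T : ℂ)⁻¹ * ∫ τ in (0 : ℝ)..T, segmentIntegral G σ τ) atTop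
      (𝓝 A₀) := by
    refine ((tendsto_cesaro_fourierInt hgi hgc hgB).const_mul (Complex.I / 2)).congr fun T => ?_
    simp_rw [hseg]
    rw [intervalIntegral.integral_const_mul]
    ring
  refine ⟨⟨A₀, ⟨hII, hces⟩, hA₀v⟩, fun A hA => ?_, fun hd => ⟨A₀, ⟨hII, ?_⟩, hA₀v⟩⟩
  -- An ordinary limit is also a Cesàro limit, so it must be A₀.
  · rw [hA₀v, tendsto_nhds_unique hces (tendsto_average hsegc hA.2)]
  · have hlim := tendsto_fourierInt_of_dini hgi
      (integrableAtFilter_logProfile hΦc hr hσ0 hσ1 hd)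
    refine (hlim.const_mul (Complex.I / 2)).congr fun T => (hseg T).symm
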